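/- For an open set $X\subset\mathbb C^n$ let $\mathrm{PSH}(X)$ be the set of plurisubharmonic functions $X\to[-\infty,\infty)$ (including $-\infty$), and for $u\in\mathrm{PSH}(X)$ let $\nu_u(p)=\lim_{r\to0}\sup_{|z-p|=r}u(z)/\log r$ be its Lelong number. For $\alpha\ge 0$ on $X$ put $G_\alpha=\sup\{u\in\mathrm{PSH}(X): u\le 0,\ \nu_u\ge\alpha\}$. Write $G_a=G_{\chi_{\{a\}}}$ for $a\in X$ and, for a closed analytic subset $A$ of $X$, $G_A=G_{\nu_A}$, where $\nu_A(p)$ is the Lelong number at $p$ of $\max_i\log|f_i|$ for generators $f_i$ of the stalk at $p$ of the ideal sheaf of $A$. With $\varrho(z,w)=\tanh^{-1}\left|\frac{z-w}{1-\bar wz}\right|$ the Poincaré distance of the unit disc $\mathbb D$, let $\delta_X(x,a)=\inf\{\varrho(z,w): f\in\mathcal O(\mathbb D,X),\ f(z)=x,\ f(w)=a\}$, let the Kobayashi pseudodistance $\kappa_X$ be the largest pseudodistance $\le\delta_X$, let $c_X(x,y)=\sup\{\varrho(f(x),f(y)): f\in\mathcal O(X,\mathbb D)\}$ be the Carathéodory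 (pseudo)distance, and put $k_A(x)=\inf_{a\in X}\nu_A(a)\log\tanh\delta_X(x,a)$. Let $c_X(x,A)=\inf_{a\in A}c_X(x,a)$, and similarly for $\kappa_X$. The Carathéodory distance from $y\in Y$ to the boundary of an open set $Y$ is $c_Y(y,\partial Y)=\inf_{p\in\partial Y}\liminf_{Y\ni x\to p}c_Y(y,x)$. There is a smooth complex curve (a closed one-dimensional complex submanifold) in $\mathbb C^2$ whose intersection $A$ with the open unit ball $X$ of $\mathbb C^2$ is nonempty and connected and such that: 1. $G_A\ne\inf_{a\in A}G_a$ on $X$; 2. the functions $\inf_{a\in A}G_a$, $k_A$, $\log\tanh c_X(\cdot,A)$ and $\log\tanh\kappa_X(\cdot,A)$ are all equal on $X$, and they are not plurisubharmonic on $X$; 3. $\log\tanh c_X(\cdot,A)\le G_A$ does not hold on all of $X$, even though $\log\tanh c_X(\cdot,a)\le G_a$ on $X$ for every $a\in X$. Furthermore, $Y=X\setminus A$ is a bounded pseudoconvex domain, $c_Y=c_X$ on $Y\times Y$, $c_Y(y,\partial Y)=c_X(y,A)$ for every $y\in Y$, and $\log\tanh c_Y(\cdot,\partial Y)$ is not plurisubharmonic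 on $Y$. -/

import Mathlib

open Set Filter Topology MeasureTheory

noncomputable section

section General

variable {E : Type*} [NormedAddCommGroup E] [NormedSpace ℂ E]

/-- The mean of `u` over the circle `θ ↦ a + r e^{iθ} b`, as (mean of the positive part) minus
(mean of the negative part). If `u` is bounded above on the circle then the first term is
finite and the mean is a number in `[-∞, ∞)`. -/
def circleMean (u : E → EReal) (a b : E) (r : ℝ) : EReal :=
  (((ENNReal.ofReal (2 * Real.pi))⁻¹ *
      ∫⁻ θ in Ioc 0 (2 * Real.pi), (u (a + circleMap 0 r θ • b)).toENNReal : ENNReal) : EReal) -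
  (((ENNReal.ofReal (2 * Real.pi))⁻¹ *
      ∫⁻ θ in Ioc 0 (2 * Real.pi), (-u (a + circleMap 0 r θ • b)).toENNReal : ENNReal) : EReal)

/-- Plurisubharmonic functions on an open set `X`: upper semicontinuous with values in
`[-∞, ∞)`, and satisfying the local submean inequality on every complex line.
The constant `-∞` is included. Only the values of `u` on `X` matter. -/
def IsPSH (X : Set E) (u : E → EReal) : Prop :=
  UpperSemicontinuousOn u X ∧ (∀ a ∈ X, u a < ⊤) ∧
    ∀ a ∈ X, ∀ b : E, ∀ᶠ r in 𝓝[>] (0 : ℝ), u a ≤ circleMean u a b r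

/-- The Lelong number `lim_{r → 0} (sup_{|z - p| = r} u z) / log r`. The limit exists for every
`u` that is plurisubharmonic near `p`, so it is the lower limit. -/
def lelongNumber (u : E → EReal) (p : E) : EReal :=
  liminf (fun r : ℝ => (⨆ z ∈ Metric.sphere p r, u z) / ((Real.log r : ℝ) : EReal)) (𝓝[>] 0)

/-- The family of negative plurisubharmonic functions on `X` whose Lelong numbers are at
least `α`. -/
def greenFamily (X : Set E) (α : E → EReal) : Set (E → EReal) :=
  {u | IsPSH X u ∧ (∀ x ∈ X, u x ≤ 0) ∧ ∀ a ∈ X, α a ≤ lelongNumber u a}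

/-- The Green function `G_α = sup F_α`. -/
def green (X : Set E) (α : E → EReal) (x : E) : EReal :=
  ⨆ u ∈ greenFamily X α, u x

/-- The pluricomplex Green function with a logarithmic pole at the point `a`. -/
def greenPoint (X : Set E) (a : E) : E → EReal :=
  green X (({a} : Set E).indicator fun _ => 1)

/-- `f` is holomorphic in a neighbourhood of `p`. -/
def HolomorphicNear (f : E → ℂ) (p : E) : Prop :=
  ∀ᶠ z in 𝓝 p, DifferentiableAt ℂ f z

/-- The germ of `f` at `p` belongs to the stalk at `p` of the ideal sheaf of `A`. -/
def InIdealStalk (A : Set E) (p : E) (f : E → ℂ) : Prop :=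
  HolomorphicNear f p ∧ ∀ᶠ z in 𝓝 p, z ∈ A → f z = 0

/-- The germs of `f 0, …, f (m - 1)` at `p` generate the stalk at `p` of the ideal sheaf
of `A`. -/
def GeneratesIdealStalk (A : Set E) (p : E) {m : ℕ} (f : Fin m → E → ℂ) : Prop :=
  (∀ i, InIdealStalk A p (f i)) ∧
    ∀ g : E → ℂ, InIdealStalk A p g → ∃ h : Fin m → E → ℂ,
      (∀ i, HolomorphicNear (h i) p) ∧ ∀ᶠ z in 𝓝 p, g z = ∑ i, h i z * f i z

/-- The multiplicity `ν_A(p)`: the Lelong number at `p` of `max_i log |f_i|`, where the `f_i` are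
generators of the stalk of the ideal sheaf of `A` at `p`. It does not depend on the choice of
generators, so the infimum over all choices is this common value. -/
def multiplicityAlong (A : Set E) (p : E) : EReal :=
  ⨅ (m : ℕ) (f : Fin m → E → ℂ) (_ : GeneratesIdealStalk A p f),
    lelongNumber (fun z => ⨆ i, ENNReal.log ‖f i z‖ₑ) p

/-- The pluricomplex Green function with a logarithmic pole along `A`. -/
def greenAlong (X A : Set E) : E → EReal :=
  green X (multiplicityAlong A)

/-- The Poincaré distance in the unit disc. -/
def poincareDist (z w : ℂ) : ℝ :=
  Real.artanh ‖(z - w) / (1 - (starRingEnd ℂ) w * z)‖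

/-- `δ_X(x, a)`: the infimum of the Poincaré distances of `z` and `w` over all analytic discs `f`
in `X` with `f z = x` and `f w = a`. -/
def discDelta (X : Set E) (x a : E) : ENNReal :=
  ⨅ (f : ℂ → E) (_ : DifferentiableOn ℂ f (Metric.ball 0 1)) (_ : MapsTo f (Metric.ball 0 1) X)
    (z ∈ Metric.ball (0 : ℂ) 1) (w ∈ Metric.ball (0 : ℂ) 1) (_ : f z = x) (_ : f w = a),
    ENNReal.ofReal (poincareDist z w)

/-- `d` is a pseudodistance on `X` (nonnegativity follows). -/
def IsPseudodistOn (X : Set E) (d : E → E → ℝ) : Prop :=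
  (∀ x ∈ X, d x x = 0) ∧ (∀ x ∈ X, ∀ y ∈ X, d x y = d y x) ∧
    ∀ x ∈ X, ∀ y ∈ X, ∀ z ∈ X, d x z ≤ d x y + d y z

/-- The Kobayashi pseudodistance: the largest pseudodistance on `X` that is at most `δ_X`. -/
def kobayashiDist (X : Set E) (x y : E) : ENNReal :=
  ⨆ (d : E → E → ℝ) (_ : IsPseudodistOn X d)
    (_ : ∀ p ∈ X, ∀ q ∈ X, ENNReal.ofReal (d p q) ≤ discDelta X p q), ENNReal.ofReal (d x y)

/-- The Carathéodory (pseudo)distance: the supremum of the Poincaré distances of `f x` and `f y`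
over all holomorphic functions `f` from `X` to the unit disc. -/
def caratheodoryDist (X : Set E) (x y : E) : ENNReal :=
  ⨆ (f : E → ℂ) (_ : DifferentiableOn ℂ f X) (_ : MapsTo f X (Metric.ball 0 1)),
    ENNReal.ofReal (poincareDist (f x) (f y))

/-- The Carathéodory distance `c_X(x, A)` from a point to a subset of `X`. -/
def caratheodoryDistSet (X : Set E) (x : E) (A : Set E) : ENNReal :=
  ⨅ a ∈ A, caratheodoryDist X x a

/-- The Kobayashi distance from a point to a subset of `X`. -/
def kobayashiDistSet (X : Set E) (x : E) (A : Set E) : ENNReal :=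
  ⨅ a ∈ A, kobayashiDist X x a

/-- The Carathéodory distance from `y ∈ Y` to the boundary of `Y`: the infimum over the boundary
points `p` of the lower limit of `c_Y(y, x)` as `x ∈ Y` tends to `p`. -/
def caratheodoryDistBoundary (Y : Set E) (y : E) : ENNReal :=
  ⨅ p ∈ frontier Y, liminf (fun x => caratheodoryDist Y y x) (𝓝[Y] p)

/-- `log tanh` on `[0, ∞]`, with values in `[-∞, 0]`. -/
def logTanh (d : ENNReal) : EReal :=
  if d = ⊤ then 0 else ENNReal.log (ENNReal.ofReal (Real.tanh d.toReal))

/-- `k_X = log tanh δ_X`. -/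
def kFun (X : Set E) (x a : E) : EReal :=
  logTanh (discDelta X x a)

/-- `k_A(x) = inf_{a ∈ X} ν_A(a) k_X(x, a)`. -/
def kAlong (X A : Set E) (x : E) : EReal :=
  ⨅ a ∈ X, multiplicityAlong A a * kFun X x a

/-- A pseudoconvex open set: it has a continuous plurisubharmonic exhaustion function. -/
def IsPseudoconvex (Y : Set E) : Prop :=
  IsOpen Y ∧ ∃ φ : E → ℝ, ContinuousOn φ Y ∧ IsPSH Y (fun z => (φ z : EReal)) ∧
    ∀ t : ℝ, IsCompact {z ∈ Y | φ z ≤ t}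

end General

/-- A smooth complex curve in `ℂ²`: a nonempty closed one-dimensional complex submanifold, i.e. a
closed set given locally by one holomorphic equation with nonzero differential. -/
def IsSmoothCurve (C : Set (EuclideanSpace ℂ (Fin 2))) : Prop :=
  C.Nonempty ∧ IsClosed C ∧ ∀ p ∈ C, ∃ (U : Set (EuclideanSpace ℂ (Fin 2)))
    (f : EuclideanSpace ℂ (Fin 2) → ℂ), IsOpen U ∧ p ∈ U ∧ DifferentiableOn ℂ f U ∧
      fderiv ℂ f p ≠ 0 ∧ C ∩ U = {z ∈ U | f z = 0}

end

/-! The curve is `hyperbola`, z₀z₁ = 1/4. In the ball, everything with a single pole is explicit.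
Write φ_a for `ballMoebius a`. The complex line through a and x cuts the ball in a disc in which
‖φ_a(x)‖ is the pseudohyperbolic distance. Hence δ, κ and c all equal artanh ‖φ_a(x)‖
(`discDelta_ball`, `kobayashiDist_ball`, `caratheodoryDist_ball`), and G_a = log ‖φ_a‖
(`greenPoint_ball`). As ν_A is 1 on A and the other points do not affect the infimum defining k_A,
the four functions of item 2 are one function D(x) = inf_{a ∈ A} log ‖φ_a(x)‖, called
`logDistHyperbola`.

D violates the submean inequality at 0. Since φ_a(0) = a and ‖a‖² ≥ 2|a₀a₁| = 1/2 on the curve, D(0)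
≥ ½ log ½. But at ζ(1, 0) with 0 < |ζ| < 4/5, the pole ½(u, ū) with u = ζ/|ζ| gives a value below ½
log ½ that depends only on |ζ|. This is `not_isPSH_of_eq_logDistHyperbola`.

A competitor for G_A is a competitor for every G_a with a ∈ A, hence lies below D. On the circle |ζ|
= 1/2 one has D ≤ ½ log ⅓, so the maximum principle gives G_A(0) ≤ ½ log ⅓ < D(0)
(`greenAlong_hyperbola_zero_lt`). This yields items 1 and 3.

On Y, Riemann extension gives c_Y = c_X. Since c_X(y, ·) is continuous in the ball and tends to
infinity at the sphere, the distance to ∂Y is c_X(y, A). Its log tanh is D on Y, and 0 ∈ Y, so the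
same obstruction applies. -/

noncomputable section

/-! ### Circle means, the maximum principle and plurisubharmonicity of log ‖F‖ -/

section Submean

variable {E : Type*} [NormedAddCommGroup E] [NormedSpace ℂ E]

/-- This is x ≤ t with the negative parts moved across, a subtraction-free form that can be
integrated in `[0, ∞]`. -/
lemma EReal.toENNReal_add_neg_le {x : EReal} {t : ℝ} (h : x ≤ t) :
    x.toENNReal + ENNReal.ofReal (-t) ≤ ENNReal.ofReal t + (-x).toENNReal := by
  induction x with
  | bot => simp
  | top => simp at h
  | coe s =>
    have hst : s ≤ t := by exact_mod_cast h
    rw [← EReal.coe_neg, EReal.toENNReal_of_ne_top (by simp), EReal.toENNReal_of_ne_top (by simp),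
      EReal.toReal_coe, EReal.toReal_coe]
    rcases le_total 0 s with hs | hs
    · rw [ENNReal.ofReal_of_nonpos (by linarith : -t ≤ 0)]
      simpa using le_add_right (ENNReal.ofReal_le_ofReal hst)
    · rw [ENNReal.ofReal_of_nonpos hs, zero_add]
      exact le_add_left (ENNReal.ofReal_le_ofReal (by linarith))

lemma EReal.neg_toENNReal_add_le {x : EReal} {t : ℝ} (h : (t : EReal) ≤ x) :
    ENNReal.ofReal t + (-x).toENNReal ≤ x.toENNReal + ENNReal.ofReal (-t) := by
  have h' : -x ≤ ((-t : ℝ) : EReal) := by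
    rw [EReal.coe_neg]; exact EReal.neg_le_neg_iff.2 h
  have := EReal.toENNReal_add_neg_le h'
  rw [neg_neg, neg_neg] at this
  rwa [add_comm, add_comm x.toENNReal]

lemma circleAverage_eq_lintegral_sub {g : ℂ → ℝ} {r : ℝ}
    (hg : ContinuousOn g (Metric.sphere 0 |r|)) :
    (∫⁻ θ in Ioc 0 (2 * Real.pi), ENNReal.ofReal (g (circleMap 0 r θ))) ≠ ⊤ ∧
    (∫⁻ θ in Ioc 0 (2 * Real.pi), ENNReal.ofReal (-g (circleMap 0 r θ))) ≠ ⊤ ∧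
    Real.circleAverage g 0 r = (2 * Real.pi)⁻¹ *
      ((∫⁻ θ in Ioc 0 (2 * Real.pi), ENNReal.ofReal (g (circleMap 0 r θ))).toReal -
       (∫⁻ θ in Ioc 0 (2 * Real.pi), ENNReal.ofReal (-g (circleMap 0 r θ))).toReal) := by
  have hc : Continuous fun θ => g (circleMap 0 r θ) :=
    hg.comp_continuous (continuous_circleMap 0 r) fun θ => by simp
  have hi : IntegrableOn (fun θ => g (circleMap 0 r θ)) (Ioc 0 (2 * Real.pi)) :=
    (hc.integrableOn_Icc).mono_set Ioc_subset_Icc_self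
  refine ⟨?_, ?_, ?_⟩
  · exact hi.lintegral_lt_top.ne
  · exact hi.neg.lintegral_lt_top.ne
  · rw [Real.circleAverage_def, intervalIntegral.integral_of_le (by positivity),
      integral_eq_lintegral_pos_part_sub_lintegral_neg_part hi, smul_eq_mul]

/-- Circle means of `u` are never computed; this lemma and the next compare them with averages of
continuous functions. -/
lemma circleMean_le_circleAverage {u : E → EReal} {a b : E} {r : ℝ} {g : ℂ → ℝ}
    (hg : ContinuousOn g (Metric.sphere 0 |r|))
    (h : ∀ ζ ∈ Metric.sphere (0 : ℂ) |r|, u (a + ζ • b) ≤ g ζ) :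
    circleMean u a b r ≤ (Real.circleAverage g 0 r : ℝ) := by
  obtain ⟨hP, hN, he⟩ := circleAverage_eq_lintegral_sub hg
  have hc : Continuous fun θ => g (circleMap 0 r θ) :=
    hg.comp_continuous (continuous_circleMap 0 r) fun θ => by simp
  have hcn : Measurable fun θ => ENNReal.ofReal (-g (circleMap 0 r θ)) :=
    hc.neg.measurable.ennreal_ofReal
  rw [he]
  unfold circleMean
  have key : (∫⁻ θ in Ioc 0 (2 * Real.pi), (u (a + circleMap 0 r θ • b)).toENNReal) +
      (∫⁻ θ in Ioc 0 (2 * Real.pi), ENNReal.ofReal (-g (circleMap 0 r θ))) ≤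
      (∫⁻ θ in Ioc 0 (2 * Real.pi), ENNReal.ofReal (g (circleMap 0 r θ))) +
      (∫⁻ θ in Ioc 0 (2 * Real.pi), (-u (a + circleMap 0 r θ • b)).toENNReal) := by
    -- Additivity needs only one of the two summands to be measurable, and `g` supplies it, so no
    -- measurability of `u` is used.
    rw [← lintegral_add_right _ hcn,
      ← lintegral_add_left hc.measurable.ennreal_ofReal]
    exact lintegral_mono fun θ => EReal.toENNReal_add_neg_le (h _ (by simp))
  revert key hP hN
  generalize (∫⁻ θ in Ioc 0 (2 * Real.pi), (u (a + circleMap 0 r θ • b)).toENNReal) = A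
  generalize (∫⁻ θ in Ioc 0 (2 * Real.pi), (-u (a + circleMap 0 r θ • b)).toENNReal) = B
  generalize (∫⁻ θ in Ioc 0 (2 * Real.pi), ENNReal.ofReal (g (circleMap 0 r θ))) = P
  generalize (∫⁻ θ in Ioc 0 (2 * Real.pi), ENNReal.ofReal (-g (circleMap 0 r θ))) = N
  intro hP hN key
  have hpi : (0 : ℝ) < 2 * Real.pi := by positivity
  have hk : (ENNReal.ofReal (2 * Real.pi))⁻¹ = ENNReal.ofReal (2 * Real.pi)⁻¹ :=
    (ENNReal.ofReal_inv_of_pos hpi).symm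
  rw [hk]
  have hk0 : ENNReal.ofReal (2 * Real.pi)⁻¹ ≠ 0 := by
    simp only [ne_eq, ENNReal.ofReal_eq_zero, not_le]; positivity
  -- If the negative part has infinite integral, the mean is `-∞`, since `x - ⊤ = ⊥` in `EReal` even
  -- for `x = ⊤`.
  by_cases hB : B = ⊤
  · rw [hB, ENNReal.mul_top hk0]; simp
  · have hA : A ≠ ⊤ := by
      intro hA; rw [hA, top_add] at key
      exact ENNReal.add_ne_top.2 ⟨hP, hB⟩ (top_le_iff.1 key)
    lift A to NNReal using hA
    lift B to NNReal using hB
    lift P to NNReal using hP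
    lift N to NNReal using hN
    have key' : (A : ℝ) + N ≤ P + B := by exact_mod_cast key
    rw [ENNReal.ofReal, ← ENNReal.coe_mul, ← ENNReal.coe_mul]
    have e : ∀ x : NNReal, (((x : NNReal) : ENNReal) : EReal) = ((x : ℝ) : EReal) := fun x => rfl
    rw [e, e, ← EReal.coe_sub, EReal.coe_le_coe_iff]
    simp only [NNReal.coe_mul, ENNReal.coe_toReal]
    rw [Real.coe_toNNReal _ (by positivity), ← mul_sub]
    gcongr ?_ * ?_
    linarith

lemma circleAverage_le_circleMean {u : E → EReal} {a b : E} {r : ℝ} {g : ℂ → ℝ}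
    (hg : ContinuousOn g (Metric.sphere 0 |r|))
    (h : ∀ ζ ∈ Metric.sphere (0 : ℂ) |r|, (g ζ : EReal) ≤ u (a + ζ • b)) :
    (Real.circleAverage g 0 r : ℝ) ≤ circleMean u a b r := by
  obtain ⟨hP, hN, he⟩ := circleAverage_eq_lintegral_sub hg
  have hc : Continuous fun θ => g (circleMap 0 r θ) :=
    hg.comp_continuous (continuous_circleMap 0 r) fun θ => by simp
  have hcn : Measurable fun θ => ENNReal.ofReal (-g (circleMap 0 r θ)) :=
    hc.neg.measurable.ennreal_ofReal
  rw [he]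
  unfold circleMean
  have key : (∫⁻ θ in Ioc 0 (2 * Real.pi), ENNReal.ofReal (g (circleMap 0 r θ))) +
      (∫⁻ θ in Ioc 0 (2 * Real.pi), (-u (a + circleMap 0 r θ • b)).toENNReal) ≤
      (∫⁻ θ in Ioc 0 (2 * Real.pi), (u (a + circleMap 0 r θ • b)).toENNReal) +
      (∫⁻ θ in Ioc 0 (2 * Real.pi), ENNReal.ofReal (-g (circleMap 0 r θ))) := by
    rw [← lintegral_add_left hc.measurable.ennreal_ofReal,
      ← lintegral_add_right _ hcn]
    exact lintegral_mono fun θ => EReal.neg_toENNReal_add_le (h _ (by simp))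
  -- The minorant `g` keeps the negative part of `u` integrable, so the mean is not `-∞`.
  have key2 : (∫⁻ θ in Ioc 0 (2 * Real.pi), (-u (a + circleMap 0 r θ • b)).toENNReal) ≤
      (∫⁻ θ in Ioc 0 (2 * Real.pi), ENNReal.ofReal (-g (circleMap 0 r θ))) := by
    refine lintegral_mono fun θ => ?_
    have h1 := EReal.neg_le_neg_iff.2 (h (circleMap 0 r θ) (by simp))
    have h2 := EReal.toENNReal_le_toENNReal h1
    rwa [← EReal.coe_neg, EReal.toENNReal_of_ne_top (x := ((- g (circleMap 0 r θ) : ℝ) : EReal))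
      (by simp), EReal.toReal_coe] at h2
  revert key key2 hP hN
  generalize (∫⁻ θ in Ioc 0 (2 * Real.pi), (u (a + circleMap 0 r θ • b)).toENNReal) = A
  generalize (∫⁻ θ in Ioc 0 (2 * Real.pi), (-u (a + circleMap 0 r θ • b)).toENNReal) = B
  generalize (∫⁻ θ in Ioc 0 (2 * Real.pi), ENNReal.ofReal (g (circleMap 0 r θ))) = P
  generalize (∫⁻ θ in Ioc 0 (2 * Real.pi), ENNReal.ofReal (-g (circleMap 0 r θ))) = N
  intro hP hN key key2
  have hpi : (0 : ℝ) < 2 * Real.pi := by positivity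
  have hk : (ENNReal.ofReal (2 * Real.pi))⁻¹ = ENNReal.ofReal (2 * Real.pi)⁻¹ :=
    (ENNReal.ofReal_inv_of_pos hpi).symm
  rw [hk]
  have hk0 : ENNReal.ofReal (2 * Real.pi)⁻¹ ≠ 0 := by
    simp only [ne_eq, ENNReal.ofReal_eq_zero, not_le]; positivity
  have hB : B ≠ ⊤ := (key2.trans_lt hN.lt_top).ne
  have e : ∀ x : NNReal, (((x : NNReal) : ENNReal) : EReal) = ((x : ℝ) : EReal) := fun x => rfl
  lift B to NNReal using hB
  by_cases hA : A = ⊤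
  · rw [hA, ENNReal.mul_top hk0, ENNReal.ofReal, ← ENNReal.coe_mul, e, EReal.coe_ennreal_top,
      EReal.top_sub_coe]
    exact le_top
  · lift A to NNReal using hA
    lift P to NNReal using hP
    lift N to NNReal using hN
    have key' : (P : ℝ) + B ≤ A + N := by exact_mod_cast key
    rw [ENNReal.ofReal, ← ENNReal.coe_mul, ← ENNReal.coe_mul]
    rw [e, e, ← EReal.coe_sub, EReal.coe_le_coe_iff]
    simp only [NNReal.coe_mul, ENNReal.coe_toReal]
    rw [Real.coe_toNNReal _ (by positivity), ← mul_sub]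
    gcongr ?_ * ?_
    linarith

open InnerProductSpace

lemma HarmonicAt.eventually_circleAverage_eq {g : ℂ → ℝ} {p : ℂ} (hg : HarmonicAt g p) :
    ∀ᶠ r in 𝓝[>] (0 : ℝ), HarmonicOnNhd g (Metric.closedBall p |r|) ∧
      Real.circleAverage g p r = g p := by
  obtain ⟨s, hs, h⟩ := Metric.eventually_nhds_iff_ball.1 hg.eventually
  filter_upwards [Ioo_mem_nhdsGT hs] with r hr
  have hh : HarmonicOnNhd g (Metric.closedBall p |r|) := fun z hz =>
    h z (Metric.closedBall_subset_ball (by rw [abs_of_pos hr.1]; exact hr.2) hz)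
  exact ⟨hh, hh.circleAverage_eq⟩

/-- A function with a harmonic minorant touching it along a complex line satisfies the submean
inequality along that line. -/
lemma eventually_le_circleMean_of_harmonicAt {u : E → EReal} {a b : E} {h : ℂ → ℝ}
    (hh : HarmonicAt h 0) (h0 : u a ≤ h 0) (hle : ∀ᶠ ζ in 𝓝 (0 : ℂ), (h ζ : EReal) ≤ u (a + ζ • b)) :
    ∀ᶠ r in 𝓝[>] (0 : ℝ), u a ≤ circleMean u a b r := by
  obtain ⟨s, hs, hle⟩ := Metric.eventually_nhds_iff_ball.1 hle
  filter_upwards [Ioo_mem_nhdsGT hs, HarmonicAt.eventually_circleAverage_eq hh] with r hr hr2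
  refine h0.trans ?_
  rw [← hr2.2]
  refine circleAverage_le_circleMean (hr2.1.continuousOn.mono Metric.sphere_subset_closedBall) ?_
  intro ζ hζ
  refine hle ζ ?_
  rw [mem_sphere_zero_iff_norm, abs_of_pos hr.1] at hζ
  simpa [hζ] using hr.2

/-- On the circle, ‖z‖² agrees with a harmonic affine function plus a constant. The excess r² over
the central value is what makes the perturbed function in the maximum principle strictly
subharmonic. -/
lemma circleAverage_normSq (p : ℂ) (r : ℝ) :
    Real.circleAverage (fun z => ‖z‖ ^ 2) p r = ‖p‖ ^ 2 + r ^ 2 := by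
  have h1 : Real.circleAverage (fun z => ‖z‖ ^ 2) p r =
      Real.circleAverage (fun z => (2 * (starRingEnd ℂ) p * (z - p)).re + (‖p‖ ^ 2 + r ^ 2)) p r := by
    refine Real.circleAverage_congr_sphere fun z hz => ?_
    have hz' : ‖z - p‖ ^ 2 = r ^ 2 := by
      rw [mem_sphere_iff_norm] at hz; rw [hz, sq_abs]
    simp only [← Complex.normSq_eq_norm_sq, Complex.normSq_apply, Complex.sub_re, Complex.sub_im]
      at hz' ⊢
    simp [Complex.mul_re]
    linarith
  have hre : HarmonicOnNhd (fun z => (2 * (starRingEnd ℂ) p * (z - p)).re) (Metric.closedBall p |r|) :=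
    fun z _ => AnalyticAt.harmonicAt_re (f := fun z => 2 * (starRingEnd ℂ) p * (z - p)) (by fun_prop)
  rw [h1, Real.circleAverage_fun_add
    ((hre.continuousOn.mono Metric.sphere_subset_closedBall).circleIntegrable')
    (circleIntegrable_const _ _ _), hre.circleAverage_eq, Real.circleAverage_const]
  simp

/-- Maximum principle: an upper semicontinuous function on a compact set which satisfies the local
submean inequality in the interior is dominated by a harmonic majorant of its boundary values. -/
lemma le_of_boundary_le_of_submean {K : Set ℂ} (hK : IsCompact K) {v : ℂ → EReal} {g : ℂ → ℝ}
    (hv : UpperSemicontinuousOn v K) (hvt : ∀ p ∈ K, v p < ⊤) (hg : ContinuousOn g K)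
    (h : ∀ p ∈ K, v p ≤ g p ∨
      (p ∈ interior K ∧ HarmonicAt g p ∧ ∀ᶠ r in 𝓝[>] (0 : ℝ), v p ≤ circleMean v p 1 r)) :
    ∀ p ∈ K, v p ≤ g p := by
  intro q hq
  by_contra hlt
  rw [not_le] at hlt
  obtain ⟨B, hB⟩ := hK.isBounded.exists_norm_le
  have hBq := (norm_nonneg q).trans (hB q hq)
  obtain ⟨t, ht1, ht2⟩ := EReal.lt_iff_exists_real_btwn.1 hlt
  have ht1' : g q < t := by exact_mod_cast ht1
  -- The function v + η‖z‖² − g is examined at a maximum point. This η is so small that the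
  -- perturbation, at most ηB², does not bridge the gap between g(q) and t < v(q); hence the maximum
  -- cannot lie where v ≤ g.
  set η : ℝ := (t - g q) / (B ^ 2 + 1) with hη
  have hη0 : 0 < η := div_pos (by linarith) (by positivity)
  have hηB : η * B ^ 2 < t - g q := by
    have : η * (B ^ 2 + 1) = t - g q := by rw [hη]; field_simp
    linarith
  have hk : ContinuousOn (fun z => ((η * ‖z‖ ^ 2 - g z : ℝ) : EReal)) K :=
    continuous_coe_real_ereal.comp_continuousOn (by fun_prop)
  have hw : UpperSemicontinuousOn (fun z => v z + ((η * ‖z‖ ^ 2 - g z : ℝ) : EReal)) K := by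
    refine UpperSemicontinuousOn.add' hv hk.upperSemicontinuousOn ?_
    intro x hx
    exact EReal.continuousAt_add (Or.inr (EReal.coe_ne_bot _)) (Or.inr (EReal.coe_ne_top _))
  obtain ⟨p, hp, hmax⟩ := hw.exists_isMaxOn ⟨q, hq⟩ hK
  have hvp_top : v p ≠ ⊤ := (hvt p hp).ne
  have hqp : v q + ((η * ‖q‖ ^ 2 - g q : ℝ) : EReal) ≤ v p + ((η * ‖p‖ ^ 2 - g p : ℝ) : EReal) :=
    hmax hq
  have hvp_bot : v p ≠ ⊥ := by
    intro hb
    rw [hb, EReal.bot_add, le_bot_iff, EReal.add_eq_bot_iff] at hqp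
    rcases hqp with hqp | hqp
    · rw [hqp] at ht2; exact not_lt_bot ht2
    · exact EReal.coe_ne_bot _ hqp
  obtain ⟨m, hm⟩ : ∃ m : ℝ, v p = m := ⟨_, (EReal.coe_toReal hvp_top hvp_bot).symm⟩
  have hmt : t - g q ≤ m + (η * ‖p‖ ^ 2 - g p) := by
    have h1 : ((t + (η * ‖q‖ ^ 2 - g q) : ℝ) : EReal) ≤ ((m + (η * ‖p‖ ^ 2 - g p) : ℝ) : EReal) := by
      rw [EReal.coe_add, EReal.coe_add, ← hm]
      exact (add_le_add_left ht2.le _).trans hqp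
    have h2 : t + (η * ‖q‖ ^ 2 - g q) ≤ m + (η * ‖p‖ ^ 2 - g p) := by exact_mod_cast h1
    have : 0 ≤ η * ‖q‖ ^ 2 := by positivity
    linarith
  have hpB : η * ‖p‖ ^ 2 ≤ η * B ^ 2 := by
    gcongr; exact hB p hp
  rcases h p hp with h1 | ⟨h_int, hharm, hsub⟩
  · rw [hm] at h1
    have : m ≤ g p := by exact_mod_cast h1
    linarith
  · obtain ⟨s, hs, hball⟩ := Metric.mem_nhds_iff.1 (mem_interior_iff_mem_nhds.1 h_int)
    obtain ⟨r, hr, hr2, hr3⟩ := ((Filter.Eventually.and (Ioo_mem_nhdsGT hs))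
      ((HarmonicAt.eventually_circleAverage_eq hharm).and hsub)).exists
    have hsph : Metric.sphere p |r| ⊆ K := fun z hz => hball (by
      rw [mem_sphere_iff_norm, abs_of_pos hr.1] at hz
      rw [mem_ball_iff_norm, hz]; exact hr.2)
    have hcont : ContinuousOn (fun z => (g z - η * ‖z‖ ^ 2) + (m + (η * ‖p‖ ^ 2 - g p))) K := by
      fun_prop
    -- Maximality at p bounds v on the circle by g − η‖z‖² plus a constant. Averaging yields v(p) ≤
    -- v(p) − ηr², a contradiction.
    have hle : circleMean v p 1 r ≤ (Real.circleAverage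
        (fun ζ => (fun z => (g z - η * ‖z‖ ^ 2) + (m + (η * ‖p‖ ^ 2 - g p))) (ζ + p)) 0 r : ℝ) := by
      refine circleMean_le_circleAverage ?_ ?_
      · refine hcont.comp (by fun_prop) fun ζ hζ => hsph ?_
        simpa [mem_sphere_iff_norm] using hζ
      · intro ζ hζ
        have hz : p + ζ ∈ K := hsph (by simpa [mem_sphere_iff_norm] using hζ)
        have h1 : v (p + ζ) + ((η * ‖p + ζ‖ ^ 2 - g (p + ζ) : ℝ) : EReal) ≤
            v p + ((η * ‖p‖ ^ 2 - g p : ℝ) : EReal) := hmax hz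
        rw [hm, ← EReal.coe_add] at h1
        rw [smul_eq_mul, mul_one, add_comm ζ p]
        have h3 : v (p + ζ) ≠ ⊤ := (hvt _ hz).ne
        generalize v (p + ζ) = x at h1 h3
        induction x with
        | bot => simp
        | top => exact absurd rfl h3
        | coe x =>
          have h2 : x + (η * ‖p + ζ‖ ^ 2 - g (p + ζ)) ≤ m + (η * ‖p‖ ^ 2 - g p) := by
            exact_mod_cast h1
          exact_mod_cast (by linarith : x ≤ (g (p + ζ) - η * ‖p + ζ‖ ^ 2) + (m + (η * ‖p‖ ^ 2 - g p)))
    rw [Real.circleAverage_map_add_const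
      (f := fun z => (g z - η * ‖z‖ ^ 2) + (m + (η * ‖p‖ ^ 2 - g p)))] at hle
    have hgI : CircleIntegrable g p r := (hg.mono hsph).circleIntegrable'
    have hnI : CircleIntegrable (fun z : ℂ => η * ‖z‖ ^ 2) p r :=
      ContinuousOn.circleIntegrable' (by fun_prop)
    rw [Real.circleAverage_fun_add (f₁ := fun z => g z - η * ‖z‖ ^ 2) (hgI.sub hnI) (circleIntegrable_const _ _ _),
      Real.circleAverage_fun_sub hgI hnI, Real.circleAverage_const, hr2.2] at hle
    have h5 : Real.circleAverage (fun z : ℂ => η * ‖z‖ ^ 2) p r = η * (‖p‖ ^ 2 + r ^ 2) := by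
      rw [← circleAverage_normSq, ← smul_eq_mul, ← Real.circleAverage_fun_smul]; rfl
    rw [h5] at hle
    have h6 := hr3.trans hle
    rw [hm] at h6
    have h7 : m ≤ g p - η * (‖p‖ ^ 2 + r ^ 2) + (m + (η * ‖p‖ ^ 2 - g p)) := by exact_mod_cast h6
    have : 0 < η * r ^ 2 := mul_pos hη0 (pow_pos hr.1 2)
    nlinarith

lemma IsPSH.comp_line {X : Set E} {u : E → EReal} (hu : IsPSH X u) (c w : E) :
    IsPSH {z : ℂ | c + z • w ∈ X} (fun z => u (c + z • w)) := by
  refine ⟨?_, fun a ha => hu.2.1 _ ha, fun a ha b => ?_⟩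
  · exact hu.1.comp (Continuous.continuousOn (by fun_prop)) fun z hz => hz
  · filter_upwards [hu.2.2 _ ha (b • w)] with r hr
    refine hr.trans_eq ?_
    simp only [circleMean, add_smul, smul_assoc, add_assoc]

/-- The logarithm of the norm of a holomorphic map is plurisubharmonic. -/
lemma isPSH_log_norm {H : Type*} [NormedAddCommGroup H] [InnerProductSpace ℂ H] {X : Set E}
    (hX : IsOpen X) {F : E → H} (hF : DifferentiableOn ℂ F X) :
    IsPSH X (fun z => ENNReal.log ‖F z‖ₑ) := by
  refine ⟨?_, ?_, ?_⟩
  · exact (ENNReal.continuous_log.comp_continuousOn hF.continuousOn.enorm).upperSemicontinuousOn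
  · intro a _; simp
  · intro a ha b
    by_cases h0 : F a = 0
    · filter_upwards with r; simp [h0]
    have hn : 0 < ‖F a‖ := norm_pos_iff.2 h0
    -- Pairing F with the unit vector in the direction of F(a) gives a holomorphic function with |k|
    -- ≤ ‖F‖ and equality at 0, so log |k| is a harmonic minorant touching at `a`.
    set k : ℂ → ℂ := fun ζ => inner ℂ (((‖F a‖⁻¹ : ℝ) : ℂ) • F a) (F (a + ζ • b)) with hk
    have hk0 : k 0 = ‖F a‖ := by
      simp only [hk, zero_smul, add_zero, inner_smul_left, inner_self_eq_norm_sq_to_K]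
      simp; field_simp
    have hline : Continuous fun ζ : ℂ => a + ζ • b := by fun_prop
    have hopen : IsOpen {ζ : ℂ | a + ζ • b ∈ X} := hX.preimage hline
    have hkd : DifferentiableOn ℂ k {ζ : ℂ | a + ζ • b ∈ X} := by
      intro ζ hζ
      have : DifferentiableWithinAt ℂ (fun ζ : ℂ => F (a + ζ • b)) {ζ : ℂ | a + ζ • b ∈ X} ζ :=
        (hF _ hζ).comp ζ (by fun_prop) fun z hz => hz
      exact (innerSL ℂ (((‖F a‖⁻¹ : ℝ) : ℂ) • F a)).differentiableAt.comp_differentiableWithinAt ζ this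
    have hmem : {ζ : ℂ | a + ζ • b ∈ X} ∈ 𝓝 (0 : ℂ) := hopen.mem_nhds (by simpa using ha)
    have hka : AnalyticAt ℂ k 0 := hkd.analyticAt hmem
    have hkne : k 0 ≠ 0 := by rw [hk0]; exact_mod_cast hn.ne'
    refine eventually_le_circleMean_of_harmonicAt
      (u := fun z => ENNReal.log ‖F z‖ₑ) (h := fun ζ => Real.log ‖k ζ‖) (hka.harmonicAt_log_norm hkne) ?_ ?_
    · rw [hk0, ← ofReal_norm, ENNReal.log_ofReal_of_pos hn]; simp
    · filter_upwards [hka.continuousAt.eventually_ne hkne] with ζ hζ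
      rw [← ENNReal.log_ofReal_of_pos (norm_pos_iff.2 hζ), ofReal_norm, ENNReal.log_le_log_iff,
        enorm_le_iff_norm_le]
      refine (norm_inner_le_norm _ _).trans ?_
      rw [norm_smul]
      simp [hn.ne']

end Submean

/-! ### Estimates of Lelong numbers -/

section Lelong

variable {E : Type*} [NormedAddCommGroup E]

lemma EReal.coe_le_div_of_neg {t c : ℝ} (hc : c < 0) {s : EReal} :
    (t : EReal) ≤ s / (c : EReal) ↔ s ≤ ((t * c : ℝ) : EReal) := by
  have hc' : (c : EReal) < 0 := by exact_mod_cast hc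
  induction s with
  | bot => simp [EReal.bot_div_of_neg_ne_bot hc' (EReal.coe_ne_bot c)]
  | top =>
    rw [EReal.top_div_of_neg_ne_bot hc' (EReal.coe_ne_bot c)]
    constructor <;> intro h
    · exact absurd (le_bot_iff.1 h) (EReal.coe_ne_bot _)
    · exact absurd (top_le_iff.1 h) (EReal.coe_ne_top _)
  | coe s =>
    rw [← EReal.coe_div, EReal.coe_le_coe_iff, EReal.coe_le_coe_iff, le_div_iff_of_neg hc]

lemma EReal.div_le_coe_of_neg {t c : ℝ} (hc : c < 0) {s : EReal} :
    s / (c : EReal) ≤ (t : EReal) ↔ ((t * c : ℝ) : EReal) ≤ s := by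
  have hc' : (c : EReal) < 0 := by exact_mod_cast hc
  induction s with
  | bot =>
    rw [EReal.bot_div_of_neg_ne_bot hc' (EReal.coe_ne_bot c)]
    constructor <;> intro h
    · exact absurd (top_le_iff.1 h) (EReal.coe_ne_top _)
    · exact absurd (le_bot_iff.1 h) (EReal.coe_ne_bot _)
  | top => simp [EReal.top_div_of_neg_ne_bot hc' (EReal.coe_ne_bot c)]
  | coe s =>
    rw [← EReal.coe_div, EReal.coe_le_coe_iff, EReal.coe_le_coe_iff, div_le_iff_of_neg hc]

lemma eventually_norm_sub_nhdsNE {p : ℝ → Prop} (a : E) (h : ∀ᶠ r in 𝓝[>] (0 : ℝ), p r) :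
    ∀ᶠ z in 𝓝[≠] a, p ‖z - a‖ := by
  have : Tendsto (fun z => ‖z - a‖) (𝓝[≠] a) (𝓝[>] 0) := by
    refine tendsto_nhdsWithin_iff.2 ⟨?_, ?_⟩
    · have : Tendsto (fun z => ‖z - a‖) (𝓝 a) (𝓝 ‖a - a‖) := Continuous.tendsto (by fun_prop) a
      rw [sub_self, norm_zero] at this
      exact this.mono_left nhdsWithin_le_nhds
    · filter_upwards [self_mem_nhdsWithin] with z hz
      exact norm_pos_iff.2 (sub_ne_zero.2 hz)
  exact this.eventually h

/-- A bound on a lower limit gives only rates t < 1, with no control of an additive constant at rate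
1. The loss is removed in `le_log_pseudoDist`. -/
lemma eventually_le_log_of_one_le_lelongNumber {u : E → EReal} {a : E} (h : 1 ≤ lelongNumber u a)
    {t : ℝ} (ht : t < 1) : ∀ᶠ z in 𝓝[≠] a, u z ≤ ((t * Real.log ‖z - a‖ : ℝ) : EReal) := by
  have ht' : (t : EReal) < 1 := by exact_mod_cast ht
  have h1 := Filter.eventually_lt_of_lt_liminf (ht'.trans_le h)
  have h2 : ∀ᶠ r in 𝓝[>] (0 : ℝ), ∀ z ∈ Metric.sphere a r, u z ≤ ((t * Real.log r : ℝ) : EReal) := by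
    filter_upwards [h1, Ioo_mem_nhdsGT one_pos] with r hr hr1 z hz
    have := (EReal.coe_le_div_of_neg (Real.log_neg hr1.1 hr1.2)).1 hr.le
    exact (le_iSup₂ (f := fun z (_ : z ∈ Metric.sphere a r) => u z) z hz).trans this
  filter_upwards [eventually_norm_sub_nhdsNE a h2] with z hz
  exact hz z (by simp)

lemma tendsto_log_const_mul_div_log {C : ℝ} (hC : 0 < C) :
    Tendsto (fun r => ((Real.log (C * r) / Real.log r : ℝ) : EReal)) (𝓝[>] 0) (𝓝 1) := by
  have h1 : Tendsto (fun r => Real.log C / Real.log r + 1) (𝓝[>] (0 : ℝ)) (𝓝 (0 + 1)) :=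
    (Tendsto.const_div_atBot Real.tendsto_log_nhdsGT_zero _).add_const 1
  rw [zero_add] at h1
  have h2 : Tendsto (fun r => Real.log (C * r) / Real.log r) (𝓝[>] 0) (𝓝 1) := by
    refine h1.congr' ?_
    filter_upwards [Ioo_mem_nhdsGT one_pos] with r hr
    have := (Real.log_neg hr.1 hr.2).ne
    rw [Real.log_mul hC.ne' hr.1.ne', add_div, div_self this]
  exact (continuous_coe_real_ereal.tendsto 1).comp h2

lemma one_le_lelongNumber {u : E → EReal} {a : E} {C : ℝ} (hC : 0 < C)
    (h : ∀ᶠ z in 𝓝 a, u z ≤ ENNReal.log (ENNReal.ofReal (C * ‖z - a‖))) :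
    1 ≤ lelongNumber u a := by
  rw [← (tendsto_log_const_mul_div_log hC).liminf_eq]
  refine liminf_le_liminf ?_
  obtain ⟨s, hs, h⟩ := Metric.eventually_nhds_iff_ball.1 h
  filter_upwards [Ioo_mem_nhdsGT one_pos, Ioo_mem_nhdsGT hs] with r hr hrs
  have hl := Real.log_neg hr.1 hr.2
  rw [EReal.coe_le_div_of_neg hl, div_mul_cancel₀ _ hl.ne]
  refine iSup₂_le fun z hz => ?_
  rw [mem_sphere_iff_norm] at hz
  refine (h z (by rw [mem_ball_iff_norm, hz]; exact hrs.2)).trans_eq ?_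
  rw [hz, ENNReal.log_ofReal_of_pos (mul_pos hC hr.1)]

lemma lelongNumber_le_one {u : E → EReal} {a : E} {C : ℝ} (hC : 0 < C)
    (h : ∀ᶠ r in 𝓝[>] (0 : ℝ), ∃ z ∈ Metric.sphere a r,
      ENNReal.log (ENNReal.ofReal (C * r)) ≤ u z) :
    lelongNumber u a ≤ 1 := by
  rw [← (tendsto_log_const_mul_div_log hC).liminf_eq]
  refine liminf_le_liminf ?_
  filter_upwards [Ioo_mem_nhdsGT one_pos, h] with r hr ⟨z, hz, hzr⟩
  have hl := Real.log_neg hr.1 hr.2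
  rw [EReal.div_le_coe_of_neg hl, div_mul_cancel₀ _ hl.ne]
  rw [ENNReal.log_ofReal_of_pos (mul_pos hC hr.1)] at hzr
  exact hzr.trans (le_iSup₂ (f := fun z (_ : z ∈ Metric.sphere a r) => u z) z hz)

lemma lelongNumber_nonneg {u : E → EReal} {a : E} (h : ∀ᶠ z in 𝓝 a, u z ≤ 0) :
    0 ≤ lelongNumber u a := by
  obtain ⟨s, hs, h⟩ := Metric.eventually_nhds_iff_ball.1 h
  refine le_liminf_of_le (by isBoundedDefault) ?_
  filter_upwards [Ioo_mem_nhdsGT one_pos, Ioo_mem_nhdsGT hs] with r hr hrs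
  have hl := Real.log_neg hr.1 hr.2
  rw [← EReal.coe_zero, EReal.coe_le_div_of_neg hl, zero_mul]
  refine iSup₂_le fun z hz => h z ?_
  rw [mem_sphere_iff_norm] at hz
  rw [mem_ball_iff_norm, hz]; exact hrs.2

/-- Nontriviality matters: over empty spheres the supremum is `-∞`, and its quotient by a negative
number is `+∞`. -/
lemma lelongNumber_zero_le [NormedSpace ℂ E] [Nontrivial E] (a : E) :
    lelongNumber (fun _ : E => (0 : EReal)) a ≤ 0 := by
  refine (liminf_le_liminf (v := fun _ => (0 : EReal)) ?_).trans_eq (liminf_const _)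
  filter_upwards [Ioo_mem_nhdsGT one_pos] with r hr
  have hl := Real.log_neg hr.1 hr.2
  obtain ⟨y, hy⟩ := NormedSpace.sphere_nonempty_rclike ℂ (E := E) hr.1.le
  have hz : a + y ∈ Metric.sphere a r := by simpa using hy
  rw [← EReal.coe_zero, EReal.div_le_coe_of_neg hl, zero_mul]
  exact le_iSup₂ (f := fun z (_ : z ∈ Metric.sphere a r) => ((0 : ℝ) : EReal)) (a + y) hz

end Lelong

/-! ### The Green function of the unit disc -/

section DiscPole

/-- The pseudohyperbolic distance of the unit disc. -/
def pseudoDist (z w : ℂ) : ℝ := ‖(z - w) / (1 - (starRingEnd ℂ) w * z)‖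

lemma one_sub_conj_mul_ne_zero {z w : ℂ} (hz : ‖z‖ < 1) (hw : ‖w‖ ≤ 1) :
    1 - (starRingEnd ℂ) w * z ≠ 0 := by
  intro h
  have h1 : ‖(starRingEnd ℂ) w * z‖ = 1 := by rw [← sub_eq_zero.1 h]; simp
  rw [norm_mul, Complex.norm_conj] at h1
  nlinarith [norm_nonneg z, norm_nonneg w]

lemma one_sub_pseudoDist_sq {z w : ℂ} (hz : ‖z‖ < 1) (hw : ‖w‖ ≤ 1) :
    1 - pseudoDist z w ^ 2 =
      (1 - ‖z‖ ^ 2) * (1 - ‖w‖ ^ 2) / ‖1 - (starRingEnd ℂ) w * z‖ ^ 2 := by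
  have h0 : ‖1 - (starRingEnd ℂ) w * z‖ ≠ 0 := norm_ne_zero_iff.2 (one_sub_conj_mul_ne_zero hz hw)
  rw [pseudoDist, norm_div, eq_div_iff (pow_ne_zero 2 h0), sub_mul, div_pow,
    div_mul_cancel₀ _ (pow_ne_zero 2 h0)]
  simp only [← Complex.normSq_eq_norm_sq, Complex.normSq_apply]
  simp
  ring

lemma pseudoDist_nonneg (z w : ℂ) : 0 ≤ pseudoDist z w := norm_nonneg _

lemma pseudoDist_lt_one {z w : ℂ} (hz : ‖z‖ < 1) (hw : ‖w‖ < 1) : pseudoDist z w < 1 := by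
  have h1 := one_sub_pseudoDist_sq hz hw.le
  have h0 : 0 < ‖1 - (starRingEnd ℂ) w * z‖ := norm_pos_iff.2 (one_sub_conj_mul_ne_zero hz hw.le)
  have h2 : 0 < 1 - pseudoDist z w ^ 2 := by
    rw [h1]
    have := norm_nonneg z
    have := norm_nonneg w
    refine div_pos (mul_pos ?_ ?_) (by positivity) <;> nlinarith
  nlinarith [pseudoDist_nonneg z w]

lemma pseudoDist_pos {z w : ℂ} (hz : ‖z‖ < 1) (hw : ‖w‖ ≤ 1) (h : z ≠ w) : 0 < pseudoDist z w :=
  norm_pos_iff.2 (div_ne_zero (sub_ne_zero.2 h) (one_sub_conj_mul_ne_zero hz hw))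

open InnerProductSpace in
lemma harmonicAt_log_pseudoDist {z w : ℂ} (hz : ‖z‖ < 1) (hw : ‖w‖ ≤ 1) (h : z ≠ w) :
    HarmonicAt (fun z => Real.log (pseudoDist z w)) z := by
  have h0 := one_sub_conj_mul_ne_zero hz hw
  refine AnalyticAt.harmonicAt_log_norm (f := fun z => (z - w) / (1 - (starRingEnd ℂ) w * z)) ?_
    (div_ne_zero (sub_ne_zero.2 h) h0)
  exact AnalyticAt.div (by fun_prop) (by fun_prop) h0

lemma continuousOn_log_pseudoDist {w : ℂ} (hw : ‖w‖ ≤ 1) :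
    ContinuousOn (fun z => Real.log (pseudoDist z w)) {z | ‖z‖ < 1 ∧ z ≠ w} := by
  intro z hz
  have h0 := one_sub_conj_mul_ne_zero hz.1 hw
  have h1 : ContinuousAt (fun z => pseudoDist z w) z := by
    unfold pseudoDist
    exact (ContinuousAt.div (f := fun z => z - w) (g := fun z => 1 - (starRingEnd ℂ) w * z)
      (by fun_prop) (by fun_prop) h0).norm
  exact (h1.log (pseudoDist_pos hz.1 hw hz.2).ne').continuousWithinAt

/-- The Green function of the disc tends to 0 uniformly at the unit circle, because 1 − ρ² ≤ (1 −
R²)/(1 − ‖w‖)² for |z| = R. -/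
lemma neg_le_log_pseudoDist {w : ℂ} (hw : ‖w‖ < 1) {η : ℝ} (hη : 0 < η) :
    ∀ᶠ R in 𝓝[<] (1 : ℝ), ∀ z : ℂ, ‖z‖ = R → -η ≤ Real.log (pseudoDist z w) := by
  have hlim : Tendsto (fun R : ℝ => 1 - (1 - R ^ 2) / (1 - ‖w‖) ^ 2) (𝓝[<] 1) (𝓝 1) := by
    have : Tendsto (fun R : ℝ => 1 - (1 - R ^ 2) / (1 - ‖w‖) ^ 2) (𝓝 1)
      (𝓝 (1 - (1 - 1 ^ 2) / (1 - ‖w‖) ^ 2)) := Continuous.tendsto (by fun_prop) 1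
    simp only [one_pow, sub_self, zero_div, sub_zero] at this
    exact this.mono_left nhdsWithin_le_nhds
  have he : Real.exp (-η) ^ 2 < 1 := by
    have := Real.exp_lt_one_iff.2 (neg_lt_zero.2 hη)
    have := Real.exp_pos (-η)
    nlinarith
  filter_upwards [hlim.eventually_const_lt he, Ioo_mem_nhdsLT (zero_lt_one' ℝ)] with R hR hR1 z hz
  have hz1 : ‖z‖ < 1 := by rw [hz]; exact hR1.2
  have h1 := one_sub_pseudoDist_sq hz1 hw.le
  have hw0 := norm_nonneg w
  have h2 : 1 - ‖w‖ ≤ ‖1 - (starRingEnd ℂ) w * z‖ := by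
    have h3 := norm_sub_norm_le (1 : ℂ) ((starRingEnd ℂ) w * z)
    rw [norm_one, norm_mul, Complex.norm_conj] at h3
    nlinarith [norm_nonneg z]
  have h4 : (1 - ‖z‖ ^ 2) * (1 - ‖w‖ ^ 2) / ‖1 - (starRingEnd ℂ) w * z‖ ^ 2 ≤
      (1 - R ^ 2) / (1 - ‖w‖) ^ 2 := by
    rw [hz]
    have hR2 : 0 ≤ 1 - R ^ 2 := by nlinarith [hR1.1, hR1.2]
    have : 0 < 1 - ‖w‖ := by linarith
    gcongr
    nlinarith [sq_nonneg ‖w‖]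
  have h5 : Real.exp (-η) ^ 2 < pseudoDist z w ^ 2 := by linarith
  have h6 : Real.exp (-η) < pseudoDist z w :=
    lt_of_pow_lt_pow_left₀ 2 (pseudoDist_nonneg _ _) h5
  exact (Real.le_log_iff_exp_le ((Real.exp_pos _).trans h6)).2 h6.le

/-- A negative subharmonic function on the disc with a logarithmic pole at `w` is dominated by the
Green function of the disc, up to a loss in the coefficient. -/
lemma le_mul_log_pseudoDist_add {v : ℂ → EReal} (hv : IsPSH (Metric.ball 0 1) v)
    (hv0 : ∀ z ∈ Metric.ball (0 : ℂ) 1, v z ≤ 0) {w : ℂ} (hw : ‖w‖ < 1)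
    (hpole : ∀ t : ℝ, 0 < t → t < 1 → ∀ᶠ z in 𝓝[≠] w, v z ≤ ((t * Real.log ‖z - w‖ : ℝ) : EReal))
    {z : ℂ} (hz : ‖z‖ < 1) (hzw : z ≠ w) {t : ℝ} (ht0 : 0 < t) (ht1 : t < 1) {η : ℝ} (hη : 0 < η) :
    v z ≤ ((t * Real.log (pseudoDist z w) + η : ℝ) : EReal) := by
  obtain ⟨R, hR1, hR2⟩ := ((neg_le_log_pseudoDist hw hη).and (Filter.Eventually.and
    (Ioo_mem_nhdsLT hz) (Ioo_mem_nhdsLT hw))).exists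
  -- A rate strictly between t and 1 leaves room to absorb a constant near the pole.
  set t' := (1 + t) / 2 with ht'
  have hpole' := hpole t' (by rw [ht']; linarith) (by rw [ht']; linarith)
  obtain ⟨s₀, hs₀, hball⟩ := Metric.eventually_nhds_iff_ball.1 (eventually_nhdsWithin_iff.1 hpole')
  -- The inner radius s satisfies (t' − t) log s ≤ −t log 2. Since |1 − w̄p| ≤ 2, this gives t' log
  -- s ≤ t log ρ(p, w) on the inner circle. On the outer circle the allowance η suffices.
  have hlog : ∀ᶠ s in 𝓝[>] (0 : ℝ), Real.log s ≤ - (t * Real.log 2) / (t' - t) :=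
    Real.tendsto_log_nhdsGT_zero.eventually_le_atBot _
  have hzw' : 0 < ‖z - w‖ := norm_pos_iff.2 (sub_ne_zero.2 hzw)
  obtain ⟨s, hs1, hs2, hs3⟩ := (hlog.and (Filter.Eventually.and (Ioo_mem_nhdsGT hs₀)
    (Ioo_mem_nhdsGT hzw'))).exists
  have hs0 : 0 < s := hs2.1
  set K : Set ℂ := Metric.closedBall 0 R ∩ {x | s ≤ ‖x - w‖} with hKdef
  have hK : IsCompact K := (isCompact_closedBall 0 R).inter_right
    (isClosed_le (by fun_prop) (by fun_prop))
  have hK1 : ∀ x ∈ K, ‖x‖ < 1 ∧ x ≠ w := fun x hx => by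
    refine ⟨(mem_closedBall_zero_iff.1 hx.1).trans_lt hR2.1.2, ?_⟩
    rintro rfl
    have := hx.2
    simp at this
    linarith
  have hKsub : K ⊆ Metric.ball 0 1 := fun x hx => by simpa using (hK1 x hx).1
  refine le_of_boundary_le_of_submean hK (g := fun z => t * Real.log (pseudoDist z w) + η)
    (hv.1.mono hKsub) (fun p hp => hv.2.1 p (hKsub hp)) ?_ ?_ z ?_
  · exact (((continuousOn_log_pseudoDist hw.le).mono hK1).const_mul t).add_const η
  · intro p hp
    have hlt := (hK1 p hp).1
    rcases eq_or_lt_of_le (mem_closedBall_zero_iff.1 hp.1) with hpR | hpR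
    · left
      refine (hv0 p (hKsub hp)).trans ?_
      have h1 := hR1 p hpR
      have h2 : 0 ≤ t * Real.log (pseudoDist p w) + η := by nlinarith
      exact_mod_cast h2
    rcases eq_or_lt_of_le (show s ≤ ‖p - w‖ from hp.2) with hps | hps
    · left
      have h1 := hball p (by rw [mem_ball_iff_norm, ← hps]; exact hs2.2) (hK1 p hp).2
      refine h1.trans ?_
      rw [EReal.coe_le_coe_iff, ← hps]
      have h0 : 0 < ‖1 - (starRingEnd ℂ) w * p‖ :=
        norm_pos_iff.2 (one_sub_conj_mul_ne_zero hlt hw.le)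
      have h2 : ‖1 - (starRingEnd ℂ) w * p‖ ≤ 2 := by
        refine (norm_sub_le _ _).trans ?_
        rw [norm_one, norm_mul, Complex.norm_conj]
        nlinarith [norm_nonneg w, norm_nonneg p]
      have h3 : Real.log (pseudoDist p w) = Real.log s - Real.log ‖1 - (starRingEnd ℂ) w * p‖ := by
        rw [pseudoDist, norm_div, ← hps, Real.log_div hs0.ne' h0.ne']
      have h4 : Real.log ‖1 - (starRingEnd ℂ) w * p‖ ≤ Real.log 2 := Real.log_le_log h0 h2
      have h5 : 0 < t' - t := by rw [ht']; linarith
      rw [le_div_iff₀ h5] at hs1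
      rw [h3]
      nlinarith
    · right
      refine ⟨?_, ?_, ?_⟩
      · refine mem_interior_iff_mem_nhds.2 (Filter.inter_mem ?_ ?_)
        · exact mem_of_superset (Metric.isOpen_ball.mem_nhds (by simpa using hpR))
            Metric.ball_subset_closedBall
        · exact mem_of_superset ((isOpen_lt (f := fun _ : ℂ => s) (g := fun x : ℂ => ‖x - w‖)
            (by fun_prop) (by fun_prop)).mem_nhds hps) fun x (hx : s < _) => hx.le
      · exact ((harmonicAt_log_pseudoDist hlt hw.le (hK1 p hp).2).const_smul (c := t)).add
          (InnerProductSpace.harmonicAt_const η)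
      · exact hv.2.2 p (hKsub hp) 1
  · exact ⟨by simpa using hR2.1.1.le, hs3.2.le⟩

/-- Off the pole, both the loss in the coefficient and the additive error tend to 0. At the pole,
the submean inequality on shrinking circles forces the value `-∞`. -/
lemma le_log_pseudoDist {v : ℂ → EReal} (hv : IsPSH (Metric.ball 0 1) v)
    (hv0 : ∀ z ∈ Metric.ball (0 : ℂ) 1, v z ≤ 0) {w : ℂ} (hw : ‖w‖ < 1)
    (hpole : ∀ t : ℝ, 0 < t → t < 1 → ∀ᶠ z in 𝓝[≠] w, v z ≤ ((t * Real.log ‖z - w‖ : ℝ) : EReal))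
    {z : ℂ} (hz : ‖z‖ < 1) :
    v z ≤ ENNReal.log (ENNReal.ofReal (pseudoDist z w)) := by
  by_cases hzw : z = w
  · subst hzw
    have h0 : pseudoDist z z = 0 := by simp [pseudoDist]
    rw [h0, ENNReal.ofReal_zero, ENNReal.log_zero, le_bot_iff]
    by_contra hne
    have hlt : v z ≠ ⊤ := (hv.2.1 z (by simpa using hz)).ne
    obtain ⟨m, hm⟩ : ∃ m : ℝ, v z = m := ⟨_, (EReal.coe_toReal hlt hne).symm⟩
    obtain ⟨s, hs, hball⟩ := Metric.eventually_nhds_iff_ball.1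
      (eventually_nhdsWithin_iff.1 (hpole (1 / 2) (by norm_num) (by norm_num)))
    have hlog : ∀ᶠ r in 𝓝[>] (0 : ℝ), Real.log r ≤ 2 * (m - 1) :=
      Real.tendsto_log_nhdsGT_zero.eventually_le_atBot _
    obtain ⟨r, hr1, hr2, hr3⟩ := (hlog.and (Filter.Eventually.and (Ioo_mem_nhdsGT hs)
      (hv.2.2 z (by simpa using hz) 1))).exists
    have h1 : circleMean v z 1 r ≤
        (Real.circleAverage (fun _ => 1 / 2 * Real.log r) 0 r : ℝ) := by
      refine circleMean_le_circleAverage (by fun_prop) fun ζ hζ => ?_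
      rw [mem_sphere_zero_iff_norm, abs_of_pos hr2.1] at hζ
      have h2 := hball (z + ζ) (by simpa [hζ] using hr2.2)
        (by
          intro h
          have : ζ = 0 := by simpa using h
          rw [this, norm_zero] at hζ
          exact hr2.1.ne hζ)
      simpa [hζ] using h2
    rw [Real.circleAverage_const] at h1
    have h3 := hr3.trans h1
    rw [hm] at h3
    have h4 : m ≤ 1 / 2 * Real.log r := by exact_mod_cast h3
    linarith
  · have hp := pseudoDist_pos hz hw.le hzw
    rw [ENNReal.log_ofReal_of_pos hp]
    set L := Real.log (pseudoDist z w)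
    have h1 : Tendsto (fun k : ℝ => (((1 - k) * L + k : ℝ) : EReal)) (𝓝[>] 0) (𝓝 (L : EReal)) := by
      have h2 : Tendsto (fun k : ℝ => (((1 - k) * L + k : ℝ) : EReal)) (𝓝 0)
          (𝓝 (((1 - 0) * L + 0 : ℝ) : EReal)) :=
        (continuous_coe_real_ereal.comp (by fun_prop : Continuous fun k : ℝ =>
          (1 - k) * L + k)).tendsto 0
      rw [sub_zero, one_mul, add_zero] at h2
      exact h2.mono_left nhdsWithin_le_nhds
    refine ge_of_tendsto h1 ?_
    filter_upwards [Ioo_mem_nhdsGT one_pos] with k hk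
    exact le_mul_log_pseudoDist_add hv hv0 hw hpole hz hzw (by linarith [hk.2]) (by linarith [hk.1])
      hk.1

end DiscPole

/-! ### Automorphisms and the Green function of the ball -/

section BallMoebius

variable {H : Type*} [NormedAddCommGroup H] [InnerProductSpace ℂ H]

/-- The involutive automorphism of the unit ball that exchanges `a` and the origin. -/
def ballMoebius (a z : H) : H :=
  (1 - inner ℂ a z)⁻¹ • ((1 - inner ℂ a z / ((1 + √(1 - ‖a‖ ^ 2) : ℝ) : ℂ)) • a -
    ((√(1 - ‖a‖ ^ 2) : ℝ) : ℂ) • z)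

lemma one_sub_inner_ne_zero {a z : H} (ha : ‖a‖ ≤ 1) (hz : ‖z‖ < 1) : 1 - inner ℂ a z ≠ 0 := by
  intro h
  have h1 : ‖(inner ℂ a z : ℂ)‖ = 1 := by rw [← sub_eq_zero.1 h]; simp
  have h2 := norm_inner_le_norm (𝕜 := ℂ) a z
  nlinarith [norm_nonneg z, norm_nonneg a]

/-- The source of all facts about φ_a used below. With s = √(1 − ‖a‖²), the definition has 1/(1 + s)
in place of (1 − s)/‖a‖², so a = 0 is no exception, and the claim becomes a polynomial identity in
s, ‖z‖ and the real and imaginary parts of ⟨a, z⟩. -/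
lemma one_sub_norm_ballMoebius_sq {a z : H} (ha : ‖a‖ ≤ 1) (hz : ‖z‖ < 1) :
    1 - ‖ballMoebius a z‖ ^ 2 = (1 - ‖a‖ ^ 2) * (1 - ‖z‖ ^ 2) / ‖1 - inner ℂ a z‖ ^ 2 := by
  have h0 : ‖1 - inner ℂ a z‖ ≠ 0 := norm_ne_zero_iff.2 (one_sub_inner_ne_zero ha hz)
  have hA : 0 ≤ 1 - ‖a‖ ^ 2 := by nlinarith [norm_nonneg a]
  rw [ballMoebius, norm_smul, norm_inv, mul_pow, inv_pow, eq_div_iff (pow_ne_zero 2 h0), sub_mul,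
    mul_right_comm, inv_mul_cancel₀ (pow_ne_zero 2 h0)]
  obtain ⟨s, hs⟩ : ∃ s, s = √(1 - ‖a‖ ^ 2) := ⟨_, rfl⟩
  have hs0 : 0 ≤ s := hs ▸ Real.sqrt_nonneg _
  have hs2 : s ^ 2 = 1 - ‖a‖ ^ 2 := by rw [hs, Real.sq_sqrt hA]
  rw [← hs, norm_sub_sq (𝕜 := ℂ) ((1 - inner ℂ a z / ((1 + s : ℝ) : ℂ)) • a), norm_smul, norm_smul, inner_smul_left, inner_smul_right]
  have hA2 : ‖a‖ ^ 2 = 1 - s ^ 2 := by linarith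
  simp only [mul_pow, hA2]
  generalize (inner ℂ a z : ℂ) = τ
  generalize ‖z‖ = Z
  have h1s : 1 + s ≠ 0 := by positivity
  have hk : τ / ((1 + s : ℝ) : ℂ) = (τ.re / (1 + s) : ℝ) + (τ.im / (1 + s) : ℝ) * Complex.I := by
    apply Complex.ext <;> simp [Complex.div_ofReal_re, Complex.div_ofReal_im, -Complex.ofReal_add]
  rw [hk, ← Complex.normSq_eq_norm_sq, ← Complex.normSq_eq_norm_sq, ← Complex.normSq_eq_norm_sq]
  simp only [Complex.normSq_apply, RCLike.re_eq_complex_re]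
  simp only [Complex.sub_re, Complex.sub_im, Complex.add_re, Complex.add_im, Complex.mul_re,
    Complex.mul_im, Complex.ofReal_re, Complex.ofReal_im, Complex.I_re, Complex.I_im,
    Complex.one_re, Complex.one_im, Complex.conj_re, Complex.conj_im, map_sub, map_add, map_mul,
    map_one]
  field_simp
  ring

lemma norm_ballMoebius_lt_one {a z : H} (ha : ‖a‖ < 1) (hz : ‖z‖ < 1) : ‖ballMoebius a z‖ < 1 := by
  have h1 := one_sub_norm_ballMoebius_sq ha.le hz
  have h0 : 0 < ‖1 - inner ℂ a z‖ := norm_pos_iff.2 (one_sub_inner_ne_zero ha.le hz)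
  have h2 : 0 < 1 - ‖ballMoebius a z‖ ^ 2 := by
    rw [h1]
    have := norm_nonneg z
    have := norm_nonneg a
    refine div_pos (mul_pos ?_ ?_) (by positivity) <;> nlinarith
  nlinarith [norm_nonneg (ballMoebius a z)]

/-- The right side of the identity for 1 − ‖φ_a(z)‖² is symmetric in a and z. -/
lemma norm_ballMoebius_comm {a z : H} (ha : ‖a‖ < 1) (hz : ‖z‖ < 1) :
    ‖ballMoebius a z‖ = ‖ballMoebius z a‖ := by
  have h1 := one_sub_norm_ballMoebius_sq ha.le hz
  have h2 := one_sub_norm_ballMoebius_sq hz.le ha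
  have h3 : ‖1 - inner ℂ a z‖ = ‖1 - inner ℂ z a‖ := by
    rw [← Complex.norm_conj (1 - inner ℂ z a), map_sub, map_one, inner_conj_symm]
  rw [h3, mul_comm (1 - ‖a‖ ^ 2), ← h2] at h1
  exact (sq_eq_sq₀ (norm_nonneg _) (norm_nonneg _)).1 (by linarith)

lemma ballMoebius_self {a : H} (ha : ‖a‖ < 1) : ballMoebius a a = 0 := by
  have h1 := one_sub_norm_ballMoebius_sq ha.le ha
  have h2 : ‖1 - inner ℂ a a‖ = 1 - ‖a‖ ^ 2 := by
    rw [inner_self_eq_norm_sq_to_K]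
    have : (1 - ((‖a‖ : ℝ) : ℂ) ^ 2) = ((1 - ‖a‖ ^ 2 : ℝ) : ℂ) := by push_cast; rfl
    change ‖(1 - ((‖a‖ : ℝ) : ℂ) ^ 2)‖ = _
    rw [this, Complex.norm_real, Real.norm_of_nonneg]
    nlinarith [norm_nonneg a]
  have h3 : (1 - ‖a‖ ^ 2) ≠ 0 := by nlinarith [norm_nonneg a]
  rw [h2] at h1
  have : ‖ballMoebius a a‖ ^ 2 = 0 := by
    have h4 : (1 - ‖a‖ ^ 2) * (1 - ‖a‖ ^ 2) / (1 - ‖a‖ ^ 2) ^ 2 = 1 := by field_simp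
    linarith
  simpa using this

lemma differentiableOn_ballMoebius {a : H} (ha : ‖a‖ ≤ 1) :
    DifferentiableOn ℂ (ballMoebius a) (Metric.ball 0 1) := by
  have hi : Differentiable ℂ (fun z => (inner ℂ a z : ℂ)) := (innerSL ℂ a).differentiable
  have h1 : DifferentiableOn ℂ (fun z => (1 - inner ℂ a z : ℂ)⁻¹) (Metric.ball 0 1) :=
    DifferentiableOn.inv (by fun_prop) fun z hz => one_sub_inner_ne_zero ha (by simpa using hz)
  have h2 : Differentiable ℂ (fun z : H =>
      (1 - inner ℂ a z / ((1 + √(1 - ‖a‖ ^ 2) : ℝ) : ℂ)) • a -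
        ((√(1 - ‖a‖ ^ 2) : ℝ) : ℂ) • z) := by
    fun_prop
  exact h1.smul h2.differentiableOn

/-- Two points of the unit ball lie on a complex line which meets the ball in a disc, and the
automorphism norm is the pseudohyperbolic distance in that disc. -/
lemma exists_disc_through [Nontrivial H] {a x : H} (ha : ‖a‖ < 1) (hx : ‖x‖ < 1) :
    ∃ (c w : H) (α ξ : ℂ), a = c + α • w ∧ x = c + ξ • w ∧ ‖α‖ < 1 ∧ ‖ξ‖ < 1 ∧ w ≠ 0 ∧ ‖w‖ ≤ 1 ∧
      (∀ z : ℂ, ‖z‖ < 1 → ‖c + z • w‖ < 1) ∧ ‖ballMoebius a x‖ = pseudoDist ξ α := by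
  obtain ⟨e, μ, he, hxa⟩ : ∃ (e : H) (μ : ℂ), ‖e‖ = 1 ∧ x = a + μ • e := by
    by_cases h : x = a
    · obtain ⟨y, hy⟩ := NormedSpace.sphere_nonempty_rclike ℂ (E := H) zero_le_one
      exact ⟨y, 0, by simpa using hy, by simp [h]⟩
    · have h' : ‖x - a‖ ≠ 0 := norm_ne_zero_iff.2 (sub_ne_zero.2 h)
      refine ⟨((‖x - a‖⁻¹ : ℝ) : ℂ) • (x - a), ‖x - a‖, ?_, ?_⟩
      · rw [norm_smul, Complex.norm_real, norm_inv, norm_norm, inv_mul_cancel₀ h']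
      · rw [smul_smul, ← Complex.ofReal_mul, mul_inv_cancel₀ h']; simp
  have hee : (inner ℂ e e : ℂ) = 1 := by rw [inner_self_eq_norm_sq_to_K, he]; simp
  obtain ⟨p, hp⟩ : ∃ p : ℂ, p = inner ℂ e a := ⟨_, rfl⟩
  -- The point of the line nearest the origin. As c ⊥ e, the line meets the ball in the disc about c
  -- of radius σ = √(1 − ‖c‖²).
  obtain ⟨c, hc⟩ : ∃ c : H, c = a - p • e := ⟨_, rfl⟩
  have hce : (inner ℂ e c : ℂ) = 0 := by
    rw [hc, inner_sub_right, inner_smul_right, hee, hp]; ring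
  have hec : (inner ℂ c e : ℂ) = 0 := by rw [← inner_conj_symm, hce, map_zero]
  have hcc : (inner ℂ c c : ℂ) = ((‖c‖ ^ 2 : ℝ) : ℂ) := by
    rw [inner_self_eq_norm_sq_to_K]; simp
  have hin : ∀ z z' : ℂ, (inner ℂ (c + z • e) (c + z' • e) : ℂ) =
      ((‖c‖ ^ 2 : ℝ) : ℂ) + (starRingEnd ℂ) z * z' := by
    intro z z'
    simp only [inner_add_left, inner_add_right, inner_smul_left, inner_smul_right, hce, hec, hcc, hee]
    ring
  have hnorm : ∀ z : ℂ, ‖c + z • e‖ ^ 2 = ‖c‖ ^ 2 + ‖z‖ ^ 2 := by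
    intro z
    have h1 := hin z z
    have h2 : (inner ℂ (c + z • e) (c + z • e) : ℂ) = ((‖c + z • e‖ ^ 2 : ℝ) : ℂ) := by
      rw [inner_self_eq_norm_sq_to_K]; simp
    rw [h2, ← Complex.normSq_eq_conj_mul_self, Complex.normSq_eq_norm_sq] at h1
    exact_mod_cast h1
  have ha' : a = c + p • e := by rw [hc]; abel
  have hx' : x = c + (p + μ) • e := by rw [hxa, ha', add_smul]; abel
  have han := hnorm p
  rw [← ha'] at han
  have hxn := hnorm (p + μ)
  rw [← hx'] at hxn
  have hc1 : 0 < 1 - ‖c‖ ^ 2 := by nlinarith [norm_nonneg a, sq_nonneg ‖p‖]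
  obtain ⟨σ, hσ⟩ : ∃ σ : ℝ, σ = √(1 - ‖c‖ ^ 2) := ⟨_, rfl⟩
  have hσ0 : 0 < σ := hσ ▸ Real.sqrt_pos.2 hc1
  have hσ2 : σ ^ 2 = 1 - ‖c‖ ^ 2 := by rw [hσ, Real.sq_sqrt hc1.le]
  have hσC : (σ : ℂ) ≠ 0 := by exact_mod_cast hσ0.ne'
  have hdiv : ∀ z : ℂ, c + (z / σ) • ((σ : ℂ) • e) = c + z • e := fun z => by
    rw [smul_smul, div_mul_cancel₀ _ hσC]
  have hlt : ∀ z : ℂ, ‖c + z • e‖ < 1 → ‖z / σ‖ < 1 := by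
    intro z hz
    have h1 := hnorm z
    rw [norm_div, Complex.norm_real, Real.norm_of_nonneg hσ0.le, div_lt_one hσ0]
    have h2 : ‖c + z • e‖ ^ 2 < 1 := by nlinarith [norm_nonneg (c + z • e)]
    exact lt_of_pow_lt_pow_left₀ 2 hσ0.le (by linarith)
  refine ⟨c, (σ : ℂ) • e, p / σ, (p + μ) / σ, ?_, ?_, ?_, ?_, ?_, ?_, ?_, ?_⟩
  · rw [hdiv]; exact ha'
  · rw [hdiv]; exact hx'
  · exact hlt _ (ha' ▸ ha)
  · exact hlt _ (hx' ▸ hx)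
  · refine smul_ne_zero hσC ?_
    rintro rfl
    simp at he
  · rw [norm_smul, he, Complex.norm_real, Real.norm_of_nonneg hσ0.le]
    nlinarith [sq_nonneg ‖c‖]
  · intro z hz
    rw [smul_smul]
    have h1 := hnorm (z * σ)
    rw [norm_mul, Complex.norm_real, Real.norm_of_nonneg hσ0.le, mul_pow] at h1
    have h2 : ‖z‖ ^ 2 < 1 := by nlinarith [norm_nonneg z]
    have h3 : ‖c + (z * σ) • e‖ ^ 2 < 1 := by nlinarith
    nlinarith [norm_nonneg (c + (z * (σ : ℂ)) • e)]
  · have h1 := one_sub_norm_ballMoebius_sq ha.le hx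
    have h2 := one_sub_pseudoDist_sq (hlt _ (hx' ▸ hx)) (hlt _ (ha' ▸ ha)).le
    -- In the disc coordinate, 1 − ⟨a, x⟩ and the factors 1 − ‖·‖² all acquire the factor σ², which
    -- cancels; the identities for the ball and for the disc then coincide.
    have h3 : (1 - inner ℂ a x : ℂ) =
        ((σ ^ 2 : ℝ) : ℂ) * (1 - (starRingEnd ℂ) (p / σ) * ((p + μ) / σ)) := by
      conv_lhs => rw [ha', hx', hin]
      rw [map_div₀, Complex.conj_ofReal]
      have h5 : ((‖c‖ ^ 2 : ℝ) : ℂ) = 1 - (σ : ℂ) ^ 2 := by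
        rw [show ‖c‖ ^ 2 = 1 - σ ^ 2 by linarith]; push_cast; ring
      rw [h5]
      push_cast
      field_simp
      ring
    have h4 : ∀ z : ℂ, 1 - ‖c + z • e‖ ^ 2 = σ ^ 2 * (1 - ‖z / σ‖ ^ 2) := by
      intro z
      rw [hnorm, norm_div, Complex.norm_real, Real.norm_of_nonneg hσ0.le]
      field_simp
      linarith
    have hae := h4 p
    have hxe := h4 (p + μ)
    rw [← ha'] at hae
    rw [← hx'] at hxe
    rw [hae, hxe, h3, norm_mul, Complex.norm_real, Real.norm_of_nonneg (by positivity), mul_pow] at h1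
    have h6 : 1 - ‖ballMoebius a x‖ ^ 2 = 1 - pseudoDist ((p + μ) / σ) (p / σ) ^ 2 := by
      rw [h1, h2]
      field_simp
    exact (sq_eq_sq₀ (norm_nonneg _) (pseudoDist_nonneg _ _)).1 (by linarith)

lemma IsPSH.mono {E : Type*} [NormedAddCommGroup E] [NormedSpace ℂ E] {X Y : Set E} {u : E → EReal}
    (hu : IsPSH X u) (h : Y ⊆ X) : IsPSH Y u :=
  ⟨hu.1.mono h, fun a ha => hu.2.1 a (h ha), fun a ha => hu.2.2 a (h ha)⟩

/-- Restriction to the disc through a and x reduces the bound to the Green function of the unit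
disc. The pole is inherited because w ≠ 0 and ‖w‖ ≤ 1, so ‖(z − α)w‖ ≤ |z − α|. -/
lemma le_log_ballMoebius_of_isPSH [Nontrivial H] {u : H → EReal} (hu : IsPSH (Metric.ball 0 1) u)
    (hu0 : ∀ x ∈ Metric.ball (0 : H) 1, u x ≤ 0) {a x : H} (ha : ‖a‖ < 1) (hx : ‖x‖ < 1)
    (hl : 1 ≤ lelongNumber u a) : u x ≤ ENNReal.log ‖ballMoebius a x‖ₑ := by
  obtain ⟨c, w, α, ξ, hα, hξ, hα1, hξ1, hw, hw1, hball, heq⟩ := exists_disc_through ha hx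
  rw [← ofReal_norm, heq, hξ]
  have hsub : Metric.ball 0 1 ⊆ {z : ℂ | c + z • w ∈ Metric.ball (0 : H) 1} := fun z hz => by
    simpa using hball z (by simpa using hz)
  refine le_log_pseudoDist (v := fun z => u (c + z • w)) ((hu.comp_line c w).mono hsub)
    (fun z hz => hu0 _ (hsub hz)) hα1 ?_ hξ1
  intro t ht0 ht1
  have h1 := eventually_le_log_of_one_le_lelongNumber hl ht1
  have htend : Tendsto (fun z : ℂ => c + z • w) (𝓝[≠] α) (𝓝[≠] a) := by
    refine tendsto_nhdsWithin_iff.2 ⟨?_, ?_⟩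
    · rw [hα]
      exact (Continuous.tendsto (by fun_prop) α).mono_left nhdsWithin_le_nhds
    · filter_upwards [self_mem_nhdsWithin] with z hz h
      rw [mem_singleton_iff, hα, add_right_inj] at h
      exact hz (smul_left_injective ℂ hw h)
  filter_upwards [htend.eventually h1, self_mem_nhdsWithin] with z hz hz1
  refine hz.trans ?_
  rw [EReal.coe_le_coe_iff]
  have h2 : 0 < ‖z - α‖ := norm_pos_iff.2 (sub_ne_zero.2 hz1)
  have h3 : c + z • w - a = (z - α) • w := by rw [hα, sub_smul]; abel
  rw [h3, norm_smul]
  have h4 := norm_pos_iff.2 hw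
  gcongr
  nlinarith

lemma eventually_log_norm_le_of_eq_zero {E F : Type*} [NormedAddCommGroup E] [NormedSpace ℂ E]
    [NormedAddCommGroup F] [NormedSpace ℂ F] {f : E → F} {a : E} (hf : DifferentiableAt ℂ f a)
    (h0 : f a = 0) : ∃ C : ℝ, 0 < C ∧
      ∀ᶠ z in 𝓝 a, ENNReal.log ‖f z‖ₑ ≤ ENNReal.log (ENNReal.ofReal (C * ‖z - a‖)) := by
  obtain ⟨C, hC, h⟩ := hf.hasFDerivAt.isBigO_sub.exists_pos
  refine ⟨C, hC, ?_⟩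
  filter_upwards [h.bound] with z hz
  rw [h0, sub_zero] at hz
  rw [ENNReal.log_le_log_iff, ← ofReal_norm]
  exact ENNReal.ofReal_le_ofReal hz

/-- The pluricomplex Green function of the unit ball. -/
lemma greenPoint_ball [Nontrivial H] {a x : H} (ha : ‖a‖ < 1) (hx : ‖x‖ < 1) :
    greenPoint (Metric.ball 0 1) a x = ENNReal.log ‖ballMoebius a x‖ₑ := by
  refine le_antisymm (iSup₂_le fun u hu => ?_) ?_
  · refine le_log_ballMoebius_of_isPSH hu.1 hu.2.1 ha hx ?_
    simpa using hu.2.2 a (by simpa using ha)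
  · have hd := differentiableOn_ballMoebius ha.le
    have hle : ∀ z ∈ Metric.ball (0 : H) 1, ENNReal.log ‖ballMoebius a z‖ₑ ≤ 0 := fun z hz => by
      rw [ENNReal.log_le_zero_iff, ← ofReal_norm, ENNReal.ofReal_le_one]
      exact (norm_ballMoebius_lt_one ha (by simpa using hz)).le
    -- The upper bound log ‖φ_a‖ is itself a competitor.
    refine le_iSup₂_of_le (fun z => ENNReal.log ‖ballMoebius a z‖ₑ) ⟨?_, hle, ?_⟩ le_rfl
    · exact isPSH_log_norm Metric.isOpen_ball hd
    · intro b hb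
      by_cases hba : b = a
      · subst hba
        simp only [mem_singleton_iff, indicator_of_mem]
        obtain ⟨C, hC, h⟩ := eventually_log_norm_le_of_eq_zero
          (hd.differentiableAt (Metric.isOpen_ball.mem_nhds hb)) (ballMoebius_self ha)
        exact one_le_lelongNumber hC h
      · rw [indicator_of_notMem (by simpa using hba)]
        exact lelongNumber_nonneg (mem_of_superset (Metric.isOpen_ball.mem_nhds hb) hle)

end BallMoebius

/-! ### The Poincaré distance: triangle inequality and Schwarz–Pick -/

section Disc

lemma poincareDist_eq_artanh (z w : ℂ) : poincareDist z w = Real.artanh (pseudoDist z w) := rfl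

lemma poincareDist_nonneg (z w : ℂ) : 0 ≤ poincareDist z w :=
  Real.artanh_nonneg (pseudoDist_nonneg z w)

lemma pseudoDist_comm {z w : ℂ} : pseudoDist z w = pseudoDist w z := by
  rw [pseudoDist, pseudoDist, norm_div, norm_div, norm_sub_rev,
    ← Complex.norm_conj (1 - (starRingEnd ℂ) w * z)]
  simp [mul_comm]

lemma poincareDist_comm (z w : ℂ) : poincareDist z w = poincareDist w z := by
  rw [poincareDist_eq_artanh, pseudoDist_comm, ← poincareDist_eq_artanh]

/-- Invariance of the pseudohyperbolic distance under disc automorphisms. -/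
lemma pseudoDist_moebius {z w v : ℂ} (hz : ‖z‖ < 1) (hw : ‖w‖ < 1) (hv : ‖v‖ < 1) :
    pseudoDist ((z - v) / (1 - (starRingEnd ℂ) v * z)) ((w - v) / (1 - (starRingEnd ℂ) v * w)) =
      pseudoDist z w := by
  have h1 := one_sub_conj_mul_ne_zero hz hv.le
  have h2 := one_sub_conj_mul_ne_zero hw hv.le
  have h2' : 1 - v * (starRingEnd ℂ) w ≠ 0 := by
    rw [mul_comm]; exact one_sub_conj_mul_ne_zero hv hw.le
  have h3 := one_sub_conj_mul_ne_zero hv hv.le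
  have h4 := one_sub_conj_mul_ne_zero hz hw.le
  have e1 : (z - v) / (1 - (starRingEnd ℂ) v * z) - (w - v) / (1 - (starRingEnd ℂ) v * w) =
      (1 - (starRingEnd ℂ) v * v) * (z - w) /
        ((1 - (starRingEnd ℂ) v * z) * (1 - (starRingEnd ℂ) v * w)) := by
    rw [div_sub_div _ _ h1 h2]
    congr 1
    ring
  have e2 : 1 - (starRingEnd ℂ) ((w - v) / (1 - (starRingEnd ℂ) v * w)) *
      ((z - v) / (1 - (starRingEnd ℂ) v * z)) =
      (1 - (starRingEnd ℂ) v * v) * (1 - (starRingEnd ℂ) w * z) /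
        ((1 - v * (starRingEnd ℂ) w) * (1 - (starRingEnd ℂ) v * z)) := by
    rw [map_div₀]
    simp only [map_sub, map_mul, map_one, Complex.conj_conj]
    rw [div_mul_div_comm, one_sub_div (mul_ne_zero h2' h1)]
    congr 1
    ring
  have e3 : ‖1 - v * (starRingEnd ℂ) w‖ = ‖1 - (starRingEnd ℂ) v * w‖ := by
    rw [← Complex.norm_conj]; simp
  rw [pseudoDist, e1, e2, pseudoDist]
  simp only [norm_div, norm_mul, e3]
  have n1 := norm_ne_zero_iff.2 h1
  have n2 := norm_ne_zero_iff.2 h2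
  have n3 := norm_ne_zero_iff.2 h3
  have n4 := norm_ne_zero_iff.2 h4
  field_simp

lemma pseudoDist_zero_right (z : ℂ) : pseudoDist z 0 = ‖z‖ := by simp [pseudoDist]

lemma artanh_add {x y : ℝ} (hx0 : 0 ≤ x) (hx : x < 1) (hy0 : 0 ≤ y) (hy : y < 1) :
    (x + y) / (1 + x * y) < 1 ∧
    Real.artanh ((x + y) / (1 + x * y)) = Real.artanh x + Real.artanh y := by
  have h0 : 0 < 1 + x * y := by positivity
  have h1 : (x + y) / (1 + x * y) < 1 := by
    rw [div_lt_one h0]; nlinarith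
  have h2 : 0 ≤ (x + y) / (1 + x * y) := by positivity
  refine ⟨h1, ?_⟩
  rw [Real.artanh_eq_half_log ⟨by linarith, by linarith⟩, Real.artanh_eq_half_log
    ⟨by linarith, by linarith⟩, Real.artanh_eq_half_log ⟨by linarith, by linarith⟩, ← mul_add,
    ← Real.log_mul (div_pos (by linarith) (by linarith)).ne'
      (div_pos (by linarith) (by linarith)).ne']
  congr 2
  have a1 : 1 - x ≠ 0 := by linarith
  have a2 : 1 - y ≠ 0 := by linarith
  have a3 : 1 - (x + y) / (1 + x * y) ≠ 0 := by linarith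
  have a4 : 1 - (x + y) / (1 + x * y) = (1 - x) * (1 - y) / (1 + x * y) := by field_simp; ring
  have a5 : 1 + (x + y) / (1 + x * y) = (1 + x) * (1 + y) / (1 + x * y) := by field_simp; ring
  rw [a4, a5]
  field_simp

/-- An automorphism moves v to 0. The pseudohyperbolic distance of the images Z, W is at most (‖Z‖ +
‖W‖)/(1 + ‖Z‖‖W‖), and artanh turns this expression into a sum. -/
lemma poincareDist_triangle {z v w : ℂ} (hz : ‖z‖ < 1) (hv : ‖v‖ < 1) (hw : ‖w‖ < 1) :
    poincareDist z w ≤ poincareDist z v + poincareDist v w := by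
  rw [poincareDist_comm v w, poincareDist_eq_artanh, poincareDist_eq_artanh, poincareDist_eq_artanh]
  have hZ := pseudoDist_lt_one hz hv
  have hW := pseudoDist_lt_one hw hv
  obtain ⟨hlt, heq⟩ := artanh_add (pseudoDist_nonneg z v) hZ (pseudoDist_nonneg w v) hW
  rw [← heq]
  refine Real.artanh_le_artanh (by linarith [pseudoDist_nonneg z w]) hlt ?_
  have h1 := one_sub_pseudoDist_sq hZ hW.le
  rw [pseudoDist_moebius hz hw hv] at h1
  obtain ⟨Z, hZd⟩ : ∃ Z, Z = (z - v) / (1 - (starRingEnd ℂ) v * z) := ⟨_, rfl⟩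
  obtain ⟨W, hWd⟩ : ∃ W, W = (w - v) / (1 - (starRingEnd ℂ) v * w) := ⟨_, rfl⟩
  have eZ : pseudoDist z v = ‖Z‖ := by rw [hZd]; rfl
  have eW : pseudoDist w v = ‖W‖ := by rw [hWd]; rfl
  rw [← hZd, ← hWd] at h1
  rw [eZ] at hZ ⊢
  rw [eW] at hW ⊢
  have hZ0 := norm_nonneg Z
  have hW0 := norm_nonneg W
  have h3 : ‖1 - (starRingEnd ℂ) W * Z‖ ≤ 1 + ‖Z‖ * ‖W‖ := by
    refine (norm_sub_le _ _).trans_eq ?_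
    rw [norm_one, norm_mul, Complex.norm_conj, mul_comm]
  have h4 : 0 < ‖1 - (starRingEnd ℂ) W * Z‖ := norm_pos_iff.2 (one_sub_conj_mul_ne_zero hZ hW.le)
  have h5 : (1 - ‖Z‖ ^ 2) * (1 - ‖W‖ ^ 2) / (1 + ‖Z‖ * ‖W‖) ^ 2 ≤
      (1 - ‖Z‖ ^ 2) * (1 - ‖W‖ ^ 2) / ‖1 - (starRingEnd ℂ) W * Z‖ ^ 2 := by
    have : 0 ≤ 1 - ‖Z‖ ^ 2 := by nlinarith
    have : 0 ≤ 1 - ‖W‖ ^ 2 := by nlinarith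
    gcongr
  have h6 : 1 - ((‖Z‖ + ‖W‖) / (1 + ‖Z‖ * ‖W‖)) ^ 2 =
      (1 - ‖Z‖ ^ 2) * (1 - ‖W‖ ^ 2) / (1 + ‖Z‖ * ‖W‖) ^ 2 := by
    have : 1 + ‖Z‖ * ‖W‖ ≠ 0 := by positivity
    field_simp
    ring
  exact le_of_sq_le_sq (by linarith) (by positivity)

/-- The Schwarz–Pick lemma. -/
lemma pseudoDist_map_le {f : ℂ → ℂ} (hf : DifferentiableOn ℂ f (Metric.ball 0 1))
    (hm : MapsTo f (Metric.ball 0 1) (Metric.ball 0 1)) {z w : ℂ} (hz : ‖z‖ < 1) (hw : ‖w‖ < 1) :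
    pseudoDist (f z) (f w) ≤ pseudoDist z w := by
  have hfb : ∀ z : ℂ, ‖z‖ < 1 → ‖f z‖ < 1 := fun z hz => by
    simpa using hm (show z ∈ Metric.ball 0 1 by simpa using hz)
  -- The automorphism ζ ↦ (ζ + w)/(1 + w̄ζ), which takes 0 to w. Composing f with it and with the
  -- automorphism taking f(w) to 0 gives a map fixing 0, to which the Schwarz lemma applies.
  set m : ℂ → ℂ := fun ζ => (ζ - (-w)) / (1 - (starRingEnd ℂ) (-w) * ζ) with hmdef
  have hw' : ‖-w‖ < 1 := by rwa [norm_neg]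
  have hmb : ∀ ζ : ℂ, ‖ζ‖ < 1 → ‖m ζ‖ < 1 := fun ζ hζ => pseudoDist_lt_one hζ hw'
  have hmd : DifferentiableOn ℂ m (Metric.ball 0 1) :=
    DifferentiableOn.div (by fun_prop) (by fun_prop) fun ζ hζ =>
      one_sub_conj_mul_ne_zero (by simpa using hζ) hw'.le
  have hfm : DifferentiableOn ℂ (fun ζ => f (m ζ)) (Metric.ball 0 1) :=
    hf.comp hmd fun ζ hζ => by simpa using hmb ζ (by simpa using hζ)
  set g : ℂ → ℂ := fun ζ => (f (m ζ) - f w) / (1 - (starRingEnd ℂ) (f w) * f (m ζ)) with hg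
  have hgd : DifferentiableOn ℂ g (Metric.ball 0 1) :=
    DifferentiableOn.div (hfm.sub_const _) ((hfm.const_mul _).const_sub _) fun ζ hζ =>
      one_sub_conj_mul_ne_zero (hfb _ (hmb ζ (by simpa using hζ))) (hfb w hw).le
  have hgb : MapsTo g (Metric.ball 0 1) (Metric.closedBall 0 1) := fun ζ hζ => by
    have := pseudoDist_lt_one (hfb _ (hmb ζ (by simpa using hζ))) (hfb w hw)
    rw [mem_closedBall_zero_iff]
    exact this.le
  have hm0 : m 0 = w := by simp [hmdef]
  have hg0 : g 0 = 0 := by simp [hg, hm0]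
  set ζ : ℂ := (z - w) / (1 - (starRingEnd ℂ) w * z) with hζ
  have hζ1 : ‖ζ‖ < 1 := pseudoDist_lt_one hz hw
  have hmζ : m ζ = z := by
    have h1 := one_sub_conj_mul_ne_zero hz hw.le
    have h3 := one_sub_conj_mul_ne_zero hζ1 hw'.le
    have hD : ζ * (1 - (starRingEnd ℂ) w * z) = z - w := div_mul_cancel₀ _ h1
    rw [hmdef]
    simp only
    rw [div_eq_iff h3, map_neg]
    linear_combination hD
  have := Complex.norm_le_norm_of_mapsTo_ball hgd hgb hg0 hζ1
  rw [hg] at this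
  simp only [hmζ] at this
  exact this

lemma poincareDist_map_le {f : ℂ → ℂ} (hf : DifferentiableOn ℂ f (Metric.ball 0 1))
    (hm : MapsTo f (Metric.ball 0 1) (Metric.ball 0 1)) {z w : ℂ} (hz : ‖z‖ < 1) (hw : ‖w‖ < 1) :
    poincareDist (f z) (f w) ≤ poincareDist z w := by
  rw [poincareDist_eq_artanh, poincareDist_eq_artanh]
  exact Real.artanh_le_artanh (by linarith [pseudoDist_nonneg (f z) (f w)])
    (pseudoDist_lt_one hz hw) (pseudoDist_map_le hf hm hz hw)

end Disc

/-! ### Invariant distances of the ball -/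

section Distances

variable {E : Type*} [NormedAddCommGroup E] [NormedSpace ℂ E]

lemma caratheodoryDist_le_discDelta (X : Set E) (x a : E) :
    caratheodoryDist X x a ≤ discDelta X x a := by
  refine iSup_le fun f => iSup₂_le fun hf hm => ?_
  refine le_iInf fun g => le_iInf fun hg => le_iInf fun hgm => le_iInf fun z => le_iInf fun hz =>
    le_iInf fun w => le_iInf fun hw => le_iInf fun hzx => le_iInf fun hwa => ?_
  subst hzx hwa
  refine ENNReal.ofReal_le_ofReal ?_
  exact poincareDist_map_le (f := fun z => f (g z)) (hf.comp hg hgm) (hm.comp hgm) (by simpa using hz)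
    (by simpa using hw)

lemma caratheodoryDist_triangle {X : Set E} {x y z : E} (hx : x ∈ X) (hy : y ∈ X) (hz : z ∈ X) :
    caratheodoryDist X x z ≤ caratheodoryDist X x y + caratheodoryDist X y z := by
  refine iSup_le fun f => iSup₂_le fun hf hm => ?_
  have key : ∀ p q, ENNReal.ofReal (poincareDist (f p) (f q)) ≤ caratheodoryDist X p q := fun p q =>
    le_iSup_of_le f (le_iSup₂_of_le hf hm le_rfl)
  refine le_trans ?_ (add_le_add (key x y) (key y z))
  rw [← ENNReal.ofReal_add (poincareDist_nonneg _ _) (poincareDist_nonneg _ _)]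
  exact ENNReal.ofReal_le_ofReal (poincareDist_triangle (by simpa using hm hx)
    (by simpa using hm hy) (by simpa using hm hz))

variable {H : Type*} [NormedAddCommGroup H] [InnerProductSpace ℂ H]

/-- The test function is φ_a paired with the unit vector in the direction of φ_a(x). -/
lemma artanh_norm_ballMoebius_le_caratheodoryDist {a x : H} (ha : ‖a‖ < 1) :
    ENNReal.ofReal (Real.artanh ‖ballMoebius a x‖) ≤ caratheodoryDist (Metric.ball 0 1) x a := by
  by_cases h0 : ballMoebius a x = 0
  · simp [h0]
  have hn : 0 < ‖ballMoebius a x‖ := norm_pos_iff.2 h0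
  obtain ⟨e, he⟩ : ∃ e : H, e = ((‖ballMoebius a x‖⁻¹ : ℝ) : ℂ) • ballMoebius a x := ⟨_, rfl⟩
  have he1 : ‖e‖ = 1 := by
    rw [he, norm_smul, Complex.norm_real, norm_inv, norm_norm, inv_mul_cancel₀ hn.ne']
  refine le_iSup_of_le (fun z => inner ℂ e (ballMoebius a z)) (le_iSup₂_of_le ?_ ?_ ?_)
  · exact (innerSL ℂ e).differentiable.comp_differentiableOn (differentiableOn_ballMoebius ha.le)
  · intro z hz
    have h1 := norm_inner_le_norm (𝕜 := ℂ) e (ballMoebius a z)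
    rw [he1, one_mul] at h1
    simpa using h1.trans_lt (norm_ballMoebius_lt_one ha (by simpa using hz))
  · simp only
    rw [poincareDist_eq_artanh, ballMoebius_self ha, inner_zero_right, pseudoDist_zero_right, he,
      inner_smul_left, inner_self_eq_norm_sq_to_K]
    refine ENNReal.ofReal_le_ofReal (le_of_eq ?_)
    congr 1
    simp
    field_simp

/-- The slice of the ball by the complex line through a and x is the disc used. -/
lemma discDelta_ball_le [Nontrivial H] {a x : H} (ha : ‖a‖ < 1) (hx : ‖x‖ < 1) :
    discDelta (Metric.ball 0 1) x a ≤ ENNReal.ofReal (Real.artanh ‖ballMoebius a x‖) := by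
  obtain ⟨c, w, α, ξ, hα, hξ, hα1, hξ1, -, -, hball, heq⟩ := exists_disc_through ha hx
  rw [heq, ← poincareDist_eq_artanh]
  refine iInf_le_of_le (fun z => c + z • w) (iInf_le_of_le (by fun_prop) (iInf_le_of_le ?_
    (iInf_le_of_le ξ (iInf_le_of_le (by simpa using hξ1) (iInf_le_of_le α (iInf_le_of_le
      (by simpa using hα1) (iInf_le_of_le hξ.symm (iInf_le_of_le hα.symm le_rfl))))))))
  intro z hz
  simpa using hball z (by simpa using hz)

lemma caratheodoryDist_ball [Nontrivial H] {a x : H} (ha : ‖a‖ < 1) (hx : ‖x‖ < 1) :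
    caratheodoryDist (Metric.ball 0 1) x a = ENNReal.ofReal (Real.artanh ‖ballMoebius a x‖) :=
  le_antisymm ((caratheodoryDist_le_discDelta _ _ _).trans (discDelta_ball_le ha hx))
    (artanh_norm_ballMoebius_le_caratheodoryDist ha)

lemma discDelta_ball [Nontrivial H] {a x : H} (ha : ‖a‖ < 1) (hx : ‖x‖ < 1) :
    discDelta (Metric.ball 0 1) x a = ENNReal.ofReal (Real.artanh ‖ballMoebius a x‖) :=
  le_antisymm (discDelta_ball_le ha hx)
    ((artanh_norm_ballMoebius_le_caratheodoryDist ha).trans (caratheodoryDist_le_discDelta _ _ _))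

lemma kobayashiDist_ball [Nontrivial H] {a x : H} (ha : ‖a‖ < 1) (hx : ‖x‖ < 1) :
    kobayashiDist (Metric.ball 0 1) x a = ENNReal.ofReal (Real.artanh ‖ballMoebius a x‖) := by
  refine le_antisymm ?_ ?_
  · refine iSup_le fun d => iSup₂_le fun _ hd => ?_
    rw [← discDelta_ball ha hx]
    exact hd x (by simpa using hx) a (by simpa using ha)
  -- The function artanh ‖φ_a(x)‖ competes in the supremum: it equals δ, and its triangle inequality
  -- is inherited from the Carathéodory distance.
  · refine le_iSup_of_le (fun x a => Real.artanh ‖ballMoebius a x‖) (le_iSup₂_of_le ?_ ?_ le_rfl)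
    · refine ⟨fun y hy => ?_, fun y hy z hz => ?_, fun y hy z hz t ht => ?_⟩
      · simp [ballMoebius_self (show ‖y‖ < 1 by simpa using hy)]
      · simp only
        rw [norm_ballMoebius_comm (by simpa using hz) (by simpa using hy)]
      · have h1 := caratheodoryDist_triangle hy hz ht
        rw [mem_ball_zero_iff] at hy hz ht
        rw [caratheodoryDist_ball ht hy, caratheodoryDist_ball hz hy, caratheodoryDist_ball ht hz,
          ← ENNReal.ofReal_add (Real.artanh_nonneg (norm_nonneg _))
          (Real.artanh_nonneg (norm_nonneg _))] at h1
        exact (ENNReal.ofReal_le_ofReal_iff (add_nonneg (Real.artanh_nonneg (norm_nonneg _))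
          (Real.artanh_nonneg (norm_nonneg _)))).1 h1
    · intro p hp q hq
      rw [discDelta_ball (by simpa using hq) (by simpa using hp)]

lemma logTanh_ofReal_artanh {ρ : ℝ} (h0 : 0 ≤ ρ) (h1 : ρ < 1) :
    logTanh (ENNReal.ofReal (Real.artanh ρ)) = ENNReal.log (ENNReal.ofReal ρ) := by
  rw [logTanh, if_neg ENNReal.ofReal_ne_top, ENNReal.toReal_ofReal (Real.artanh_nonneg h0),
    Real.tanh_artanh ⟨by linarith, h1⟩]

lemma logTanh_monotone : Monotone logTanh := by
  intro d d' h
  unfold logTanh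
  split_ifs with h1 h2 h2
  · exact le_rfl
  · exact absurd (top_le_iff.1 (h1 ▸ h)) h2
  · rw [ENNReal.log_le_zero_iff, ENNReal.ofReal_le_one]
    exact (Real.tanh_lt_one _).le
  · rw [ENNReal.log_le_log_iff]
    refine ENNReal.ofReal_le_ofReal ((Real.artanh_le_artanh_iff
      ⟨Real.neg_one_lt_tanh _, Real.tanh_lt_one _⟩ ⟨Real.neg_one_lt_tanh _, Real.tanh_lt_one _⟩).1 ?_)
    rw [Real.artanh_tanh, Real.artanh_tanh]
    exact ENNReal.toReal_mono h2 h

lemma continuousAt_logTanh {d : ENNReal} (hd : d ≠ ⊤) : ContinuousAt logTanh d := by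
  have h1 : ContinuousAt (fun d : ENNReal =>
      ENNReal.log (ENNReal.ofReal (Real.tanh d.toReal))) d := by
    refine ENNReal.continuous_log.continuousAt.comp
      (ENNReal.continuous_ofReal.continuousAt.comp ?_)
    have ht : Continuous Real.tanh := by
      rw [funext Real.tanh_eq_sinh_div_cosh]
      exact Real.continuous_sinh.div Real.continuous_cosh fun x => (Real.cosh_pos x).ne'
    exact ht.continuousAt.comp (ENNReal.continuousAt_toReal hd)
  refine h1.congr ?_
  filter_upwards [isOpen_ne.mem_nhds hd] with x hx
  rw [logTanh, if_neg hx]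

lemma logTanh_iInf₂ {ι : Type*} {A : Set ι} {c : ι → ENNReal} (hA : A.Nonempty)
    (hc : ∀ a ∈ A, c a ≠ ⊤) : logTanh (⨅ a ∈ A, c a) = ⨅ a ∈ A, logTanh (c a) := by
  obtain ⟨a, ha⟩ := hA
  have : Nonempty A := ⟨⟨a, ha⟩⟩
  rw [iInf_subtype', iInf_subtype']
  have hfin : (⨅ a : A, c a) ≠ ⊤ :=
    ((iInf_le (fun a : A => c a) ⟨a, ha⟩).trans_lt (hc a ha).lt_top).ne
  exact Monotone.map_ciInf_of_continuousAt (continuousAt_logTanh hfin) logTanh_monotone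
    (OrderBot.bddBelow _)

end Distances

/-! ### Holomorphic dependence of integrals on parameters -/

section ParametricIntegral

variable {E : Type*} [NormedAddCommGroup E] [NormedSpace ℂ E] [ProperSpace E]

/-- Joint continuity suffices, because Schwarz-lemma estimates on a fixed ball control the
increments and derivatives in z that differentiation under the integral requires. -/
lemma differentiableOn_intervalIntegral {U : Set E} (hU : IsOpen U) {κ : ℝ → E → ℂ} {a b : ℝ}
    (hab : a ≤ b) (hc : ContinuousOn (Function.uncurry κ) (univ ×ˢ U))
    (hd : ∀ θ, DifferentiableOn ℂ (κ θ) U) :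
    DifferentiableOn ℂ (fun z => ∫ θ in a..b, κ θ z) U := by
  intro z₀ hz₀
  refine DifferentiableAt.differentiableWithinAt ?_
  obtain ⟨s, hs, hsU⟩ := Metric.nhds_basis_closedBall.mem_iff.1 (hU.mem_nhds hz₀)
  have hcompact : IsCompact (Metric.closedBall z₀ s) := isCompact_closedBall z₀ s
  have hcK : ContinuousOn (Function.uncurry κ) (univ ×ˢ Metric.closedBall z₀ s) :=
    hc.mono (prod_mono le_rfl hsU)
  have hcz : ∀ z ∈ U, Continuous fun θ => κ θ z := fun z hz =>
    hc.comp_continuous (f := fun θ => (θ, z)) (by fun_prop) fun θ => ⟨mem_univ _, hz⟩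
  obtain ⟨M, hM⟩ := (isCompact_Icc.prod hcompact).exists_bound_of_continuousOn
    (hcK.mono (prod_mono (subset_univ (Icc a b)) le_rfl))
  have hdb : ∀ θ, DifferentiableOn ℂ (κ θ) (Metric.ball z₀ s) := fun θ =>
    (hd θ).mono (Metric.ball_subset_closedBall.trans hsU)
  have hF' : Continuous fun θ => fderiv ℂ (κ θ) z₀ := by
    rw [continuous_iff_continuousAt]
    intro θ₀
    rw [Metric.continuousAt_iff']
    intro ε hε
    -- Closeness ε s/4 on the closed ball becomes ε s/2 after subtracting the central value, hence
    -- ε/2 for the derivative.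
    obtain ⟨v, hv, hvu⟩ := hcompact.mem_uniformity_of_prod hcK (mem_univ θ₀)
      (Metric.dist_mem_uniformity (show 0 < ε * s / 4 by positivity))
    rw [nhdsWithin_univ] at hv
    filter_upwards [hv] with θ hθ
    have hdz : ∀ θ, DifferentiableAt ℂ (κ θ) z₀ := fun θ => (hd θ).differentiableAt (hU.mem_nhds hz₀)
    have hle : ∀ z ∈ Metric.closedBall z₀ s, ‖κ θ z - κ θ₀ z‖ ≤ ε * s / 4 := fun z hz => by
      have h1 : dist (κ θ z) (κ θ₀ z) < ε * s / 4 := hvu θ hθ z hz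
      rw [dist_eq_norm] at h1
      exact h1.le
    rw [dist_eq_norm, ← fderiv_fun_sub (hdz θ) (hdz θ₀)]
    have h2 := Complex.norm_fderiv_le_div_of_mapsTo_ball (f := fun z => κ θ z - κ θ₀ z)
      (c := z₀) (R₁ := s) (R₂ := ε * s / 2) ((hdb θ).sub (hdb θ₀)) (fun z hz => by
        rw [mem_closedBall_iff_norm]
        refine (norm_sub_le _ _).trans ?_
        have := hle z (Metric.ball_subset_closedBall hz)
        have := hle z₀ (Metric.mem_closedBall_self hs.le)
        linarith) hs
    refine h2.trans_lt ?_
    rw [div_lt_iff₀ hs]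
    nlinarith
  have key := hasFDerivAt_integral_of_dominated_loc_of_lip' (𝕜 := ℂ)
    (μ := volume.restrict (Ioc a b)) (F := fun z θ => κ θ z) (x₀ := z₀)
    (F' := fun θ => fderiv ℂ (κ θ) z₀) (bound := fun _ => 2 * M / s)
    (Metric.ball_mem_nhds z₀ hs)
    (fun z hz => (hcz z (hsU (Metric.ball_subset_closedBall hz))).aestronglyMeasurable)
    (((hcz z₀ hz₀).integrableOn_Icc).mono_set Ioc_subset_Icc_self)
    hF'.aestronglyMeasurable
    (by
      refine (ae_restrict_mem measurableSet_Ioc).mono fun θ hθ z hz => ?_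
      have h1 := Complex.dist_le_div_mul_dist_of_mapsTo_ball (f := κ θ) (c := z₀) (R₁ := s)
        (R₂ := 2 * M) (hdb θ) (fun y hy => by
          rw [mem_closedBall_iff_norm]
          refine (norm_sub_le _ _).trans ?_
          have h1 : ‖κ θ y‖ ≤ M := hM (θ, y) ⟨Ioc_subset_Icc_self hθ, Metric.ball_subset_closedBall hy⟩
          have h2 : ‖κ θ z₀‖ ≤ M := hM (θ, z₀) ⟨Ioc_subset_Icc_self hθ, Metric.mem_closedBall_self hs.le⟩
          linarith) hz
      simpa [dist_eq_norm] using h1)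
    (integrable_const _)
    (Eventually.of_forall fun θ => ((hd θ).differentiableAt (hU.mem_nhds hz₀)).hasFDerivAt)
  have := key.2.differentiableAt
  simpa only [intervalIntegral.integral_of_le hab] using this

lemma differentiableOn_circleIntegral {U : Set E} (hU : IsOpen U) {k : ℂ → E → ℂ} {c : ℂ} {R : ℝ}
    (hR : 0 ≤ R) (hc : ContinuousOn (Function.uncurry k) (Metric.sphere c R ×ˢ U))
    (hd : ∀ ζ ∈ Metric.sphere c R, DifferentiableOn ℂ (k ζ) U) :
    DifferentiableOn ℂ (fun z => ∮ ζ in C(c, R), k ζ z) U := by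
  refine differentiableOn_intervalIntegral hU (by positivity) ?_ fun θ => ?_
  · have h1 : ContinuousOn (fun p : ℝ × E => k (circleMap c R p.1) p.2) (univ ×ˢ U) :=
      hc.comp (f := fun p : ℝ × E => (circleMap c R p.1, p.2)) (by fun_prop)
        fun p hp => ⟨circleMap_mem_sphere c hR p.1, hp.2⟩
    have h2 : Continuous fun p : ℝ × E => deriv (circleMap c R) p.1 := by
      simp only [deriv_circleMap]; fun_prop
    exact h2.continuousOn.smul h1
  · exact (hd _ (circleMap_mem_sphere c hR θ)).const_smul (deriv (circleMap c R) θ)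

end ParametricIntegral

/-! ### The hyperbola: ideal, multiplicity and Riemann extension -/

section Hyperbola

/-- The point of `ℂ²` with the first coordinate of `z` and second coordinate `ζ`. -/
def replaceSnd (z : EuclideanSpace ℂ (Fin 2)) (ζ : ℂ) : EuclideanSpace ℂ (Fin 2) :=
  z + (ζ - z 1) • EuclideanSpace.single 1 1

lemma replaceSnd_zero (z : EuclideanSpace ℂ (Fin 2)) (ζ : ℂ) : replaceSnd z ζ 0 = z 0 := by
  simp [replaceSnd]

lemma replaceSnd_one (z : EuclideanSpace ℂ (Fin 2)) (ζ : ℂ) : replaceSnd z ζ 1 = ζ := by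
  simp [replaceSnd]

lemma replaceSnd_self (z : EuclideanSpace ℂ (Fin 2)) : replaceSnd z (z 1) = z := by
  simp [replaceSnd]

lemma continuous_replaceSnd :
    Continuous fun p : EuclideanSpace ℂ (Fin 2) × ℂ => replaceSnd p.1 p.2 := by
  unfold replaceSnd; fun_prop

lemma differentiable_replaceSnd_left (ζ : ℂ) : Differentiable ℂ fun z => replaceSnd z ζ := by
  unfold replaceSnd; fun_prop

lemma differentiable_replaceSnd_right (z : EuclideanSpace ℂ (Fin 2)) :
    Differentiable ℂ (replaceSnd z) := by
  unfold replaceSnd; fun_prop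

/-- The smooth curve `z₀ z₁ = 1 / 4`. -/
def hyperbola : Set (EuclideanSpace ℂ (Fin 2)) := {z | z 0 * z 1 = 1 / 4}

lemma mem_hyperbola_iff {z : EuclideanSpace ℂ (Fin 2)} (h : z 0 ≠ 0) :
    z ∈ hyperbola ↔ z 1 = (4 * z 0)⁻¹ := by
  change z 0 * z 1 = 1 / 4 ↔ _
  rw [← mul_eq_one_iff_eq_inv₀ (by simpa using h)]
  constructor <;> intro h'
  · linear_combination 4 * h'
  · linear_combination h' / 4

lemma ne_zero_of_mem_hyperbola {z : EuclideanSpace ℂ (Fin 2)} (h : z ∈ hyperbola) :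
    z 0 ≠ 0 ∧ z 1 ≠ 0 := by
  rw [← mul_ne_zero_iff, show z 0 * z 1 = 1 / 4 from h]
  norm_num

lemma isClosed_hyperbola : IsClosed hyperbola :=
  isClosed_eq (by fun_prop) (by fun_prop)

/-- For z near a, the vertical line through z meets the hyperbola only at height (4z₀)⁻¹, inside the
circle of radius R about a₁. Cauchy integrals over this circle therefore stay off the curve, while
`P` holds on the larger disc of radius 2R. -/
lemma exists_polydisc {P : EuclideanSpace ℂ (Fin 2) → Prop} {a : EuclideanSpace ℂ (Fin 2)}
    (ha : a ∈ hyperbola) (hP : ∀ᶠ z in 𝓝 a, P z) :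
    ∃ R > 0, ∃ V, IsOpen V ∧ a ∈ V ∧ ∀ z ∈ V, z 0 ≠ 0 ∧ ‖z 1 - a 1‖ < R ∧
      ‖(4 * z 0)⁻¹ - a 1‖ < R ∧ ∀ ζ ∈ Metric.ball (a 1) (2 * R), P (replaceSnd z ζ) := by
  have ha0 := (ne_zero_of_mem_hyperbola ha).1
  have h1 : Tendsto (fun p : EuclideanSpace ℂ (Fin 2) × ℂ => replaceSnd p.1 p.2)
      (𝓝 a ×ˢ 𝓝 (a 1)) (𝓝 a) := by
    have := continuous_replaceSnd.tendsto (a, a 1)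
    rwa [replaceSnd_self, nhds_prod_eq] at this
  obtain ⟨pa, hpa, pb, hpb, hab⟩ := Filter.eventually_prod_iff.1 (h1.eventually hP)
  obtain ⟨ρ, hρ, hball⟩ := Metric.eventually_nhds_iff_ball.1 hpb
  have hc0 : Continuous fun z : EuclideanSpace ℂ (Fin 2) => z 0 := by fun_prop
  have hc1 : Continuous fun z : EuclideanSpace ℂ (Fin 2) => z 1 := by fun_prop
  have e1 : ∀ᶠ z : EuclideanSpace ℂ (Fin 2) in 𝓝 a, z 0 ≠ 0 := hc0.continuousAt.eventually_ne ha0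
  have e2 : ∀ᶠ z : EuclideanSpace ℂ (Fin 2) in 𝓝 a, ‖z 1 - a 1‖ < ρ / 2 :=
    (isOpen_lt (by fun_prop) (by fun_prop)).mem_nhds (by simpa using hρ)
  have hβ : ContinuousAt (fun z : EuclideanSpace ℂ (Fin 2) => (4 * z 0)⁻¹) a :=
    (hc0.continuousAt.const_mul 4).inv₀ (by simpa using ha0)
  have e3 : ∀ᶠ z : EuclideanSpace ℂ (Fin 2) in 𝓝 a, ‖(4 * z 0)⁻¹ - a 1‖ < ρ / 2 := by
    rw [(mem_hyperbola_iff ha0).1 ha]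
    have := hβ.eventually_mem (Metric.ball_mem_nhds _ (half_pos hρ))
    simpa only [mem_ball_iff_norm] using this
  obtain ⟨V, hV, hVo, haV⟩ := _root_.eventually_nhds_iff.1 (hpa.and (e1.and (e2.and e3)))
  refine ⟨ρ / 2, by positivity, V, hVo, haV, fun z hz => ?_⟩
  obtain ⟨h1, h2, h3, h4⟩ := hV z hz
  refine ⟨h2, h3, h4, fun ζ hζ => hab h1 (hball ζ ?_)⟩
  rwa [mul_div_cancel₀ _ two_ne_zero] at hζ

/-- A holomorphic germ vanishing on the hyperbola is divisible by its equation. -/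
lemma exists_eq_mul_of_vanishing {g : EuclideanSpace ℂ (Fin 2) → ℂ}
    {a : EuclideanSpace ℂ (Fin 2)} (ha : a ∈ hyperbola) (hg : HolomorphicNear g a)
    (hg0 : ∀ᶠ z in 𝓝 a, z ∈ hyperbola → g z = 0) :
    ∃ h : EuclideanSpace ℂ (Fin 2) → ℂ, HolomorphicNear h a ∧
      ∀ᶠ z in 𝓝 a, g z = h z * (z 0 * z 1 - 1 / 4) := by
  obtain ⟨R, hR, V, hV, haV, hVP⟩ := exists_polydisc ha (hg.and hg0)
  have hsub : Metric.closedBall (a 1) R ⊆ Metric.ball (a 1) (2 * R) :=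
    Metric.closedBall_subset_ball (by linarith)
  -- With β = (4z₀)⁻¹, the integral of k is 2πi times the divided difference of g in the second
  -- variable between z₁ and β, where g vanishes. Since z₀z₁ − 1/4 = z₀(z₁ − β), the quotient sought
  -- is this divided difference over z₀.
  set k : ℂ → EuclideanSpace ℂ (Fin 2) → ℂ := fun ζ z =>
    g (replaceSnd z ζ) * ((ζ - z 1)⁻¹ * (ζ - (4 * z 0)⁻¹)⁻¹) with hk
  have hne : ∀ ζ ∈ Metric.sphere (a 1) R, ∀ y : ℂ, ‖y - a 1‖ < R → ζ - y ≠ 0 := by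
    intro ζ hζ y hy h
    rw [sub_eq_zero] at h
    rw [mem_sphere_iff_norm, h] at hζ
    exact hy.ne hζ
  have hsd : DifferentiableOn ℂ (fun z => ∮ ζ in C(a 1, R), k ζ z) V := by
    refine differentiableOn_circleIntegral hV hR.le ?_ ?_
    · rintro ⟨ζ, z⟩ ⟨hζ, hz⟩
      obtain ⟨h0, h1, h2, h3⟩ := hVP z hz
      have hgc : ContinuousAt g (replaceSnd z ζ) :=
        (h3 ζ (hsub (Metric.sphere_subset_closedBall hζ))).1.continuousAt
      have hr : ContinuousAt (fun p : ℂ × EuclideanSpace ℂ (Fin 2) => replaceSnd p.2 p.1) (ζ, z) :=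
        (continuous_replaceSnd.comp continuous_swap).continuousAt
      have e1 : ContinuousAt (fun p : ℂ × EuclideanSpace ℂ (Fin 2) => g (replaceSnd p.2 p.1)) (ζ, z) :=
        ContinuousAt.comp (g := g) (f := fun p : ℂ × EuclideanSpace ℂ (Fin 2) =>
          replaceSnd p.2 p.1) hgc hr
      have e2 : ContinuousAt (fun p : ℂ × EuclideanSpace ℂ (Fin 2) => (p.1 - p.2 1)⁻¹) (ζ, z) :=
        ContinuousAt.inv₀ (by fun_prop) (hne ζ hζ _ h1)
      have e3 : ContinuousAt (fun p : ℂ × EuclideanSpace ℂ (Fin 2) => (4 * p.2 0)⁻¹) (ζ, z) :=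
        ContinuousAt.inv₀ (by fun_prop) (by simpa using h0)
      have e4 : ContinuousAt (fun p : ℂ × EuclideanSpace ℂ (Fin 2) =>
          (p.1 - (4 * p.2 0)⁻¹)⁻¹) (ζ, z) :=
        ContinuousAt.inv₀ (continuousAt_fst.sub e3) (hne ζ hζ _ h2)
      exact (e1.mul (e2.mul e4)).continuousWithinAt
    · intro ζ hζ z hz
      obtain ⟨h0, h1, h2, h3⟩ := hVP z hz
      have hgd := (h3 ζ (hsub (Metric.sphere_subset_closedBall hζ))).1
      have e1 : DifferentiableAt ℂ (fun z => g (replaceSnd z ζ)) z :=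
        DifferentiableAt.comp z hgd (differentiable_replaceSnd_left ζ z)
      have e2 : DifferentiableAt ℂ (fun z : EuclideanSpace ℂ (Fin 2) => (ζ - z 1)⁻¹) z :=
        DifferentiableAt.inv (by fun_prop) (hne ζ hζ _ h1)
      have e3 : DifferentiableAt ℂ (fun z : EuclideanSpace ℂ (Fin 2) => (4 * z 0)⁻¹) z :=
        DifferentiableAt.inv (by fun_prop) (by simpa using h0)
      have e4 : DifferentiableAt ℂ (fun z : EuclideanSpace ℂ (Fin 2) => (ζ - (4 * z 0)⁻¹)⁻¹) z :=
        DifferentiableAt.inv (e3.const_sub ζ) (hne ζ hζ _ h2)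
      exact (e1.mul (e2.mul e4)).differentiableWithinAt
  refine ⟨fun z => (2 * Real.pi * Complex.I : ℂ)⁻¹ * (∮ ζ in C(a 1, R), k ζ z) * (z 0)⁻¹, ?_, ?_⟩
  · filter_upwards [hV.mem_nhds haV] with z hz
    have e1 : DifferentiableAt ℂ (fun z : EuclideanSpace ℂ (Fin 2) => (z 0)⁻¹) z :=
      DifferentiableAt.inv (by fun_prop) (hVP z hz).1
    exact ((hsd.differentiableAt (hV.mem_nhds hz)).const_mul _).mul e1
  · filter_upwards [hV.mem_nhds haV] with z hz
    obtain ⟨h0, h1, h2, h3⟩ := hVP z hz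
    have hG : DifferentiableOn ℂ (fun ζ => g (replaceSnd z ζ)) (Metric.ball (a 1) (2 * R)) :=
      fun ζ hζ => (DifferentiableAt.comp ζ (h3 ζ hζ).1
        (differentiable_replaceSnd_right z ζ)).differentiableWithinAt
    have hGc : DiffContOnCl ℂ (fun ζ => g (replaceSnd z ζ)) (Metric.ball (a 1) R) :=
      (hG.mono hsub).diffContOnCl_ball le_rfl
    have c1 := hGc.circleIntegral_sub_inv_smul (w := z 1) (mem_ball_iff_norm.2 h1)
    have c2 := hGc.circleIntegral_sub_inv_smul (w := (4 * z 0)⁻¹) (mem_ball_iff_norm.2 h2)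
    have hβ : g (replaceSnd z (4 * z 0)⁻¹) = 0 := by
      refine (h3 _ (hsub (mem_closedBall_iff_norm.2 h2.le))).2 ?_
      rw [mem_hyperbola_iff (by rwa [replaceSnd_zero]), replaceSnd_zero, replaceSnd_one]
    have hcont : ContinuousOn (fun ζ => g (replaceSnd z ζ)) (Metric.sphere (a 1) R) :=
      hG.continuousOn.mono (Metric.sphere_subset_closedBall.trans hsub)
    have h_int : ∀ y : ℂ, ‖y - a 1‖ < R →
        CircleIntegrable (fun ζ => (ζ - y)⁻¹ • g (replaceSnd z ζ)) (a 1) R := fun y hy =>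
      ContinuousOn.circleIntegrable hR.le ((ContinuousOn.inv₀ (by fun_prop)
        fun ζ hζ => hne ζ hζ y hy).smul hcont)
    -- Partial fractions, multiplied by z₁ − β so that z₁ = β needs no separate treatment.
    have c3 : (∮ ζ in C(a 1, R), k ζ z) * (z 1 - (4 * z 0)⁻¹) =
        (∮ ζ in C(a 1, R), (ζ - z 1)⁻¹ • g (replaceSnd z ζ)) -
        ∮ ζ in C(a 1, R), (ζ - (4 * z 0)⁻¹)⁻¹ • g (replaceSnd z ζ) := by
      rw [← circleIntegral.integral_sub (h_int _ h1) (h_int _ h2), mul_comm, ← smul_eq_mul,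
        ← circleIntegral.integral_smul]
      refine circleIntegral.integral_congr hR.le fun ζ hζ => ?_
      have n1 := hne ζ hζ _ h1
      have n2 := hne ζ hζ _ h2
      simp only [hk, smul_eq_mul]
      generalize (4 * z 0)⁻¹ = β at n2
      field_simp
      ring
    rw [c1, c2, replaceSnd_self, hβ, smul_zero, sub_zero, smul_eq_mul] at c3
    have hz4 : z 0 * z 1 - 1 / 4 = z 0 * (z 1 - (4 * z 0)⁻¹) := by
      field_simp
    have hpi : (2 * Real.pi * Complex.I : ℂ) ≠ 0 := Complex.two_pi_I_ne_zero
    rw [hz4]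
    calc g z = (2 * Real.pi * Complex.I : ℂ)⁻¹ * ((2 * Real.pi * Complex.I : ℂ) * g z) := by
          rw [inv_mul_cancel_left₀ hpi]
      _ = _ := by
          rw [← c3]
          have : (z 0)⁻¹ * z 0 = 1 := inv_mul_cancel₀ h0
          linear_combination (-(2 * Real.pi * Complex.I : ℂ)⁻¹ * (∮ ζ in C(a 1, R), k ζ z) *
            (z 1 - (4 * z 0)⁻¹)) * this

/-- A bounded holomorphic function on the complement of the hyperbola extends locally across it. -/
lemma exists_local_extension {f : EuclideanSpace ℂ (Fin 2) → ℂ} {X : Set (EuclideanSpace ℂ (Fin 2))}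
    (hX : IsOpen X) (hf : DifferentiableOn ℂ f (X \ hyperbola)) (hb : ∀ z ∈ X \ hyperbola, ‖f z‖ ≤ 1)
    {a : EuclideanSpace ℂ (Fin 2)} (haX : a ∈ X) (ha : a ∈ hyperbola) :
    ∃ V, IsOpen V ∧ a ∈ V ∧ V ⊆ X ∧ ∃ F : EuclideanSpace ℂ (Fin 2) → ℂ, DifferentiableOn ℂ F V ∧
      ∀ z ∈ V \ hyperbola, F z = f z := by
  obtain ⟨R, hR, V, hV, haV, hVP⟩ := exists_polydisc (P := fun z => z ∈ X) ha (hX.mem_nhds haX)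
  have hYo : IsOpen (X \ hyperbola) := hX.sdiff isClosed_hyperbola
  have hsub : Metric.closedBall (a 1) R ⊆ Metric.ball (a 1) (2 * R) :=
    Metric.closedBall_subset_ball (by linarith)
  have hne : ∀ ζ ∈ Metric.sphere (a 1) R, ∀ y : ℂ, ‖y - a 1‖ < R → ζ ≠ y := by
    intro ζ hζ y hy h
    rw [mem_sphere_iff_norm, h] at hζ
    exact hy.ne hζ
  have hmem : ∀ z ∈ V, ∀ ζ ∈ Metric.ball (a 1) (2 * R), ζ ≠ (4 * z 0)⁻¹ →
      replaceSnd z ζ ∈ X \ hyperbola := by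
    intro z hz ζ hζ hζ'
    obtain ⟨h0, h1, h2, h3⟩ := hVP z hz
    refine ⟨h3 ζ hζ, ?_⟩
    rwa [mem_hyperbola_iff (by rwa [replaceSnd_zero]), replaceSnd_zero, replaceSnd_one]
  have hmemS : ∀ z ∈ V, ∀ ζ ∈ Metric.sphere (a 1) R, replaceSnd z ζ ∈ X \ hyperbola :=
    fun z hz ζ hζ => hmem z hz ζ (hsub (Metric.sphere_subset_closedBall hζ))
      (hne ζ hζ _ (hVP z hz).2.2.1)
  -- The extension is the Cauchy integral of f in the second variable; its contour avoids the
  -- hyperbola.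
  refine ⟨V, hV, haV, fun z hz => ?_, fun z => (2 * Real.pi * Complex.I : ℂ)⁻¹ *
    ∮ ζ in C(a 1, R), (ζ - z 1)⁻¹ * f (replaceSnd z ζ), ?_, ?_⟩
  · have := (hVP z hz).2.2.2 (z 1) (hsub (mem_closedBall_iff_norm.2 (hVP z hz).2.1.le))
    rwa [replaceSnd_self] at this
  · refine (differentiableOn_circleIntegral hV hR.le
      (k := fun ζ z => (ζ - z 1)⁻¹ * f (replaceSnd z ζ)) ?_ ?_).const_mul _
    · rintro ⟨ζ, z⟩ ⟨hζ, hz⟩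
      have hgc : ContinuousAt f (replaceSnd z ζ) :=
        (hf.differentiableAt (hYo.mem_nhds (hmemS z hz ζ hζ))).continuousAt
      have hr : ContinuousAt (fun p : ℂ × EuclideanSpace ℂ (Fin 2) => replaceSnd p.2 p.1) (ζ, z) :=
        (continuous_replaceSnd.comp continuous_swap).continuousAt
      have e1 : ContinuousAt (fun p : ℂ × EuclideanSpace ℂ (Fin 2) => f (replaceSnd p.2 p.1)) (ζ, z) :=
        ContinuousAt.comp (g := f) (f := fun p : ℂ × EuclideanSpace ℂ (Fin 2) =>
          replaceSnd p.2 p.1) hgc hr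
      have e2 : ContinuousAt (fun p : ℂ × EuclideanSpace ℂ (Fin 2) => (p.1 - p.2 1)⁻¹) (ζ, z) :=
        ContinuousAt.inv₀ (by fun_prop) (sub_ne_zero.2 (hne ζ hζ _ (hVP z hz).2.1))
      exact (e2.mul e1).continuousWithinAt
    · intro ζ hζ z hz
      have hgd := hf.differentiableAt (hYo.mem_nhds (hmemS z hz ζ hζ))
      have e1 : DifferentiableAt ℂ (fun z => f (replaceSnd z ζ)) z :=
        DifferentiableAt.comp z hgd (differentiable_replaceSnd_left ζ z)
      have e2 : DifferentiableAt ℂ (fun z : EuclideanSpace ℂ (Fin 2) => (ζ - z 1)⁻¹) z :=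
        DifferentiableAt.inv (by fun_prop) (sub_ne_zero.2 (hne ζ hζ _ (hVP z hz).2.1))
      exact (e2.mul e1).differentiableWithinAt
  · rintro z ⟨hz, hzC⟩
    obtain ⟨h0, h1, h2, h3⟩ := hVP z hz
    set β := (4 * z 0)⁻¹ with hβ
    set G : ℂ → ℂ := fun ζ => f (replaceSnd z ζ) with hG
    have hGd : DifferentiableOn ℂ G (Metric.ball (a 1) (2 * R) \ {β}) := fun ζ hζ =>
      (DifferentiableAt.comp ζ (hf.differentiableAt (hYo.mem_nhds (hmem z hz ζ hζ.1 hζ.2)))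
        (differentiable_replaceSnd_right z ζ)).differentiableWithinAt
    have hβmem : Metric.ball (a 1) (2 * R) ∈ 𝓝 β :=
      Metric.isOpen_ball.mem_nhds (hsub (mem_closedBall_iff_norm.2 h2.le))
    -- On a single vertical line the singularity at β is removable, so the Cauchy integral
    -- reproduces f at z₁ ≠ β.
    have hup := Complex.differentiableOn_update_limUnder_of_bddAbove hβmem hGd
      ⟨1, by rintro _ ⟨ζ, hζ, rfl⟩; exact hb _ (hmem z hz ζ hζ.1 hζ.2)⟩
    have hGc := (hup.mono hsub).diffContOnCl_ball (c := a 1) (R := R) le_rfl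
    have c1 := hGc.circleIntegral_sub_inv_smul (w := z 1) (mem_ball_iff_norm.2 h1)
    have hz1 : z 1 ≠ β := fun h => hzC ((mem_hyperbola_iff h0).2 h)
    rw [Function.update_of_ne hz1] at c1
    have c2 : (∮ ζ in C(a 1, R), (ζ - z 1)⁻¹ * f (replaceSnd z ζ)) =
        ∮ ζ in C(a 1, R), (ζ - z 1)⁻¹ • Function.update G β (limUnder (𝓝[≠] β) G) ζ := by
      refine circleIntegral.integral_congr hR.le fun ζ hζ => ?_
      simp only
      rw [Function.update_of_ne (hne ζ hζ _ h2), smul_eq_mul]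
    simp only
    rw [c2, c1, smul_eq_mul, inv_mul_cancel_left₀ Complex.two_pi_I_ne_zero]
    simp only [hG, replaceSnd_self]

/-- Moving the first coordinate leaves the curve at once, because the second is nonzero there. -/
lemma neBot_nhdsWithin_compl_hyperbola (a : EuclideanSpace ℂ (Fin 2)) : (𝓝[hyperbolaᶜ] a).NeBot := by
  rw [← mem_closure_iff_nhdsWithin_neBot]
  by_cases ha : a ∈ hyperbola
  · have h1 : Tendsto (fun t : ℂ => a + t • EuclideanSpace.single (0 : Fin 2) (1 : ℂ)) (𝓝[≠] 0) (𝓝 a) := by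
      have : Tendsto (fun t : ℂ => a + t • EuclideanSpace.single (0 : Fin 2) (1 : ℂ)) (𝓝 0)
          (𝓝 (a + (0 : ℂ) • EuclideanSpace.single (0 : Fin 2) (1 : ℂ))) :=
        Continuous.tendsto (by fun_prop) 0
      rw [zero_smul, add_zero] at this
      exact this.mono_left nhdsWithin_le_nhds
    refine mem_closure_of_tendsto h1 ?_
    filter_upwards [self_mem_nhdsWithin] with t ht h
    have h2 : (a 0 + t) * a 1 = 1 / 4 := by
      have h3 : (a + t • EuclideanSpace.single (0 : Fin 2) (1 : ℂ)) 0 *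
        (a + t • EuclideanSpace.single (0 : Fin 2) (1 : ℂ)) 1 = 1 / 4 := h
      simpa using h3
    have h3 : a 0 * a 1 = 1 / 4 := ha
    have h4 : t * a 1 = 0 := by linear_combination h2 - h3
    rcases mul_eq_zero.1 h4 with h5 | h5
    · exact ht h5
    · exact (ne_zero_of_mem_hyperbola ha).2 h5
  · exact subset_closure ha

/-- Riemann extension across the hyperbola for maps into the unit disc. -/
lemma exists_extension {X : Set (EuclideanSpace ℂ (Fin 2))} (hX : IsOpen X) (hXc : IsPreconnected X)
    {f : EuclideanSpace ℂ (Fin 2) → ℂ} (hf : DifferentiableOn ℂ f (X \ hyperbola))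
    (hm : MapsTo f (X \ hyperbola) (Metric.ball 0 1)) (hne : (X \ hyperbola).Nonempty) :
    ∃ F : EuclideanSpace ℂ (Fin 2) → ℂ, DifferentiableOn ℂ F X ∧ MapsTo F X (Metric.ball 0 1) ∧
      ∀ z ∈ X \ hyperbola, F z = f z := by
  classical
  have hb : ∀ z ∈ X \ hyperbola, ‖f z‖ < 1 := fun z hz => by simpa using hm hz
  -- Defining the values on the curve as limits makes F agree with every local extension, so no
  -- gluing is needed.
  set F : EuclideanSpace ℂ (Fin 2) → ℂ := fun z =>
    if z ∈ hyperbola then limUnder (𝓝[hyperbolaᶜ] z) f else f z with hF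
  have hFf : ∀ z, z ∉ hyperbola → F z = f z := fun z hz => by simp only [hF, if_neg hz]
  have hFd : DifferentiableOn ℂ F X := by
    intro a haX
    refine DifferentiableAt.differentiableWithinAt ?_
    by_cases ha : a ∈ hyperbola
    · obtain ⟨V, hV, haV, hVX, Φ, hΦ, hΦf⟩ :=
        exists_local_extension hX hf (fun z hz => (hb z hz).le) haX ha
      have heq : ∀ z ∈ V, F z = Φ z := by
        intro z hz
        by_cases hzC : z ∈ hyperbola
        · simp only [hF, if_pos hzC]
          have := neBot_nhdsWithin_compl_hyperbola z
          refine Tendsto.limUnder_eq ?_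
          have h1 : Tendsto Φ (𝓝[hyperbolaᶜ] z) (𝓝 (Φ z)) :=
            (hΦ.continuousOn.continuousAt (hV.mem_nhds hz)).tendsto.mono_left nhdsWithin_le_nhds
          refine h1.congr' ?_
          filter_upwards [self_mem_nhdsWithin, mem_nhdsWithin_of_mem_nhds (hV.mem_nhds hz)]
            with y hy hyV
          exact hΦf y ⟨hyV, hy⟩
        · rw [hFf z hzC, hΦf z ⟨hz, hzC⟩]
      exact (hΦ.differentiableAt (hV.mem_nhds haV)).congr_of_eventuallyEq
        (mem_of_superset (hV.mem_nhds haV) heq)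
    · have hY : X \ hyperbola ∈ 𝓝 a := (hX.sdiff isClosed_hyperbola).mem_nhds ⟨haX, ha⟩
      exact (hf.differentiableAt hY).congr_of_eventuallyEq
        (mem_of_superset hY fun z hz => hFf z hz.2)
  have hle : ∀ z ∈ X, ‖F z‖ ≤ 1 := by
    intro z hz
    have := neBot_nhdsWithin_compl_hyperbola z
    have h1 : Tendsto (fun y => ‖F y‖) (𝓝[hyperbolaᶜ] z) (𝓝 ‖F z‖) :=
      (hFd.continuousOn.continuousAt (hX.mem_nhds hz)).norm.tendsto.mono_left nhdsWithin_le_nhds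
    refine le_of_tendsto h1 ?_
    filter_upwards [self_mem_nhdsWithin, mem_nhdsWithin_of_mem_nhds (hX.mem_nhds hz)] with y hy hyX
    rw [hFf y hy]
    exact (hb y ⟨hyX, hy⟩).le
  refine ⟨F, hFd, fun z hz => ?_, fun z hz => hFf z hz.2⟩
  rw [mem_ball_zero_iff]
  -- If |F| reached 1, the maximum modulus principle would give |F| = 1 throughout X, contrary to
  -- |f| < 1 off the curve.
  refine lt_of_le_of_ne (hle z hz) fun h1 => ?_
  obtain ⟨p, hp⟩ := hne
  have h2 := Complex.norm_eqOn_of_isPreconnected_of_isMaxOn hXc hX hFd hz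
    (fun y hy => by simpa [h1] using hle y hy) hp.1
  have h3 := hb p hp
  rw [← hFf p hp.2] at h3
  simp only [Function.comp_apply, Function.const_apply, h1] at h2
  linarith

lemma caratheodoryDist_diff_hyperbola {X : Set (EuclideanSpace ℂ (Fin 2))} (hX : IsOpen X)
    (hXc : IsPreconnected X) {x y : EuclideanSpace ℂ (Fin 2)} (hx : x ∈ X \ hyperbola)
    (hy : y ∈ X \ hyperbola) :
    caratheodoryDist (X \ hyperbola) x y = caratheodoryDist X x y := by
  refine le_antisymm ?_ ?_
  · refine iSup_le fun f => iSup₂_le fun hf hm => ?_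
    obtain ⟨F, hF, hFm, hFf⟩ := exists_extension hX hXc hf hm ⟨x, hx⟩
    refine le_iSup_of_le F (le_iSup₂_of_le hF hFm ?_)
    rw [hFf x hx, hFf y hy]
  · refine iSup_le fun f => iSup₂_le fun hf hm => ?_
    exact le_iSup_of_le f (le_iSup₂_of_le (hf.mono sdiff_subset) (hm.mono_left sdiff_subset) le_rfl)

lemma isSmoothCurve_hyperbola : IsSmoothCurve hyperbola := by
  refine ⟨⟨!₂[1 / 2, 1 / 2], ?_⟩, isClosed_hyperbola, fun p hp => ?_⟩
  · change (!₂[1 / 2, 1 / 2] : EuclideanSpace ℂ (Fin 2)) 0 *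
      (!₂[1 / 2, 1 / 2] : EuclideanSpace ℂ (Fin 2)) 1 = 1 / 4
    simp; norm_num
  · refine ⟨univ, fun z => z 0 * z 1 - 1 / 4, isOpen_univ, mem_univ p, ?_, ?_, ?_⟩
    · exact Differentiable.differentiableOn (by fun_prop)
    · intro h
      have hd : DifferentiableAt ℂ (fun z : EuclideanSpace ℂ (Fin 2) => z 0 * z 1 - 1 / 4) p := by
        fun_prop
      have h1 : HasDerivAt (fun t : ℂ => p + t • EuclideanSpace.single (0 : Fin 2) (1 : ℂ))
          (EuclideanSpace.single (0 : Fin 2) (1 : ℂ)) 0 := by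
        simpa using ((hasDerivAt_id (0 : ℂ)).smul_const
          (EuclideanSpace.single (0 : Fin 2) (1 : ℂ))).const_add p
      have h2 : HasFDerivAt (fun z : EuclideanSpace ℂ (Fin 2) => z 0 * z 1 - 1 / 4)
          (0 : EuclideanSpace ℂ (Fin 2) →L[ℂ] ℂ)
          (p + (0 : ℂ) • EuclideanSpace.single (0 : Fin 2) (1 : ℂ)) := by
        rw [zero_smul, add_zero, ← h]; exact hd.hasFDerivAt
      have h3 := h2.comp_hasDerivAt (0 : ℂ) h1
      have h4 : HasDerivAt (fun t : ℂ => (p 0 + t) * p 1 - 1 / 4) (p 1) 0 := by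
        simpa using (((hasDerivAt_id (0 : ℂ)).const_add (p 0)).mul_const (p 1)).sub_const (1 / 4)
      have h5 : (fun t : ℂ => (p 0 + t) * p 1 - 1 / 4) =
          (fun z : EuclideanSpace ℂ (Fin 2) => z 0 * z 1 - 1 / 4) ∘
            fun t : ℂ => p + t • EuclideanSpace.single (0 : Fin 2) (1 : ℂ) := by
        funext t; simp
      rw [h5] at h4
      have h6 := h4.unique h3
      exact (ne_zero_of_mem_hyperbola hp).2 (by simpa using h6)
    · ext z
      simp [hyperbola, sub_eq_zero]

variable {X : Set (EuclideanSpace ℂ (Fin 2))}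

/-- Every germ in the ideal vanishes at a, hence is O(‖z − a‖). -/
lemma one_le_multiplicityAlong {E : Type*} [NormedAddCommGroup E] [NormedSpace ℂ E] {A : Set E}
    {a : E} (ha : a ∈ A) : 1 ≤ multiplicityAlong A a := by
  refine le_iInf fun m => le_iInf fun f => le_iInf fun hf => ?_
  have h1 : ∀ i, ∃ C : ℝ, 0 < C ∧
      ∀ᶠ z in 𝓝 a, ENNReal.log ‖f i z‖ₑ ≤ ENNReal.log (ENNReal.ofReal (C * ‖z - a‖)) := fun i =>
    eventually_log_norm_le_of_eq_zero (hf.1 i).1.self_of_nhds ((hf.1 i).2.self_of_nhds ha)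
  choose C hC h using h1
  -- The added 1 keeps the common constant positive even for an empty family of generators.
  have hS : ∀ i, C i ≤ 1 + ∑ i, C i := fun i => by
    have := Finset.single_le_sum (f := C) (fun i _ => (hC i).le) (Finset.mem_univ i)
    linarith
  have hS0 : 0 < 1 + ∑ i, C i := by
    have := Finset.sum_nonneg (f := C) (s := Finset.univ) fun i _ => (hC i).le
    linarith
  refine one_le_lelongNumber hS0 ?_
  filter_upwards [eventually_all.2 h] with z hz
  refine iSup_le fun i => (hz i).trans ?_
  rw [ENNReal.log_le_log_iff]
  refine ENNReal.ofReal_le_ofReal ?_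
  gcongr
  exact hS i

/-- By divisibility, z₀z₁ − 1/4 generates the stalk. Along the first axis its increment at a is
exactly r a₁ with a₁ ≠ 0, so its order there is one. -/
lemma multiplicityAlong_hyperbola (hX : IsOpen X) {a : EuclideanSpace ℂ (Fin 2)}
    (ha : a ∈ hyperbola ∩ X) : multiplicityAlong (hyperbola ∩ X) a = 1 := by
  refine le_antisymm ?_ (one_le_multiplicityAlong ha)
  have hgen : GeneratesIdealStalk (hyperbola ∩ X) a
      (fun (_ : Fin 1) (z : EuclideanSpace ℂ (Fin 2)) => z 0 * z 1 - 1 / 4) := by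
    refine ⟨fun _ => ⟨Eventually.of_forall fun z => by fun_prop, Eventually.of_forall fun z hz => ?_⟩,
      fun g hg => ?_⟩
    · exact sub_eq_zero.2 hz.1
    · obtain ⟨h, hh, hgh⟩ := exists_eq_mul_of_vanishing ha.1 hg.1 (by
        filter_upwards [hg.2, hX.mem_nhds ha.2] with z hz hzX hzC
        exact hz ⟨hzC, hzX⟩)
      refine ⟨fun _ => h, fun _ => hh, ?_⟩
      simpa using hgh
  refine iInf_le_of_le 1 (iInf_le_of_le _ (iInf_le_of_le hgen ?_))
  refine lelongNumber_le_one (norm_pos_iff.2 (ne_zero_of_mem_hyperbola ha.1).2) ?_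
  filter_upwards [self_mem_nhdsWithin] with r hr
  rw [mem_Ioi] at hr
  refine ⟨a + (r : ℂ) • EuclideanSpace.single (0 : Fin 2) (1 : ℂ), ?_, ?_⟩
  · simp [norm_smul, abs_of_pos hr]
  · refine le_iSup_of_le 0 ?_
    rw [ENNReal.log_le_log_iff, ← ofReal_norm]
    have h1 : a 0 * a 1 = 1 / 4 := ha.1
    have h2 : (a + (r : ℂ) • EuclideanSpace.single (0 : Fin 2) (1 : ℂ)) 0 *
        (a + (r : ℂ) • EuclideanSpace.single (0 : Fin 2) (1 : ℂ)) 1 - 1 / 4 = r * a 1 := by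
      simp
      linear_combination h1
    rw [h2, norm_mul, Complex.norm_real, Real.norm_of_nonneg hr.le, mul_comm]

/-- Away from A, the constant 1 generates the stalk. -/
lemma multiplicityAlong_nonpos {E : Type*} [NormedAddCommGroup E] [NormedSpace ℂ E] [Nontrivial E]
    {A : Set E} {a : E} (ha : ∀ᶠ z in 𝓝 a, z ∉ A) : multiplicityAlong A a ≤ 0 := by
  have hgen : GeneratesIdealStalk A a (fun (_ : Fin 1) (_ : E) => (1 : ℂ)) := by
    refine ⟨fun _ => ⟨Eventually.of_forall fun z => by fun_prop, ha.mono fun z hz hzA => absurd hzA hz⟩,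
      fun g hg => ⟨fun _ => g, fun _ => hg.1, Eventually.of_forall fun z => by simp⟩⟩
  refine iInf_le_of_le 1 (iInf_le_of_le _ (iInf_le_of_le hgen ?_))
  simpa using lelongNumber_zero_le a

end Hyperbola

/-! ### Connectedness of A and Y -/

section Topology

lemma norm_sq_eq_add (z : EuclideanSpace ℂ (Fin 2)) : ‖z‖ ^ 2 = ‖z 0‖ ^ 2 + ‖z 1‖ ^ 2 := by
  rw [EuclideanSpace.norm_sq_eq, Fin.sum_univ_two]

/-- The map w ↦ ½(e^w, e^{−w}) has squared norm cosh(2 Re w)/2, so A is the image of a set of w that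
is star-shaped about 0. -/
lemma isConnected_hyperbola_inter_ball :
    IsConnected (hyperbola ∩ Metric.ball (0 : EuclideanSpace ℂ (Fin 2)) 1) := by
  set S : Set ℂ := {w | Real.cosh (2 * w.re) < 2} with hS
  set φ : ℂ → EuclideanSpace ℂ (Fin 2) := fun w => !₂[Complex.exp w / 2, Complex.exp (-w) / 2] with hφ
  have hstar : StarConvex ℝ 0 S := by
    rw [starConvex_zero_iff]
    intro w hw t ht0 ht1
    have hw' : Real.cosh (2 * w.re) < 2 := hw
    change Real.cosh (2 * (t • w).re) < 2
    refine lt_of_le_of_lt ?_ hw'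
    rw [Real.cosh_le_cosh, Complex.real_smul, Complex.re_ofReal_mul]
    rw [show 2 * (t * w.re) = t * (2 * w.re) by ring, abs_mul, abs_of_nonneg ht0]
    exact mul_le_of_le_one_left (abs_nonneg _) ht1
  have hSc : IsConnected S := by
    have h0 : (0 : ℂ) ∈ S := by change Real.cosh (2 * (0 : ℂ).re) < 2; simp
    exact (hstar.isPathConnected h0).isConnected
  have hφc : Continuous φ := by
    rw [hφ]; fun_prop
  have hnorm : ∀ w, ‖φ w‖ ^ 2 = Real.cosh (2 * w.re) / 2 := by
    intro w
    rw [norm_sq_eq_add]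
    simp only [hφ]
    simp [Complex.norm_exp]
    rw [Real.cosh_eq, div_pow, div_pow, ← Real.exp_nat_mul, ← Real.exp_nat_mul]
    push_cast
    ring_nf
  have himg : hyperbola ∩ Metric.ball (0 : EuclideanSpace ℂ (Fin 2)) 1 = φ '' S := by
    ext z
    constructor
    · rintro ⟨hz, hzb⟩
      have h0 := (ne_zero_of_mem_hyperbola hz).1
      have h2z : 2 * z 0 ≠ 0 := mul_ne_zero two_ne_zero h0
      have hφz : φ (Complex.log (2 * z 0)) = z := by
        ext i
        fin_cases i
        · simp [hφ, Complex.exp_log h2z]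
        · simp only [hφ]
          simp only [Fin.mk_one, Fin.isValue, Matrix.cons_val_one,
            Matrix.cons_val_fin_one]
          rw [Complex.exp_neg, Complex.exp_log h2z, (mem_hyperbola_iff h0).1 hz]
          field_simp
          norm_num
      refine ⟨Complex.log (2 * z 0), ?_, hφz⟩
      have h1 := hnorm (Complex.log (2 * z 0))
      rw [hφz] at h1
      have h2 : ‖z‖ < 1 := by simpa using hzb
      change Real.cosh (2 * (Complex.log (2 * z 0)).re) < 2
      nlinarith [norm_nonneg z]
    · rintro ⟨w, hw, rfl⟩
      have hw' : Real.cosh (2 * w.re) < 2 := hw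
      refine ⟨?_, ?_⟩
      · change φ w 0 * φ w 1 = 1 / 4
        simp only [hφ]
        simp only [Fin.isValue, Matrix.cons_val_one,
            Matrix.cons_val_fin_one, Matrix.cons_val_zero]
        rw [Complex.exp_neg]
        have := Complex.exp_ne_zero w
        field_simp
        norm_num
      · rw [mem_ball_zero_iff]
        have h1 := hnorm w
        nlinarith [norm_nonneg (φ w)]
  rw [himg]
  exact hSc.image φ hφc.continuousOn

/-- The segment from 0 to z hits the curve only if z₀z₁ is real and positive. In that case z is
first rotated in its first coordinate until the product is no longer real. -/
lemma isConnected_ball_diff_hyperbola :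
    IsConnected (Metric.ball (0 : EuclideanSpace ℂ (Fin 2)) 1 \ hyperbola) := by
  set Y := Metric.ball (0 : EuclideanSpace ℂ (Fin 2)) 1 \ hyperbola with hY
  have h0 : (0 : EuclideanSpace ℂ (Fin 2)) ∈ Y := by
    refine ⟨by simp, fun h => ?_⟩
    exact (ne_zero_of_mem_hyperbola h).1 rfl
  have hseg : ∀ z : EuclideanSpace ℂ (Fin 2), ‖z‖ < 1 →
      (∀ s : ℝ, s ∈ Icc (0 : ℝ) 1 → (s : ℂ) ^ 2 * (z 0 * z 1) ≠ 1 / 4) →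
      ∃ t ⊆ Y, (0 : EuclideanSpace ℂ (Fin 2)) ∈ t ∧ z ∈ t ∧ IsPreconnected t := by
    intro z hz hs
    refine ⟨(fun s : ℝ => (s : ℂ) • z) '' Icc 0 1, ?_, ⟨0, by simp, by simp⟩, ⟨1, by simp, by simp⟩,
      isPreconnected_Icc.image _ (Continuous.continuousOn (by fun_prop))⟩
    rintro _ ⟨s, hs1, rfl⟩
    refine ⟨?_, fun h => hs s hs1 ?_⟩
    · rw [mem_ball_zero_iff, norm_smul, Complex.norm_real, Real.norm_of_nonneg hs1.1]
      exact (mul_le_of_le_one_left (norm_nonneg z) hs1.2).trans_lt hz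
    · have h1 : ((s : ℂ) • z) 0 * ((s : ℂ) • z) 1 = 1 / 4 := h
      simp only [PiLp.smul_apply, smul_eq_mul] at h1
      rw [← h1]; ring
  refine ⟨⟨0, h0⟩, isPreconnected_of_forall 0 fun z hz => ?_⟩
  have hz1 : ‖z‖ < 1 := by simpa using hz.1
  have hzC : z 0 * z 1 ≠ 1 / 4 := hz.2
  by_cases hs : ∀ s : ℝ, s ∈ Icc (0 : ℝ) 1 → (s : ℂ) ^ 2 * (z 0 * z 1) ≠ 1 / 4
  · exact hseg z hz1 hs
  push Not at hs
  obtain ⟨s, hs1, hsz⟩ := hs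
  have hs0 : s ≠ 0 := by rintro rfl; norm_num at hsz
  have hs0' : (s : ℂ) ≠ 0 := by exact_mod_cast hs0
  have hprod : z 0 * z 1 = (((4 * s ^ 2)⁻¹ : ℝ) : ℂ) := by
    push_cast
    field_simp
    linear_combination 4 * hsz
  obtain ⟨c, hc⟩ : ∃ c : ℝ, c = (4 * s ^ 2)⁻¹ := ⟨_, rfl⟩
  rw [← hc] at hprod
  have hc0 : 0 < c := by rw [hc]; positivity
  have hc4 : c ≠ 1 / 4 := by
    rintro h
    apply hzC
    rw [hprod, h]; norm_num
  set ρ : ℝ → EuclideanSpace ℂ (Fin 2) := fun θ => !₂[Complex.exp (θ * Complex.I) * z 0, z 1] with hρ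
  have hρn : ∀ θ, ‖ρ θ‖ < 1 := fun θ => by
    have h1 := norm_sq_eq_add (ρ θ)
    have h2 := norm_sq_eq_add z
    have h3 : ‖ρ θ 0‖ = ‖z 0‖ := by
      simp [hρ, Complex.norm_exp_ofReal_mul_I]
    have h4 : ρ θ 1 = z 1 := by simp [hρ]
    rw [h3, h4, ← h2] at h1
    rwa [(sq_eq_sq₀ (norm_nonneg _) (norm_nonneg _)).1 h1]
  have hρp : ∀ θ, ρ θ 0 * ρ θ 1 = Complex.exp (θ * Complex.I) * c := fun θ => by
    simp [hρ, mul_assoc, hprod]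
  have hρY : ∀ θ, ρ θ ∈ Y := fun θ => by
    refine ⟨by simpa using hρn θ, fun h => ?_⟩
    have h1 : ρ θ 0 * ρ θ 1 = 1 / 4 := h
    rw [hρp] at h1
    have h2 := congrArg norm h1
    rw [norm_mul, Complex.norm_exp_ofReal_mul_I, Complex.norm_real, Real.norm_of_nonneg hc0.le] at h2
    apply hc4
    rw [one_mul] at h2
    rw [h2]; norm_num
  -- During the rotation |z₀z₁| = c ≠ 1/4 is constant. At angle 1 the product has imaginary part c
  -- sin 1 > 0, so the segment from 0 avoids the curve.
  obtain ⟨t, htY, ht0, ht1, htc⟩ := hseg (ρ 1) (hρn 1) fun r hr h => by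
    rw [hρp] at h
    have h1 := congrArg Complex.im h
    have hr0 : r ≠ 0 := by
      rintro rfl
      norm_num at h
    have h2 : r ^ 2 * (Real.sin 1 * c) = 0 := by
      have h3 : ((r : ℂ) ^ 2 * (Complex.exp (((1 : ℝ) : ℂ) * Complex.I) * c)).im =
          r ^ 2 * (Real.sin 1 * c) := by
        rw [← Complex.ofReal_pow, Complex.im_ofReal_mul, Complex.im_mul_ofReal, Complex.exp_ofReal_mul_I_im]
      rw [← h3, h1]; norm_num
    have hsin : 0 < Real.sin 1 := Real.sin_pos_of_pos_of_lt_pi one_pos (by linarith [Real.pi_gt_three])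
    have : 0 < r ^ 2 * (Real.sin 1 * c) := by positivity
    linarith
  refine ⟨t ∪ ρ '' Icc 0 1, union_subset htY ?_, Or.inl ht0, Or.inr ⟨0, by simp, ?_⟩, ?_⟩
  · rintro _ ⟨θ, _, rfl⟩; exact hρY θ
  · ext i
    fin_cases i <;> simp [hρ]
  · refine IsPreconnected.union (ρ 1) ht1 ⟨1, by simp, rfl⟩ htc
      (isPreconnected_Icc.image _ (Continuous.continuousOn ?_))
    rw [hρ]; fun_prop

end Topology

/-! ### Pseudoconvexity of Y -/

section Pseudoconvex

/-- The tangent-line inequality for the convex function 1/s; with s = 1 − ‖z‖² it supplies harmonic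
minorants. -/
lemma inv_add_le_inv_of_pos {s s₀ : ℝ} (hs : 0 < s) (hs₀ : 0 < s₀) :
    s₀⁻¹ + (s₀ - s) / s₀ ^ 2 ≤ s⁻¹ := by
  have : s⁻¹ - (s₀⁻¹ + (s₀ - s) / s₀ ^ 2) = (s₀ - s) ^ 2 / (s * s₀ ^ 2) := by
    field_simp; ring
  have h2 : 0 ≤ (s₀ - s) ^ 2 / (s * s₀ ^ 2) := by positivity
  linarith

/-- The sum of `1 / (1 - ‖z‖²)` and the modulus of a holomorphic function is plurisubharmonic on
subsets of the unit ball. -/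
lemma isPSH_inv_one_sub_norm_sq_add_norm {H : Type*} [NormedAddCommGroup H] [InnerProductSpace ℂ H]
    {Y : Set H} (hY : IsOpen Y) (hYb : Y ⊆ Metric.ball 0 1) {F : H → ℂ}
    (hF : DifferentiableOn ℂ F Y) :
    ContinuousOn (fun z => (1 - ‖z‖ ^ 2)⁻¹ + ‖F z‖) Y ∧
      IsPSH Y (fun z => (((1 - ‖z‖ ^ 2)⁻¹ + ‖F z‖ : ℝ) : EReal)) := by
  have hpos : ∀ z ∈ Y, 0 < 1 - ‖z‖ ^ 2 := fun z hz => by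
    have : ‖z‖ < 1 := by simpa using hYb hz
    nlinarith [norm_nonneg z]
  have hc : ContinuousOn (fun z => (1 - ‖z‖ ^ 2)⁻¹ + ‖F z‖) Y :=
    (ContinuousOn.inv₀ (by fun_prop) fun z hz => (hpos z hz).ne').add hF.continuousOn.norm
  refine ⟨hc, (continuous_coe_real_ereal.comp_continuousOn hc).upperSemicontinuousOn,
    fun a _ => EReal.coe_lt_top _, fun p hp b => ?_⟩
  obtain ⟨u, hu1, hu⟩ : ∃ u : ℂ, ‖u‖ ≤ 1 ∧ (u * F p).re = ‖F p‖ := by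
    by_cases h0 : F p = 0
    · exact ⟨0, by simp, by simp [h0]⟩
    · have h0' : ‖F p‖ ≠ 0 := norm_ne_zero_iff.2 h0
      refine ⟨(starRingEnd ℂ) (F p) / ‖F p‖, by simp [h0'], ?_⟩
      rw [div_mul_eq_mul_div, ← Complex.normSq_eq_conj_mul_self, ← Complex.ofReal_div,
        Complex.ofReal_re, Complex.normSq_eq_norm_sq]
      field_simp
  set s₀ := 1 - ‖p‖ ^ 2 with hs₀
  -- Re Φ is a harmonic minorant touching at ζ = 0. The coefficient 2/s₀² is the slope 1/s₀² times
  -- the factor in ‖p + ζb‖² = ‖p‖² + 2 Re(ζ⟨p, b⟩) + ‖ζb‖², whose last term is dropped.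
  set Φ : ℂ → ℂ := fun ζ => ((s₀⁻¹ : ℝ) : ℂ) + ζ * (((2 / s₀ ^ 2 : ℝ) : ℂ) * inner ℂ p b) +
    u * F (p + ζ • b) with hΦ
  have hline : Continuous fun ζ : ℂ => p + ζ • b := by fun_prop
  have hmem : {ζ : ℂ | p + ζ • b ∈ Y} ∈ 𝓝 (0 : ℂ) :=
    (hY.preimage hline).mem_nhds (by simpa using hp)
  have hΦa : AnalyticAt ℂ Φ 0 := by
    refine DifferentiableOn.analyticAt (s := {ζ : ℂ | p + ζ • b ∈ Y}) ?_ hmem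
    have : DifferentiableOn ℂ (fun ζ : ℂ => F (p + ζ • b)) {ζ : ℂ | p + ζ • b ∈ Y} :=
      hF.comp (Differentiable.differentiableOn (by fun_prop)) fun ζ hζ => hζ
    exact DifferentiableOn.add (Differentiable.differentiableOn (by fun_prop)) (this.const_mul u)
  refine eventually_le_circleMean_of_harmonicAt
    (u := fun z => (((1 - ‖z‖ ^ 2)⁻¹ + ‖F z‖ : ℝ) : EReal)) (h := fun ζ => (Φ ζ).re)
    hΦa.harmonicAt_re ?_ ?_
  · rw [EReal.coe_le_coe_iff]
    simp only [hΦ, zero_mul, add_zero, zero_smul, Complex.add_re, Complex.ofReal_re, hu]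
    rfl
  · filter_upwards [hmem] with ζ hζ
    rw [EReal.coe_le_coe_iff]
    have h1 := inv_add_le_inv_of_pos (hpos _ hζ) (hpos p hp)
    have h2 : (u * F (p + ζ • b)).re ≤ ‖F (p + ζ • b)‖ := by
      refine (Complex.re_le_norm _).trans ?_
      rw [norm_mul]
      exact mul_le_of_le_one_left (norm_nonneg _) hu1
    have h3 : (ζ * (((2 / s₀ ^ 2 : ℝ) : ℂ) * inner ℂ p b)).re ≤
        (s₀ - (1 - ‖p + ζ • b‖ ^ 2)) / s₀ ^ 2 := by
      rw [mul_left_comm, Complex.re_ofReal_mul, div_mul_eq_mul_div]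
      have h4 := norm_add_sq (𝕜 := ℂ) p (ζ • b)
      rw [inner_smul_right] at h4
      have h5 : RCLike.re (ζ * inner ℂ p b) = (ζ * inner ℂ p b).re := rfl
      rw [h5] at h4
      gcongr
      nlinarith [sq_nonneg ‖ζ • b‖]
    simp only [hΦ, Complex.add_re, Complex.ofReal_re]
    linarith

/-- Clearing denominators describes sublevel sets by closed conditions on the closed ball. The last
two conditions exclude s = 0 and n = 0; the first alone holds at s = n = 0. -/
lemma inv_add_inv_le_iff_mul_le {s n t : ℝ} (hs0 : 0 ≤ s) (hn0 : 0 ≤ n) :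
    (0 < s ∧ 0 < n ∧ s⁻¹ + n⁻¹ ≤ t) ↔ (n + s ≤ t * (s * n) ∧ 1 ≤ t * s ∧ 1 ≤ t * n) := by
  constructor
  · rintro ⟨hs, hn, h⟩
    have hs' : 0 < s⁻¹ := inv_pos.2 hs
    have hn' : 0 < n⁻¹ := inv_pos.2 hn
    refine ⟨?_, ?_, ?_⟩
    · have := mul_le_mul_of_nonneg_right h (mul_pos hs hn).le
      have e : (s⁻¹ + n⁻¹) * (s * n) = n + s := by field_simp
      linarith
    · have := mul_le_mul_of_nonneg_right (show s⁻¹ ≤ t by linarith) hs.le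
      rwa [inv_mul_cancel₀ hs.ne'] at this
    · have := mul_le_mul_of_nonneg_right (show n⁻¹ ≤ t by linarith) hn.le
      rwa [inv_mul_cancel₀ hn.ne'] at this
  · rintro ⟨h1, h2, h3⟩
    have hs : 0 < s := lt_of_le_of_ne hs0 fun h => by rw [← h, mul_zero] at h2; linarith
    have hn : 0 < n := lt_of_le_of_ne hn0 fun h => by rw [← h, mul_zero] at h3; linarith
    have e : s⁻¹ + n⁻¹ = (n + s) / (s * n) := by field_simp
    rw [e, div_le_iff₀ (mul_pos hs hn)]
    exact ⟨hs, hn, h1⟩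

lemma isPseudoconvex_ball_diff_hyperbola :
    IsPseudoconvex (Metric.ball (0 : EuclideanSpace ℂ (Fin 2)) 1 \ hyperbola) := by
  have hYo : IsOpen (Metric.ball (0 : EuclideanSpace ℂ (Fin 2)) 1 \ hyperbola) :=
    Metric.isOpen_ball.sdiff isClosed_hyperbola
  have hq : ∀ z ∈ Metric.ball (0 : EuclideanSpace ℂ (Fin 2)) 1 \ hyperbola,
      z 0 * z 1 - 1 / 4 ≠ 0 := fun z hz => sub_ne_zero.2 hz.2
  have hF : DifferentiableOn ℂ (fun z : EuclideanSpace ℂ (Fin 2) => (z 0 * z 1 - 1 / 4)⁻¹)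
      (Metric.ball (0 : EuclideanSpace ℂ (Fin 2)) 1 \ hyperbola) :=
    DifferentiableOn.inv (Differentiable.differentiableOn (by fun_prop)) hq
  obtain ⟨h1, h2⟩ := isPSH_inv_one_sub_norm_sq_add_norm hYo sdiff_subset hF
  refine ⟨hYo, fun z => (1 - ‖z‖ ^ 2)⁻¹ + ‖(z 0 * z 1 - 1 / 4)⁻¹‖, h1, h2, fun t => ?_⟩
  have hset : {z ∈ Metric.ball (0 : EuclideanSpace ℂ (Fin 2)) 1 \ hyperbola |
      (1 - ‖z‖ ^ 2)⁻¹ + ‖(z 0 * z 1 - 1 / 4)⁻¹‖ ≤ t} =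
      Metric.closedBall 0 1 ∩ ({z : EuclideanSpace ℂ (Fin 2) |
        ‖z 0 * z 1 - 1 / 4‖ + (1 - ‖z‖ ^ 2) ≤ t * ((1 - ‖z‖ ^ 2) * ‖z 0 * z 1 - 1 / 4‖)} ∩
        ({z : EuclideanSpace ℂ (Fin 2) | 1 ≤ t * (1 - ‖z‖ ^ 2)} ∩
        {z : EuclideanSpace ℂ (Fin 2) | 1 ≤ t * ‖z 0 * z 1 - 1 / 4‖})) := by
    ext z
    constructor
    · rintro ⟨hz, hzt⟩
      have hz1 : ‖z‖ < 1 := by simpa using hz.1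
      have hs : 0 < 1 - ‖z‖ ^ 2 := by nlinarith [norm_nonneg z]
      have hn : 0 < ‖z 0 * z 1 - 1 / 4‖ := norm_pos_iff.2 (hq z hz)
      rw [norm_inv] at hzt
      exact ⟨by simpa using hz1.le, (inv_add_inv_le_iff_mul_le hs.le hn.le).1 ⟨hs, hn, hzt⟩⟩
    · rintro ⟨hz, hz1⟩
      have hzn : ‖z‖ ≤ 1 := by simpa using hz
      have hs0 : 0 ≤ 1 - ‖z‖ ^ 2 := by nlinarith [norm_nonneg z]
      obtain ⟨hs, hn, hle⟩ := (inv_add_inv_le_iff_mul_le hs0 (norm_nonneg _)).2 hz1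
      refine ⟨⟨?_, fun h => ?_⟩, ?_⟩
      · rw [mem_ball_zero_iff]; nlinarith [norm_nonneg z]
      · exact norm_pos_iff.1 hn (sub_eq_zero.2 h)
      · rw [norm_inv]; exact hle
  rw [hset]
  refine (isCompact_closedBall 0 1).inter_right ?_
  refine IsClosed.inter ?_ (IsClosed.inter ?_ ?_)
  all_goals exact isClosed_le (by fun_prop) (by fun_prop)

end Pseudoconvex

/-! ### The Carathéodory distance to the boundary -/

section Boundary

lemma continuousAt_artanh {x : ℝ} (hx : x ∈ Ioo (-1) 1) : ContinuousAt Real.artanh x := by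
  unfold Real.artanh
  have h1 : 0 < 1 - x := by linarith [hx.2]
  have h2 : 0 < 1 + x := by linarith [hx.1]
  have h3 : ContinuousAt (fun x : ℝ => (1 + x) / (1 - x)) x :=
    ContinuousAt.div (by fun_prop) (by fun_prop) h1.ne'
  exact h3.sqrt.log (Real.sqrt_pos.2 (div_pos h2 h1)).ne'

variable {H : Type*} [NormedAddCommGroup H] [InnerProductSpace ℂ H] [Nontrivial H]

lemma continuousAt_caratheodoryDist_ball {a y : H} (ha : ‖a‖ < 1) (hy : ‖y‖ < 1) :
    ContinuousAt (fun x => caratheodoryDist (Metric.ball 0 1) y x) a := by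
  have h1 : ContinuousAt (fun x => ENNReal.ofReal (Real.artanh ‖ballMoebius y x‖)) a := by
    refine ENNReal.continuous_ofReal.continuousAt.comp ?_
    have h2 : ContinuousAt (fun x => ‖ballMoebius y x‖) a :=
      ((differentiableOn_ballMoebius hy.le).continuousOn.continuousAt
        (Metric.isOpen_ball.mem_nhds (by simpa using ha))).norm
    exact ContinuousAt.comp (f := fun x => ‖ballMoebius y x‖) (g := Real.artanh)
      (continuousAt_artanh ⟨by linarith [norm_nonneg (ballMoebius y a)],
        norm_ballMoebius_lt_one hy ha⟩) h2
  refine h1.congr ?_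
  filter_upwards [Metric.isOpen_ball.mem_nhds (show a ∈ Metric.ball 0 1 by simpa using ha)] with x hx
  have hx' : ‖x‖ < 1 := by simpa using hx
  rw [caratheodoryDist_ball hx' hy, norm_ballMoebius_comm hy hx']

/-- The distance blows up because 1 − ‖φ_y(x)‖² ≤ (1 − ‖x‖²)/(1 − ‖y‖)², which tends to 0. -/
lemma tendsto_caratheodoryDist_ball_top {p y : H} (hp : ‖p‖ = 1) (hy : ‖y‖ < 1) :
    Tendsto (fun x => caratheodoryDist (Metric.ball 0 1) y x) (𝓝[Metric.ball 0 1] p) (𝓝 ⊤) := by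
  rw [ENNReal.tendsto_nhds_top_iff_nat]
  intro n
  have hlim : Tendsto (fun x : H => 1 - (1 - ‖x‖ ^ 2) / (1 - ‖y‖) ^ 2) (𝓝[Metric.ball 0 1] p) (𝓝 1) := by
    have : Tendsto (fun x : H => 1 - (1 - ‖x‖ ^ 2) / (1 - ‖y‖) ^ 2) (𝓝 p)
      (𝓝 (1 - (1 - ‖p‖ ^ 2) / (1 - ‖y‖) ^ 2)) := Continuous.tendsto (by fun_prop) p
    simp only [hp, one_pow, sub_self, zero_div, sub_zero] at this
    exact this.mono_left nhdsWithin_le_nhds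
  have ht : Real.tanh (n + 1) ^ 2 < 1 := by
    rw [sq_lt_one_iff_abs_lt_one]; exact Real.abs_tanh_lt_one _
  filter_upwards [hlim.eventually_const_lt ht, self_mem_nhdsWithin] with x hx hxb
  have hx1 : ‖x‖ < 1 := by simpa using hxb
  rw [caratheodoryDist_ball hx1 hy, norm_ballMoebius_comm hx1 hy]
  have h1 := one_sub_norm_ballMoebius_sq hy.le hx1
  have hy0 := norm_nonneg y
  have h2 : 1 - ‖y‖ ≤ ‖1 - inner ℂ y x‖ := by
    have h3 := norm_sub_norm_le (1 : ℂ) (inner ℂ y x)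
    have h4 := norm_inner_le_norm (𝕜 := ℂ) y x
    rw [norm_one] at h3
    nlinarith [norm_nonneg x]
  have h4 : (1 - ‖y‖ ^ 2) * (1 - ‖x‖ ^ 2) / ‖1 - inner ℂ y x‖ ^ 2 ≤
      (1 - ‖x‖ ^ 2) / (1 - ‖y‖) ^ 2 := by
    have hx2 : 0 ≤ 1 - ‖x‖ ^ 2 := by nlinarith [norm_nonneg x]
    have : 0 < 1 - ‖y‖ := by linarith
    gcongr
    nlinarith [sq_nonneg ‖y‖]
  have h5 : Real.tanh (n + 1) ^ 2 < ‖ballMoebius y x‖ ^ 2 := by linarith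
  have h6 : Real.tanh (n + 1) < ‖ballMoebius y x‖ := lt_of_pow_lt_pow_left₀ 2 (norm_nonneg _) h5
  have h7 : (n + 1 : ℝ) < Real.artanh ‖ballMoebius y x‖ := by
    rw [← Real.artanh_tanh (n + 1)]
    exact Real.artanh_lt_artanh (Real.neg_one_lt_tanh _) (norm_ballMoebius_lt_one hy hx1) h6
  rw [← ENNReal.ofReal_natCast]
  exact (ENNReal.ofReal_lt_ofReal_iff_of_nonneg (by positivity)).2 (by linarith)

/-- A boundary point of Y lies on A, where continuity makes the lower limit c_X(y, p), or on the
unit sphere, where it is infinite and does not affect the infimum. Conversely every point of A is a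
boundary point. -/
lemma caratheodoryDistBoundary_ball_diff_hyperbola {y : EuclideanSpace ℂ (Fin 2)}
    (hy : y ∈ Metric.ball 0 1 \ hyperbola) :
    caratheodoryDistBoundary (Metric.ball 0 1 \ hyperbola) y =
      caratheodoryDistSet (Metric.ball 0 1) y (hyperbola ∩ Metric.ball 0 1) := by
  have hyn : ‖y‖ < 1 := by simpa using hy.1
  have hYo : IsOpen (Metric.ball (0 : EuclideanSpace ℂ (Fin 2)) 1 \ hyperbola) :=
    Metric.isOpen_ball.sdiff isClosed_hyperbola
  have hpre : IsPreconnected (Metric.ball (0 : EuclideanSpace ℂ (Fin 2)) 1) :=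
    (convex_ball 0 1).isPreconnected
  have heq : ∀ p, ∀ᶠ x in 𝓝[Metric.ball 0 1 \ hyperbola] p,
      caratheodoryDist (Metric.ball 0 1) y x = caratheodoryDist (Metric.ball 0 1 \ hyperbola) y x :=
    fun p => by
      filter_upwards [self_mem_nhdsWithin] with x hx
      exact (caratheodoryDist_diff_hyperbola Metric.isOpen_ball hpre hy hx).symm
  have hinside : ∀ p ∈ closure (Metric.ball (0 : EuclideanSpace ℂ (Fin 2)) 1 \ hyperbola), ‖p‖ < 1 →
      liminf (fun x => caratheodoryDist (Metric.ball 0 1 \ hyperbola) y x)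
        (𝓝[Metric.ball 0 1 \ hyperbola] p) = caratheodoryDist (Metric.ball 0 1) y p := by
    intro p hp hpn
    have := mem_closure_iff_nhdsWithin_neBot.1 hp
    exact (((continuousAt_caratheodoryDist_ball hpn hyn).tendsto.mono_left
      nhdsWithin_le_nhds).congr' (heq p)).liminf_eq
  have hAcl : ∀ a ∈ hyperbola ∩ Metric.ball 0 1,
      a ∈ closure (Metric.ball (0 : EuclideanSpace ℂ (Fin 2)) 1 \ hyperbola) := by
    intro a ha
    have h1 : a ∈ closure hyperbolaᶜ :=
      mem_closure_iff_nhdsWithin_neBot.2 (neBot_nhdsWithin_compl_hyperbola a)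
    exact Metric.isOpen_ball.inter_closure ⟨ha.2, h1⟩
  refine le_antisymm ?_ ?_
  · refine le_iInf₂ fun a ha => ?_
    have hfr : a ∈ frontier (Metric.ball (0 : EuclideanSpace ℂ (Fin 2)) 1 \ hyperbola) := by
      rw [hYo.frontier_eq]
      exact ⟨hAcl a ha, fun h => h.2 ha.1⟩
    refine iInf₂_le_of_le a hfr ?_
    rw [hinside a (hAcl a ha) (by simpa using ha.2)]
  · refine le_iInf₂ fun p hp => ?_
    rw [hYo.frontier_eq] at hp
    have hpn : ‖p‖ ≤ 1 := by
      have := closure_minimal (sdiff_subset.trans Metric.ball_subset_closedBall)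
        Metric.isClosed_closedBall hp.1
      simpa using this
    rcases lt_or_eq_of_le hpn with hpn | hpn
    · have hpb : p ∈ Metric.ball (0 : EuclideanSpace ℂ (Fin 2)) 1 := by simpa using hpn
      have hpC : p ∈ hyperbola := by
        by_contra h
        exact hp.2 ⟨hpb, h⟩
      rw [hinside p hp.1 hpn]
      exact iInf₂_le p ⟨hpC, hpb⟩
    · have := mem_closure_iff_nhdsWithin_neBot.1 hp.1
      have h1 := (((tendsto_caratheodoryDist_ball_top hpn hyn).mono_left
        (nhdsWithin_mono p sdiff_subset)).congr' (heq p)).liminf_eq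
      rw [h1]
      exact le_top

end Boundary

/-! ### Failure of plurisubharmonicity and the strict inequality at 0 -/

section Curve

lemma ballMoebius_zero_right {H : Type*} [NormedAddCommGroup H] [InnerProductSpace ℂ H] (a : H) :
    ballMoebius a 0 = a := by
  simp [ballMoebius]

lemma half_le_norm_sq_of_mem_hyperbola {a : EuclideanSpace ℂ (Fin 2)} (ha : a ∈ hyperbola) :
    1 / 2 ≤ ‖a‖ ^ 2 := by
  have h1 : a 0 * a 1 = 1 / 4 := ha
  have h2 := congrArg norm h1
  rw [norm_mul] at h2
  norm_num at h2
  rw [norm_sq_eq_add]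
  nlinarith [sq_nonneg (‖a 0‖ - ‖a 1‖)]

/-- The point `½ (u, ū)` of the hyperbola with `|u| = 1` is close to `ζ (1, 0)` if `u = ζ / |ζ|`. -/
lemma exists_mem_hyperbola_norm_ballMoebius_sq {ζ : ℂ} (h0 : ζ ≠ 0) (h1 : ‖ζ‖ < 1) :
    ∃ a ∈ hyperbola ∩ Metric.ball 0 1,
      ‖ballMoebius a (ζ • EuclideanSpace.single (0 : Fin 2) (1 : ℂ))‖ ^ 2 =
        1 - (1 - ‖ζ‖ ^ 2) / 2 / (1 - ‖ζ‖ / 2) ^ 2 := by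
  have hn : ‖ζ‖ ≠ 0 := norm_ne_zero_iff.2 h0
  have hnC : (‖ζ‖ : ℂ) ≠ 0 := by exact_mod_cast hn
  set u : ℂ := ζ / ‖ζ‖ with hu
  have hu1 : ‖u‖ = 1 := by rw [hu, norm_div, Complex.norm_real, norm_norm, div_self hn]
  have huu : (starRingEnd ℂ) u * u = 1 := by
    rw [← Complex.normSq_eq_conj_mul_self, Complex.normSq_eq_norm_sq, hu1]; simp
  have huζ : (starRingEnd ℂ) u * ζ = ‖ζ‖ := by
    have : ζ = u * ‖ζ‖ := by rw [hu, div_mul_cancel₀ _ hnC]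
    calc (starRingEnd ℂ) u * ζ = (starRingEnd ℂ) u * (u * ‖ζ‖) := by rw [← this]
      _ = _ := by rw [← mul_assoc, huu, one_mul]
  -- This choice has ‖a‖² = 1/2 and makes the inner product with ζ(1, 0) equal to ‖ζ‖/2, so the
  -- value depends on ‖ζ‖ alone.
  set a : EuclideanSpace ℂ (Fin 2) := !₂[u / 2, (starRingEnd ℂ) u / 2] with ha
  have han : ‖a‖ ^ 2 = 1 / 2 := by
    rw [norm_sq_eq_add]
    simp [ha, hu1]
    norm_num
  have ha1 : ‖a‖ < 1 := by nlinarith [norm_nonneg a]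
  refine ⟨a, ⟨?_, by simpa using ha1⟩, ?_⟩
  · change a 0 * a 1 = 1 / 4
    simp only [ha, Fin.isValue, Matrix.cons_val_one, Matrix.cons_val_fin_one, Matrix.cons_val_zero]
    linear_combination huu / 4
  · have hxn : ‖ζ • EuclideanSpace.single (0 : Fin 2) (1 : ℂ)‖ = ‖ζ‖ := by simp [norm_smul]
    have h2 := one_sub_norm_ballMoebius_sq ha1.le (hxn ▸ h1)
    have hin : (inner ℂ a (ζ • EuclideanSpace.single (0 : Fin 2) (1 : ℂ)) : ℂ) =
        ((‖ζ‖ / 2 : ℝ) : ℂ) := by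
      rw [inner_smul_right, EuclideanSpace.inner_single_right]
      simp only [ha, Fin.isValue, Matrix.cons_val_zero]
      rw [map_div₀, map_ofNat]
      push_cast
      rw [← huζ]
      ring
    have h3 : ‖(1 : ℂ) - ((‖ζ‖ / 2 : ℝ) : ℂ)‖ = 1 - ‖ζ‖ / 2 := by
      rw [← Complex.ofReal_one, ← Complex.ofReal_sub, Complex.norm_real, Real.norm_of_nonneg]
      linarith
    rw [hin, h3, han, hxn] at h2
    rw [show (1 - ‖ζ‖ ^ 2) / 2 = (1 - 1 / 2) * (1 - ‖ζ‖ ^ 2) by ring]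
    linarith

/-- The logarithmic distance to the hyperbola in the ball. -/
def logDistHyperbola (x : EuclideanSpace ℂ (Fin 2)) : EReal :=
  ⨅ a ∈ hyperbola ∩ Metric.ball 0 1, ENNReal.log ‖ballMoebius a x‖ₑ

lemma le_logDistHyperbola_zero : ((Real.log (1 / 2) / 2 : ℝ) : EReal) ≤ logDistHyperbola 0 := by
  refine le_iInf₂ fun a ha => ?_
  have h1 := half_le_norm_sq_of_mem_hyperbola ha.1
  have h2 : 0 < ‖a‖ := by
    rcases (norm_nonneg a).eq_or_lt with h | h
    · rw [← h] at h1; norm_num at h1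
    · exact h
  rw [ballMoebius_zero_right, ← ofReal_norm, ENNReal.log_ofReal_of_pos h2, EReal.coe_le_coe_iff]
  have h3 := Real.log_le_log (by norm_num) h1
  rw [Real.log_pow] at h3
  push_cast at h3
  linarith

lemma logDistHyperbola_le {ζ : ℂ} (h0 : ζ ≠ 0) (h1 : ‖ζ‖ < 1) :
    logDistHyperbola (ζ • EuclideanSpace.single (0 : Fin 2) (1 : ℂ)) ≤
      ((Real.log (1 - (1 - ‖ζ‖ ^ 2) / 2 / (1 - ‖ζ‖ / 2) ^ 2) / 2 : ℝ) : EReal) := by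
  obtain ⟨a, ha, h⟩ := exists_mem_hyperbola_norm_ballMoebius_sq h0 h1
  refine iInf₂_le_of_le a ha ?_
  rw [← h]
  have hpos : 0 < ‖ballMoebius a (ζ • EuclideanSpace.single (0 : Fin 2) (1 : ℂ))‖ := by
    have h2 : 0 < ‖ballMoebius a (ζ • EuclideanSpace.single (0 : Fin 2) (1 : ℂ))‖ ^ 2 := by
      rw [h, sub_pos, div_lt_one (pow_pos (by linarith) 2)]
      nlinarith [sq_nonneg (‖ζ‖ - 2 / 3)]
    exact lt_of_le_of_ne (norm_nonneg _) fun h => by rw [← h] at h2; norm_num at h2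
  rw [← ofReal_norm, ENNReal.log_ofReal_of_pos hpos, EReal.coe_le_coe_iff, Real.log_pow]
  push_cast
  linarith

/-- The first inequality amounts to (1 − r²) − (1 − r/2)² = r − 5r²/4 > 0, whence the threshold 4/5.
The second is positivity of ¾(r − 2/3)² + 1/6. -/
lemma sub_div_lt_half {r : ℝ} (h0 : 0 < r) (h1 : r < 4 / 5) :
    1 - (1 - r ^ 2) / 2 / (1 - r / 2) ^ 2 < 1 / 2 ∧ 0 < 1 - (1 - r ^ 2) / 2 / (1 - r / 2) ^ 2 := by
  have h2 : 0 < (1 - r / 2) ^ 2 := pow_pos (by linarith) 2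
  constructor
  · rw [sub_lt_comm, lt_div_iff₀ h2]
    nlinarith
  · rw [sub_pos, div_lt_one h2]
    nlinarith [sq_nonneg (r - 2 / 3)]

/-- On every small circle about 0 in the first axis, u is at most a constant below ½ log ½ ≤ u(0).
Allowing any open S containing 0 covers both X and Y. -/
lemma not_isPSH_of_eq_logDistHyperbola {S : Set (EuclideanSpace ℂ (Fin 2))} (hS : IsOpen S)
    (h0 : (0 : EuclideanSpace ℂ (Fin 2)) ∈ S) {u : EuclideanSpace ℂ (Fin 2) → EReal}
    (hu : ∀ z ∈ S, u z = logDistHyperbola z) : ¬ IsPSH S u := by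
  intro h
  obtain ⟨s, hs, hsS⟩ := Metric.isOpen_iff.1 hS 0 h0
  obtain ⟨r, hr1, hr2, hr3⟩ := (Filter.Eventually.and (Ioo_mem_nhdsGT hs) (Filter.Eventually.and
    (Ioo_mem_nhdsGT (show (0 : ℝ) < 4 / 5 by norm_num))
    (h.2.2 0 h0 (EuclideanSpace.single (0 : Fin 2) (1 : ℂ))))).exists
  have h1 : circleMean u 0 (EuclideanSpace.single (0 : Fin 2) (1 : ℂ)) r ≤ (Real.circleAverage
      (fun _ => Real.log (1 - (1 - r ^ 2) / 2 / (1 - r / 2) ^ 2) / 2) 0 r : ℝ) := by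
    refine circleMean_le_circleAverage (by fun_prop) fun ζ hζ => ?_
    rw [mem_sphere_zero_iff_norm, abs_of_pos hr1.1] at hζ
    rw [zero_add, hu _ (hsS (by simpa [norm_smul, hζ] using hr1.2)), ← hζ]
    refine logDistHyperbola_le ?_ (by rw [hζ]; linarith [hr2.2])
    rintro rfl
    rw [norm_zero] at hζ
    exact hr1.1.ne hζ
  rw [Real.circleAverage_const] at h1
  have h2 := (le_logDistHyperbola_zero.trans_eq (hu 0 h0).symm).trans (hr3.trans h1)
  rw [EReal.coe_le_coe_iff] at h2
  obtain ⟨h3, h4⟩ := sub_div_lt_half hr2.1 hr2.2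
  have := Real.log_lt_log h4 h3
  linarith

/-- Since ν_A ≥ 1 on A, competitors for G_A compete for each G_a with a ∈ A, whence G_A ≤ inf G_a.
-/
lemma mem_greenFamily_indicator_of_mem {X A : Set (EuclideanSpace ℂ (Fin 2))} (hX : IsOpen X)
    {u : EuclideanSpace ℂ (Fin 2) → EReal} (hu : u ∈ greenFamily X (multiplicityAlong A))
    {a : EuclideanSpace ℂ (Fin 2)} (haX : a ∈ X) (ha : a ∈ A) :
    u ∈ greenFamily X (({a} : Set (EuclideanSpace ℂ (Fin 2))).indicator fun _ => 1) := by
  refine ⟨hu.1, hu.2.1, fun b hb => ?_⟩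
  by_cases hba : b = a
  · subst hba
    simp only [mem_singleton_iff, indicator_of_mem]
    exact (one_le_multiplicityAlong ha).trans (hu.2.2 b haX)
  · rw [indicator_of_notMem (by simpa using hba)]
    exact lelongNumber_nonneg (mem_of_superset (hX.mem_nhds hb) hu.2.1)

lemma iInf_greenPoint_eq {x : EuclideanSpace ℂ (Fin 2)} (hx : x ∈ Metric.ball 0 1) :
    (⨅ a ∈ hyperbola ∩ Metric.ball 0 1, greenPoint (Metric.ball 0 1) a x) = logDistHyperbola x :=
  biInf_congr fun a ha => greenPoint_ball (by simpa using ha.2) (by simpa using hx)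

/-- The Green function along the hyperbola is smaller than the logarithmic distance at `0`. -/
lemma greenAlong_hyperbola_zero_lt :
    greenAlong (Metric.ball 0 1) (hyperbola ∩ Metric.ball 0 1) 0 < logDistHyperbola 0 := by
  -- The value 1/3 is 1 − (1 − r²)/2/(1 − r/2)² at r = 1/2.
  have h3 : Real.log (1 / 3) / 2 < Real.log (1 / 2) / 2 := by
    have := Real.log_lt_log (by norm_num) (show (1 / 3 : ℝ) < 1 / 2 by norm_num)
    linarith
  refine lt_of_le_of_lt ?_ (lt_of_lt_of_le (EReal.coe_lt_coe_iff.2 h3) le_logDistHyperbola_zero)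
  refine iSup₂_le fun u hu => ?_
  have huD : ∀ x ∈ Metric.ball (0 : EuclideanSpace ℂ (Fin 2)) 1, u x ≤ logDistHyperbola x := by
    intro x hx
    rw [← iInf_greenPoint_eq hx]
    refine le_iInf₂ fun a ha => ?_
    exact le_iSup₂_of_le (f := fun (u : EuclideanSpace ℂ (Fin 2) → EReal) (_ : u ∈ greenFamily
      (Metric.ball 0 1) (({a} : Set (EuclideanSpace ℂ (Fin 2))).indicator fun _ => 1)) => u x) u
      (mem_greenFamily_indicator_of_mem Metric.isOpen_ball hu ha.2 ha) le_rfl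
  have hline := hu.1.comp_line 0 (EuclideanSpace.single (0 : Fin 2) (1 : ℂ))
  have hK : Metric.closedBall (0 : ℂ) (1 / 2) ⊆
      {z : ℂ | 0 + z • EuclideanSpace.single (0 : Fin 2) (1 : ℂ) ∈ Metric.ball 0 1} := by
    intro z hz
    have hz' : ‖z‖ ≤ 1 / 2 := by simpa using hz
    change 0 + z • EuclideanSpace.single (0 : Fin 2) (1 : ℂ) ∈ Metric.ball 0 1
    rw [zero_add, mem_ball_zero_iff]
    simp [norm_smul]
    linarith
  -- Maximum principle on the disc of radius 1/2 in the first axis, with a constant majorant.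
  have key := le_of_boundary_le_of_submean (isCompact_closedBall (0 : ℂ) (1 / 2))
    (v := fun z => u (0 + z • EuclideanSpace.single (0 : Fin 2) (1 : ℂ)))
    (g := fun _ => Real.log (1 / 3) / 2) (hline.1.mono hK) (fun p hp => hline.2.1 p (hK hp))
    (by fun_prop) (fun p hp => by
      rcases eq_or_lt_of_le (mem_closedBall_zero_iff.1 hp) with hpn | hpn
      · left
        refine (huD _ (hK hp)).trans ?_
        rw [zero_add]
        refine (logDistHyperbola_le ?_ ?_).trans ?_
        · rintro rfl; norm_num at hpn
        · rw [hpn]; norm_num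
        · rw [hpn]; norm_num
      · right
        refine ⟨?_, InnerProductSpace.harmonicAt_const _, hline.2.2 p (hK hp) 1⟩
        rw [interior_closedBall _ (by norm_num)]
        simpa using hpn) 0 (by simp)
  simpa using key

end Curve

end

/-! ### Assembly -/

theorem mainTheorem6 :
    ∃ C X A Y : Set (EuclideanSpace ℂ (Fin 2)),
      IsSmoothCurve C ∧ X = Metric.ball 0 1 ∧ A = C ∩ X ∧ Y = X \ A ∧ IsConnected A ∧
      -- the Green function along the curve is not the infimum of those with poles on it
      (∃ x ∈ X, greenAlong X A x ≠ ⨅ a ∈ A, greenPoint X a x) ∧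
      -- four functions agree on the ball, and none of them is plurisubharmonic
      (∀ x ∈ X, (⨅ a ∈ A, greenPoint X a x) = kAlong X A x ∧
        (⨅ a ∈ A, greenPoint X a x) = logTanh (caratheodoryDistSet X x A) ∧
        (⨅ a ∈ A, greenPoint X a x) = logTanh (kobayashiDistSet X x A)) ∧
      ¬ IsPSH X (fun x => ⨅ a ∈ A, greenPoint X a x) ∧
      ¬ IsPSH X (kAlong X A) ∧
      ¬ IsPSH X (fun x => logTanh (caratheodoryDistSet X x A)) ∧
      ¬ IsPSH X (fun x => logTanh (kobayashiDistSet X x A)) ∧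
      -- domination holds for single poles and fails along the curve
      (∀ a ∈ X, ∀ x ∈ X, logTanh (caratheodoryDist X x a) ≤ greenPoint X a x) ∧
      (¬ ∀ x ∈ X, logTanh (caratheodoryDistSet X x A) ≤ greenAlong X A x) ∧
      -- the complement of the curve in the ball
      IsOpen Y ∧ IsConnected Y ∧ Bornology.IsBounded Y ∧ IsPseudoconvex Y ∧
      (∀ x ∈ Y, ∀ y ∈ Y, caratheodoryDist Y x y = caratheodoryDist X x y) ∧
      (∀ y ∈ Y, caratheodoryDistBoundary Y y = caratheodoryDistSet X y A) ∧
      ¬ IsPSH Y (fun y => logTanh (caratheodoryDistBoundary Y y)) := by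
  have hYeq : (Metric.ball 0 1 : Set (EuclideanSpace ℂ (Fin 2))) \
      (hyperbola ∩ Metric.ball 0 1) = Metric.ball 0 1 \ hyperbola := by
    ext z
    constructor
    · exact fun h => ⟨h.1, fun hC => h.2 ⟨hC, h.1⟩⟩
    · exact fun h => ⟨h.1, fun hC => h.2 hC.1⟩
  have hbn : ∀ x ∈ (Metric.ball 0 1 : Set (EuclideanSpace ℂ (Fin 2))), ‖x‖ < 1 := fun x hx => by
    simpa using hx
  have h0X : (0 : EuclideanSpace ℂ (Fin 2)) ∈ Metric.ball (0 : EuclideanSpace ℂ (Fin 2)) 1 := by simp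
  have h0C : (0 : EuclideanSpace ℂ (Fin 2)) ∉ hyperbola := fun h =>
    (ne_zero_of_mem_hyperbola h).1 rfl
  have hYo : IsOpen (Metric.ball (0 : EuclideanSpace ℂ (Fin 2)) 1 \ hyperbola) :=
    Metric.isOpen_ball.sdiff isClosed_hyperbola
  have hlog : ∀ a ∈ (Metric.ball 0 1 : Set (EuclideanSpace ℂ (Fin 2))),
      ∀ x ∈ (Metric.ball 0 1 : Set (EuclideanSpace ℂ (Fin 2))),
      logTanh (ENNReal.ofReal (Real.artanh ‖ballMoebius a x‖)) = ENNReal.log ‖ballMoebius a x‖ₑ :=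
    fun a ha x hx => by
      rw [logTanh_ofReal_artanh (norm_nonneg _) (norm_ballMoebius_lt_one (hbn a ha) (hbn x hx)),
        ofReal_norm]
  have hc : ∀ x ∈ (Metric.ball 0 1 : Set (EuclideanSpace ℂ (Fin 2))), logTanh (caratheodoryDistSet
      (Metric.ball 0 1) x (hyperbola ∩ Metric.ball 0 1)) = logDistHyperbola x := by
    intro x hx
    rw [caratheodoryDistSet, logTanh_iInf₂ isConnected_hyperbola_inter_ball.nonempty]
    · refine biInf_congr fun a ha => ?_
      rw [caratheodoryDist_ball (hbn a ha.2) (hbn x hx), hlog a ha.2 x hx]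
    · intro a ha
      rw [caratheodoryDist_ball (hbn a ha.2) (hbn x hx)]
      exact ENNReal.ofReal_ne_top
  have hkob : ∀ x ∈ (Metric.ball 0 1 : Set (EuclideanSpace ℂ (Fin 2))), logTanh (kobayashiDistSet
      (Metric.ball 0 1) x (hyperbola ∩ Metric.ball 0 1)) = logDistHyperbola x := by
    intro x hx
    rw [kobayashiDistSet, logTanh_iInf₂ isConnected_hyperbola_inter_ball.nonempty]
    · refine biInf_congr fun a ha => ?_
      rw [kobayashiDist_ball (hbn a ha.2) (hbn x hx), hlog a ha.2 x hx]
    · intro a ha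
      rw [kobayashiDist_ball (hbn a ha.2) (hbn x hx)]
      exact ENNReal.ofReal_ne_top
  have hkF : ∀ a ∈ (Metric.ball 0 1 : Set (EuclideanSpace ℂ (Fin 2))),
      ∀ x ∈ (Metric.ball 0 1 : Set (EuclideanSpace ℂ (Fin 2))),
      kFun (Metric.ball 0 1) x a = ENNReal.log ‖ballMoebius a x‖ₑ := fun a ha x hx => by
    rw [kFun, discDelta_ball (hbn a ha) (hbn x hx), hlog a ha x hx]
  have hneg : ∀ a ∈ (Metric.ball 0 1 : Set (EuclideanSpace ℂ (Fin 2))),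
      ∀ x ∈ (Metric.ball 0 1 : Set (EuclideanSpace ℂ (Fin 2))),
      ENNReal.log ‖ballMoebius a x‖ₑ ≤ 0 := fun a ha x hx => by
    rw [ENNReal.log_le_zero_iff, ← ofReal_norm, ENNReal.ofReal_le_one]
    exact (norm_ballMoebius_lt_one (hbn a ha) (hbn x hx)).le
  have hk : ∀ x ∈ (Metric.ball 0 1 : Set (EuclideanSpace ℂ (Fin 2))),
      kAlong (Metric.ball 0 1) (hyperbola ∩ Metric.ball 0 1) x = logDistHyperbola x := by
    intro x hx
    refine le_antisymm (le_iInf₂ fun a ha => ?_) (le_iInf₂ fun a ha => ?_)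
    · refine iInf₂_le_of_le a ha.2 ?_
      rw [multiplicityAlong_hyperbola Metric.isOpen_ball ha, one_mul, hkF a ha.2 x hx]
    · by_cases haC : a ∈ hyperbola
      · rw [multiplicityAlong_hyperbola Metric.isOpen_ball ⟨haC, ha⟩, one_mul, hkF a ha x hx]
        exact iInf₂_le a ⟨haC, ha⟩
      · have h1 : multiplicityAlong (hyperbola ∩ Metric.ball 0 1) a ≤ 0 :=
          multiplicityAlong_nonpos (mem_of_superset (isClosed_hyperbola.isOpen_compl.mem_nhds haC)
            fun z hz hzA => hz hzA.1)
        obtain ⟨b, hb⟩ := isConnected_hyperbola_inter_ball.nonempty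
        have h2 : logDistHyperbola x ≤ 0 := (iInf₂_le b hb).trans (hneg b hb.2 x hx)
        refine h2.trans ?_
        rw [hkF a ha x hx]
        -- Off the curve the term is a product of two nonpositive factors, hence nonnegative, and
        -- cannot lower the infimum. This includes a = x, where k is `-∞`, because 0 · (−∞) = 0 in
        -- `EReal`.
        rw [← neg_mul_neg]
        exact mul_nonneg (EReal.neg_nonneg.2 h1) (EReal.neg_nonneg.2 (hneg a ha x hx))
  refine ⟨hyperbola, Metric.ball 0 1, hyperbola ∩ Metric.ball 0 1, Metric.ball 0 1 \ hyperbola,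
    isSmoothCurve_hyperbola, rfl, rfl, hYeq.symm, isConnected_hyperbola_inter_ball,
    ⟨0, h0X, ?_⟩, fun x hx => ?_, ?_, ?_, ?_, ?_, ?_, ?_, hYo, isConnected_ball_diff_hyperbola,
    Metric.isBounded_ball.subset sdiff_subset, isPseudoconvex_ball_diff_hyperbola,
    fun x hx y hy => caratheodoryDist_diff_hyperbola Metric.isOpen_ball
      (convex_ball 0 1).isPreconnected hx hy,
    fun y hy => caratheodoryDistBoundary_ball_diff_hyperbola hy, ?_⟩
  · rw [iInf_greenPoint_eq h0X]
    exact greenAlong_hyperbola_zero_lt.ne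
  · rw [iInf_greenPoint_eq hx, hk x hx, hc x hx, hkob x hx]
    exact ⟨rfl, rfl, rfl⟩
  · exact not_isPSH_of_eq_logDistHyperbola Metric.isOpen_ball h0X fun z hz => iInf_greenPoint_eq hz
  · exact not_isPSH_of_eq_logDistHyperbola Metric.isOpen_ball h0X hk
  · exact not_isPSH_of_eq_logDistHyperbola Metric.isOpen_ball h0X hc
  · exact not_isPSH_of_eq_logDistHyperbola Metric.isOpen_ball h0X hkob
  · intro a ha x hx
    rw [caratheodoryDist_ball (hbn a ha) (hbn x hx), hlog a ha x hx,
      greenPoint_ball (hbn a ha) (hbn x hx)]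
  · intro h
    have h1 := h 0 h0X
    rw [hc 0 h0X] at h1
    exact absurd greenAlong_hyperbola_zero_lt (not_lt.2 h1)
  · refine not_isPSH_of_eq_logDistHyperbola hYo ⟨h0X, h0C⟩ fun z hz => ?_
    rw [caratheodoryDistBoundary_ball_diff_hyperbola hz, hc z hz.1]
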